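/- **Setting.** Fix an integer $k\ge 1$ and let $\mathbb S_k=\mathbb Z^2\times\{0,\dots,k\}$, viewed as a graph with an edge between any two vertices at Euclidean distance $1$. Under $\mathbf P_p$ each edge is open with probability $p$ and closed with probability $1-p$, independently. For $T\subset\mathbb Z^2$ write $\overline T=T\times\{0,\dots,k\}$. For $x,y\in\mathbb S_k$ let $\mathrm{dist}^*(x,y)=\max\{|x_1-y_1|,|x_2-y_2|\}$ be the sup-norm distance of their projections on $\mathbb Z^2$. For $U\subset\mathbb S_k$ let $\partial U$ be the set of vertices of $U$ that have a neighbor in $\mathbb S_k\setminus U$. Write $X\overset{U}{\longleftrightarrow}Y$ for the event that some path of open edges in $U$ connects $X\cap U$ to $Y\cap U$. Order the vertices of $\mathbb S_k$ by their Euclidean norm, ties being broken by the lexicographic order of the coordinates, and order self-avoiding paths by the induced lexicographic order. Let $\Gamma=\Gamma^S_{\min}(A,B)$ be the minimal open self-avoiding path in $S$ from $A$ to $B$, with $\Gamma=\emptyset$ if there is none, and let $\mathcal N(\overline\Gamma,r)=\{x\in S:\mathrm{dist}^*(x,y)\le r\text{ for some }y\in\Gamma\}$. **Theorem 3.5 (main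 gluing lemma for paths).** Fix integers $k\ge1$ and $r\ge3$, and $\varepsilon>0$. There exist a continuous, strictly increasing function $\mathsf h_0:[0,1]\to[0,1]$ with $\mathsf h_0(0)=0$ and $\mathsf h_0(1)=1$, and a constant $c_0>0$ with $\mathsf h_0(x)\ge c_0x$ for all $x\in[0,1]$, both depending only on $k$, $r$ and $\varepsilon$, such that the following holds. Let $S\subset R$ be two subsets of $\mathbb S_k$, each of the form $\overline{[a,b]\times[c,d]}$ with integers $a,b,c,d$ such that $b-a\ge r+2$ and $d-c\ge r+2$. Let $A,B\subset\partial S$ and $C\subset\partial R$ be such that the projections of $A,B,C$ on $\mathbb Z^2$ are at sup-norm distance at least $r+2$ from each other. Then for every $p\in[\varepsilon,1-\varepsilon]$, $$\mathbf P_p\big[C\overset{R}{\longleftrightarrow}A\big]\ \ge\ \mathsf h_0\Big(\mathbf P_p\big[C\overset{R}{\longleftrightarrow}\mathcal N(\overline\Gamma,r)\big]\Big).$$ -/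

import Mathlib

namespace SlabPercolation

/-- Vertices `(x₁, x₂, x₃)` of the slab `ℤ² × {0, …, k}`. -/
abbrev Vertex (k : ℕ) : Type := ℤ × ℤ × Fin (k + 1)

/-- The third coordinate of a vertex, as an integer. -/
def height {k : ℕ} (x : Vertex k) : ℤ := (x.2.2 : ℕ)

/-- The slab as a graph: two vertices are adjacent iff their Euclidean distance is `1`. -/
def slab (k : ℕ) : SimpleGraph (Vertex k) where
  Adj x y := (x.1 - y.1) ^ 2 + (x.2.1 - y.2.1) ^ 2 + (height x - height y) ^ 2 = 1
  symm := ⟨fun x y h => by rw [← h]; ring⟩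
  loopless := ⟨fun x h => by simp at h⟩

/-- A bond configuration: `true` is open, `false` is closed. -/
abbrev Config (k : ℕ) : Type := (slab k).edgeSet → Bool

/-- Bernoulli bond percolation of density `p` on the slab: the product over all edges of the
law that gives mass `p` to `true` and `1 - p` to `false`. -/
noncomputable def percolation (k : ℕ) (p : unitInterval) : MeasureTheory.Measure (Config k) :=
  MeasureTheory.Measure.infinitePi
    (fun _ : (slab k).edgeSet => ProbabilityTheory.bernoulliMeasure true false p)

/-- The graph of those open edges of `ω` that have both endpoints in `S`. -/
def openGraph {k : ℕ} (ω : Config k) (S : Set (Vertex k)) : SimpleGraph (Vertex k) where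
  Adj x y := x ∈ S ∧ y ∈ S ∧ ∃ h : (slab k).Adj x y, ω ⟨s(x, y), h⟩ = true
  symm := ⟨by
    rintro x y ⟨hx, hy, h, hω⟩
    refine ⟨hy, hx, h.symm, ?_⟩
    rw [← hω]
    congr 2
    exact Sym2.eq_swap⟩
  loopless := ⟨fun x h => (slab k).loopless.irrefl x h.2.2.1⟩

/-- `A` and `B` are connected in `S`: there is a path of open edges in `S` from `A ∩ S` to
`B ∩ S`. -/
def Connected {k : ℕ} (ω : Config k) (S A B : Set (Vertex k)) : Prop :=
  ∃ a ∈ A ∩ S, ∃ b ∈ B ∩ S, (openGraph ω S).Reachable a b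

/-- The list of successive vertices of an open self-avoiding path in `S` from `A` to `B`. -/
def IsOpenPath {k : ℕ} (ω : Config k) (S A B : Set (Vertex k)) (γ : List (Vertex k)) : Prop :=
  ∃ a ∈ A ∩ S, ∃ b ∈ B ∩ S, ∃ w : (openGraph ω S).Walk a b, w.IsPath ∧ w.support = γ

/-- The square of the Euclidean norm of a vertex. -/
def normSq {k : ℕ} (x : Vertex k) : ℤ := x.1 ^ 2 + x.2.1 ^ 2 + height x ^ 2

/-- The ordering of the vertices: by Euclidean norm, ties being broken by the lexicographic
order of the coordinates. -/
def Precedes {k : ℕ} (x y : Vertex k) : Prop :=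
  normSq x < normSq y ∨
    normSq x = normSq y ∧
      (x.1 < y.1 ∨ x.1 = y.1 ∧ (x.2.1 < y.2.1 ∨ x.2.1 = y.2.1 ∧ height x < height y))

/-- `γ` is the minimal open self-avoiding path in `S` from `A` to `B`, for the lexicographic
order on paths induced by `Precedes`. -/
def IsMinimalOpenPath {k : ℕ} (ω : Config k) (S A B : Set (Vertex k))
    (γ : List (Vertex k)) : Prop :=
  IsOpenPath ω S A B γ ∧
    ∀ γ' : List (Vertex k), IsOpenPath ω S A B γ' → γ' = γ ∨ List.Lex Precedes γ γ'

/-- The set of vertices of the minimal open self-avoiding path in `S` from `A` to `B`. It is empty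
if there is no open path from `A` to `B` in `S`. -/
def minimalPath {k : ℕ} (ω : Config k) (S A B : Set (Vertex k)) : Set (Vertex k) :=
  {x | ∃ γ : List (Vertex k), IsMinimalOpenPath ω S A B γ ∧ x ∈ γ}

/-- Sup-norm distance of the projections of two vertices on `ℤ²`. -/
def distStar {k : ℕ} (x y : Vertex k) : ℤ := max |x.1 - y.1| |x.2.1 - y.2.1|

/-- The vertices of `S` whose projection is at sup-norm distance at most `r` from the projection
of some vertex of `Γ`. -/
def neighborhood {k : ℕ} (S Γ : Set (Vertex k)) (r : ℕ) : Set (Vertex k) :=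
  {x | x ∈ S ∧ ∃ y ∈ Γ, distStar x y ≤ r}

/-- The projections of `U` and `V` on `ℤ²` are at sup-norm distance at least `m`. -/
def FarApart {k : ℕ} (m : ℕ) (U V : Set (Vertex k)) : Prop :=
  ∀ x ∈ U, ∀ y ∈ V, (m : ℤ) ≤ distStar x y

/-- The rectangular region `([a, b] × [c, d]) × {0, …, k}`. -/
def box (k : ℕ) (a b c d : ℤ) : Set (Vertex k) :=
  {x | (a ≤ x.1 ∧ x.1 ≤ b) ∧ (c ≤ x.2.1 ∧ x.2.1 ≤ d)}

/-- The region `S` is a rectangular region whose two sides have length at least `m`. -/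
def IsBox (k m : ℕ) (S : Set (Vertex k)) : Prop :=
  ∃ a b c d : ℤ, (m : ℤ) ≤ b - a ∧ (m : ℤ) ≤ d - c ∧ S = box k a b c d

/-- The vertex boundary: vertices of `U` with a neighbour in the slab outside `U`. -/
def vertexBoundary {k : ℕ} (U : Set (Vertex k)) : Set (Vertex k) :=
  {x | x ∈ U ∧ ∃ y, y ∉ U ∧ (slab k).Adj x y}

/-- Continuous strictly increasing functions from `[0, 1]` onto `[0, 1]`, represented by
real functions of which only the values on `[0, 1]` matter. -/
structure IsGluingFunction (h : ℝ → ℝ) : Prop where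
  continuousOn : ContinuousOn h (Set.Icc 0 1)
  strictMonoOn : StrictMonoOn h (Set.Icc 0 1)
  map_zero : h 0 = 0
  map_one : h 1 = 1

end SlabPercolation

namespace SlabPercolation

/-! Write `q` for the probability that `C` is joined to `A` and `x` for the probability that `C` is
joined to the `r`-neighbourhood of the minimal path Γ. Two inequalities carry the theorem: `x ≤ (1 +
M) q`, and `1 - q ≤ η + K η (1 - x)` for each `η > 0`, with `M` and `K` depending on `k`, `r`, `ε`
only. The gluing function is the supremum of lower bounds of this kind (`exists_isGluingFunction`).

Both inequalities come from finite-energy surgery: if each configuration of an event can be altered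
in `t` ways on boundedly many edges, and the place of the alteration can be read off the result up
to boundedly many choices, then the event is at most a constant over `t` times as likely as its
image (`mul_real_le_of_modification`). A contact is a vertex of `C` near the cluster of `A`, or a
vertex of the cluster of `C` near Γ. When `C` is not joined to `A`, a surgery near any contact joins
them and leaves a trace of its location (`exists_modification`, `ncard_traces_le`). So having at
least `t` contacts and no connection has probability at most `(M / t) q`; `t = 1` gives the first
inequality.

When there are fewer than `t` contacts, a bounded number of closings separates the cluster of `A`
from the vicinity of `C` (`mul_real_separate_le`), and then the cluster of `C` from the vicinity of
Γ (`mul_real_separate_path_le`). Using the bound on many contacts before each of the two closings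
gives the second inequality.

The delicate surgery is at a contact with Γ away from `A` (`exists_detour`). Its trace is the place
where `C` attaches to the minimal path, but the surgery may itself change that path. Therefore the
new route is arranged so that at the junction the step along the path precedes the step into the
branch to `C`, unless the branch leaves `S` or the path ends there. Then the new minimal path
follows the old one up to the modified region `D`, traverses the prescribed route and never returns
to `D`, and every attachment lies in `D` (`IsDetour.attachSet_subset`). If a direct junction has the
wrong order, path and branch are rerouted inside a 3 × 3 × 2 block, where a finite check provides
tripods with either order at the junction (`exists_isTripod`). -/

variable {k : ℕ}

/-! ### Open chains and clusters -/

/-- The edge between `x` and `y` is present in the slab and open. -/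
def OpenEdge (ω : Config k) (x y : Vertex k) : Prop :=
  ∃ h : (slab k).Adj x y, ω ⟨s(x, y), h⟩ = true

theorem OpenEdge.symm {ω : Config k} {x y : Vertex k} (h : OpenEdge ω x y) : OpenEdge ω y x := by
  obtain ⟨h, hω⟩ := h
  refine ⟨h.symm, ?_⟩
  rw [← hω]
  congr 2
  exact Sym2.eq_swap

/-- `γ` is a list of vertices of `S` that leads from `A` to `B`, successive vertices being joined
by open edges. -/
structure IsOpenChain (ω : Config k) (S A B : Set (Vertex k)) (γ : List (Vertex k)) : Prop where
  ne_nil : γ ≠ []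
  head : ∀ a ∈ γ.head?, a ∈ A
  last : ∀ b ∈ γ.getLast?, b ∈ B
  subset : ∀ v ∈ γ, v ∈ S
  chain : γ.IsChain (OpenEdge ω)

/-- Walks are traded for lists of vertices, so that cutting and splicing paths becomes list surgery.
-/
theorem isOpenPath_iff {ω : Config k} {S A B : Set (Vertex k)} {γ : List (Vertex k)} :
    IsOpenPath ω S A B γ ↔ IsOpenChain ω S A B γ ∧ γ.Nodup := by
  constructor
  · rintro ⟨a, ha, b, hb, w, hw, rfl⟩
    refine ⟨⟨w.support_ne_nil, ?_, ?_, ?_, ?_⟩, hw.support_nodup⟩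
    · intro x hx
      rw [List.head?_eq_some_head w.support_ne_nil, w.head_support] at hx
      cases hx
      exact ha.1
    · intro x hx
      rw [List.getLast?_eq_some_getLast w.support_ne_nil, w.getLast_support] at hx
      cases hx
      exact hb.1
    · intro v hv
      by_cases h : w.Nil
      · rw [SimpleGraph.Walk.nil_iff_support_eq.1 h, List.mem_singleton] at hv
        exact hv ▸ ha.2
      · obtain ⟨e, he, hve⟩ := (SimpleGraph.Walk.mem_support_iff_exists_mem_edges_of_not_nil h).1 hv
        induction e with
        | h x y =>
          have := w.adj_of_mem_edges he
          rcases Sym2.mem_iff.1 hve with rfl | rfl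
          exacts [this.1, this.2.1]
    · exact w.isChain_adj_support.imp fun _ _ h => h.2.2
  · rintro ⟨h, hnd⟩
    have hc : γ.IsChain (openGraph ω S).Adj :=
      h.chain.imp_of_mem_imp fun x y hx hy hxy => ⟨h.subset x hx, h.subset y hy, hxy⟩
    refine ⟨γ.head h.ne_nil, ⟨h.head _ (List.head?_eq_some_head _), h.subset _ (List.head_mem _)⟩,
      γ.getLast h.ne_nil, ⟨h.last _ (List.getLast?_eq_some_getLast _),
        h.subset _ (List.getLast_mem _)⟩, .ofSupport γ h.ne_nil hc, ?_, ?_⟩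
    · rw [SimpleGraph.Walk.isPath_def, SimpleGraph.Walk.support_ofSupport]
      exact hnd
    · exact SimpleGraph.Walk.support_ofSupport ..

/-- The vertices joined to `X` by an open path in `R`. -/
def cluster (ω : Config k) (R X : Set (Vertex k)) : Set (Vertex k) :=
  {v | ∃ x ∈ X ∩ R, (openGraph ω R).Reachable x v}

theorem connected_iff {ω : Config k} {R X Y : Set (Vertex k)} :
    Connected ω R X Y ↔ ∃ y ∈ Y ∩ R, y ∈ cluster ω R X := by
  constructor
  · rintro ⟨x, hx, y, hy, h⟩
    exact ⟨y, hy, x, hx, h⟩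
  · rintro ⟨y, hy, x, hx, h⟩
    exact ⟨x, hx, y, hy, h⟩

theorem Connected.symm {ω : Config k} {R X Y : Set (Vertex k)} (h : Connected ω R X Y) :
    Connected ω R Y X := by
  obtain ⟨x, hx, y, hy, h⟩ := h
  exact ⟨y, hy, x, hx, h.symm⟩

theorem subset_cluster {ω : Config k} {R X : Set (Vertex k)} {x : Vertex k} (hx : x ∈ X)
    (hR : x ∈ R) : x ∈ cluster ω R X :=
  ⟨x, ⟨hx, hR⟩, .refl _⟩

theorem cluster_step {ω : Config k} {R X : Set (Vertex k)} {x y : Vertex k}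
    (hx : x ∈ cluster ω R X) (hxy : (openGraph ω R).Adj x y) : y ∈ cluster ω R X := by
  obtain ⟨a, ha, h⟩ := hx
  exact ⟨a, ha, h.trans hxy.reachable⟩

/-- A set that contains the start of an open path and is closed under open edges contains the
end of the path. -/
theorem reachable_mem {V : Type*} {G : SimpleGraph V} {I : Set V}
    (hI : ∀ x ∈ I, ∀ y, G.Adj x y → y ∈ I) {a b : V} (ha : a ∈ I) (h : G.Reachable a b) :
    b ∈ I := by
  obtain ⟨w⟩ := h
  induction w with
  | nil => exact ha
  | cons hadj _ ih => exact ih (hI _ ha _ hadj)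

/-- The induction principle for clusters: later bounds on clusters amount to the choice of the
invariant `I`. -/
theorem cluster_subset_of_closed {ω : Config k} {R X I : Set (Vertex k)}
    (hX : ∀ x ∈ X ∩ R, x ∈ I) (hI : ∀ x ∈ I, ∀ y, (openGraph ω R).Adj x y → y ∈ I) :
    cluster ω R X ⊆ I := by
  rintro v ⟨x, hx, h⟩
  exact reachable_mem hI (hX x hx) h

theorem cluster_subset {ω : Config k} {R X : Set (Vertex k)} : cluster ω R X ⊆ R :=
  cluster_subset_of_closed (fun _ hx => hx.2) fun _ _ _ h => h.2.1

theorem cluster_mono {ω ω' : Config k} {R R' X : Set (Vertex k)} (hR : R ⊆ R')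
    (h : ∀ x y, (openGraph ω R).Adj x y → (openGraph ω' R').Adj x y) :
    cluster ω R X ⊆ cluster ω' R' X :=
  cluster_subset_of_closed (fun _ hx => subset_cluster hx.1 (hR hx.2))
    fun x hx y hxy => cluster_step hx (h x y hxy)

/-- An open chain that contains a vertex of the cluster lies in the cluster. -/
theorem chain_subset_cluster {ω : Config k} {R X : Set (Vertex k)} {l : List (Vertex k)}
    (hl : l.IsChain (OpenEdge ω)) (hR : ∀ v ∈ l, v ∈ R) {x : Vertex k} (hx : x ∈ l)
    (hxX : x ∈ cluster ω R X) : ∀ v ∈ l, v ∈ cluster ω R X := by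
  have hl' : l.IsChain (openGraph ω R).Adj :=
    hl.imp_of_mem_imp fun x y hx hy hxy => ⟨hR x hx, hR y hy, hxy⟩
  clear hl hR
  induction l generalizing x with
  | nil => simp
  | cons a l ih =>
    cases l with
    | nil => simp_all
    | cons b l =>
      obtain ⟨hab, hl⟩ := List.isChain_cons_cons.1 hl'
      rcases List.mem_cons.1 hx with rfl | hx
      · have := ih (x := b) (by simp) (cluster_step hxX hab) hl
        intro v hv
        rcases List.mem_cons.1 hv with rfl | hv
        exacts [hxX, this v hv]
      · have := ih hx hxX hl
        intro v hv
        rcases List.mem_cons.1 hv with rfl | hv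
        · exact cluster_step (this b (by simp)) hab.symm
        · exact this v hv

theorem IsOpenChain.subset_cluster {ω : Config k} {S R A B : Set (Vertex k)} {γ : List (Vertex k)}
    (h : IsOpenChain ω S A B γ) (hSR : S ⊆ R) : ∀ v ∈ γ, v ∈ cluster ω R A := by
  have hmem := List.head_mem h.ne_nil
  exact chain_subset_cluster h.chain (fun v hv => hSR (h.subset v hv)) hmem
    (SlabPercolation.subset_cluster (h.head _ (List.head?_eq_some_head _)) (hSR (h.subset _ hmem)))

/-! ### The order on vertices and paths -/

theorem precedes_irrefl (x : Vertex k) : ¬Precedes x x := by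
  simp [Precedes]

theorem precedes_trans {x y z : Vertex k} (h : Precedes x y) (h' : Precedes y z) :
    Precedes x z := by
  unfold Precedes at *
  omega

theorem precedes_trichotomous (x y : Vertex k) (h : x ≠ y) : Precedes x y ∨ Precedes y x := by
  by_contra! hc
  obtain ⟨h1, h2⟩ := hc
  unfold Precedes at h1 h2
  have h3 : x.1 = y.1 ∧ x.2.1 = y.2.1 ∧ height x = height y := by omega
  apply h
  obtain ⟨a, b, c⟩ := x
  obtain ⟨a', b', c'⟩ := y
  simp only [height, Nat.cast_inj, Fin.val_inj] at h3
  obtain ⟨rfl, rfl, rfl⟩ := h3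
  rfl

theorem precedes_asymm {x y : Vertex k} (h : Precedes x y) : ¬Precedes y x :=
  fun h' => precedes_irrefl x (precedes_trans h h')

instance : IsStrictTotalOrder (Vertex k) Precedes where
  irrefl := precedes_irrefl
  trans _ _ _ := precedes_trans
  trichotomous x y h1 h2 := by
    by_contra h
    exact (precedes_trichotomous x y h).elim h1 h2

theorem lex_asymm {l l' : List (Vertex k)} (h : List.Lex Precedes l l') :
    ¬List.Lex Precedes l' l :=
  Std.Asymm.asymm _ _ h

theorem List.lex_cases {α : Type*} {r : α → α → Prop} {l l' : List α} (h : List.Lex r l l') :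
    (∃ b t, l' = l ++ b :: t) ∨ ∃ p a s b t, l = p ++ a :: s ∧ l' = p ++ b :: t ∧ r a b := by
  induction h with
  | nil => exact .inl ⟨_, _, rfl⟩
  | cons h ih =>
    rename_i a _ _
    rcases ih with ⟨b, t, rfl⟩ | ⟨p, x, s, b, t, rfl, rfl, hab⟩
    · exact .inl ⟨b, t, rfl⟩
    · exact .inr ⟨a :: p, x, s, b, t, rfl, rfl, hab⟩
  | rel h => exact .inr ⟨[], _, _, _, _, rfl, rfl, h⟩

theorem lex_append_of_precedes {p s t : List (Vertex k)} {a b : Vertex k} (h : Precedes a b) :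
    List.Lex Precedes (p ++ a :: s) (p ++ b :: t) :=
  List.Lex.append_left _ (.rel h) p

instance : IsStrictOrder (List (Vertex k)) (List.Lex Precedes) where
  irrefl l h := lex_asymm h h
  trans _ _ _ h h' := by
    exact (IsOrderConnected.conn _ _ _ h).elim id fun h'' => (lex_asymm h' h'').elim

/-! ### Existence and rigidity of the minimal path -/

theorem finite_setOf_isOpenPath {ω : Config k} {S A B : Set (Vertex k)} (hS : S.Finite) :
    {γ | IsOpenPath ω S A B γ}.Finite := by
  have := hS.to_subtype
  have := Fintype.ofFinite S
  refine ((List.finite_length_le S (Fintype.card S)).image (List.map (↑))).subset fun γ hγ => ?_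
  obtain ⟨h1, h2⟩ := isOpenPath_iff.1 hγ
  lift γ to List S using h1.subset
  exact ⟨γ, List.Nodup.length_le_card (h2.of_map _), rfl⟩

/-- The lexicographic order on lists is in general not well-founded. A minimum exists because
self-avoiding paths in the finite set `S` have bounded length, so that there are finitely many of
them. -/
theorem exists_isMinimalOpenPath {ω : Config k} {S A B : Set (Vertex k)} (hS : S.Finite)
    (h : ∃ γ, IsOpenPath ω S A B γ) : ∃ γ, IsMinimalOpenPath ω S A B γ := by
  obtain ⟨γ, hγ⟩ := h
  obtain ⟨⟨m, hm⟩, -, hmin⟩ := ((finite_setOf_isOpenPath (ω := ω) (A := A) (B := B) hS).wellFoundedOn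
    (r := List.Lex Precedes)).has_min Set.univ ⟨⟨γ, hγ⟩, trivial⟩
  refine ⟨m, hm, fun γ' hγ' => ?_⟩
  by_contra! hc
  exact hc.1 (Std.Trichotomous.trichotomous (r := List.Lex Precedes) γ' m
    (hmin ⟨γ', hγ'⟩ trivial) hc.2)

theorem IsMinimalOpenPath.isOpenChain {ω : Config k} {S A B : Set (Vertex k)}
    {γ : List (Vertex k)} (h : IsMinimalOpenPath ω S A B γ) : IsOpenChain ω S A B γ :=
  (isOpenPath_iff.1 h.1).1

theorem IsMinimalOpenPath.nodup {ω : Config k} {S A B : Set (Vertex k)}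
    {γ : List (Vertex k)} (h : IsMinimalOpenPath ω S A B γ) : γ.Nodup :=
  (isOpenPath_iff.1 h.1).2

theorem IsMinimalOpenPath.eq {ω : Config k} {S A B : Set (Vertex k)} {γ γ' : List (Vertex k)}
    (h : IsMinimalOpenPath ω S A B γ) (h' : IsMinimalOpenPath ω S A B γ') : γ = γ' := by
  rcases h.2 γ' h'.1 with h1 | h1
  · exact h1.symm
  rcases h'.2 γ h.1 with h2 | h2
  · exact h2
  exact (lex_asymm h1 h2).elim

theorem IsMinimalOpenPath.not_lex {ω : Config k} {S A B : Set (Vertex k)} {γ γ' : List (Vertex k)}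
    (h : IsMinimalOpenPath ω S A B γ) (h' : IsOpenPath ω S A B γ') : ¬List.Lex Precedes γ' γ := by
  intro hl
  rcases h.2 γ' h' with rfl | h1
  · exact lex_asymm hl hl
  · exact lex_asymm hl h1

theorem IsMinimalOpenPath.minimalPath_eq {ω : Config k} {S A B : Set (Vertex k)}
    {γ : List (Vertex k)} (h : IsMinimalOpenPath ω S A B γ) :
    minimalPath ω S A B = {x | x ∈ γ} := by
  ext x
  constructor
  · rintro ⟨γ', h', hx⟩
    rwa [← h'.eq h]
  · exact fun hx => ⟨γ, h, hx⟩

/-- A minimal path does not visit `B` before its end. -/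
theorem IsMinimalOpenPath.notMem_of_prefix {ω : Config k} {S A B : Set (Vertex k)}
    {p t : List (Vertex k)} {b v : Vertex k} (h : IsMinimalOpenPath ω S A B (p ++ b :: t))
    (hv : v ∈ p) : v ∉ B := by
  intro hvB
  obtain ⟨p1, p2, rfl⟩ := List.append_of_mem hv
  have hpre : (p1 ++ [v]) <+: (p1 ++ v :: p2) ++ b :: t := ⟨p2 ++ b :: t, by simp⟩
  have hc := h.isOpenChain
  refine h.not_lex (γ' := p1 ++ [v]) (isOpenPath_iff.2 ⟨⟨by simp, ?_, ?_, ?_, ?_⟩, ?_⟩) ?_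
  · intro a ha
    refine hc.head a ?_
    cases p1 <;> simpa using ha
  · intro x hx
    obtain rfl : v = x := by simpa using hx
    exact hvB
  · exact fun x hx => hc.subset x (hpre.subset hx)
  · exact hc.chain.prefix hpre
  · exact h.nodup.sublist hpre.sublist
  · have : (p1 ++ v :: p2) ++ b :: t = (p1 ++ [v]) ++ (p2 ++ b :: t) := by simp
    rw [this]
    conv_lhs => rw [← List.append_nil (p1 ++ [v])]
    refine List.Lex.append_left _ ?_ _
    cases p2 <;> exact List.Lex.nil

theorem exists_first {α : Type*} {P : α → Prop} {l : List α} (h : ∃ x ∈ l, P x) :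
    ∃ l₁ x l₂, l = l₁ ++ x :: l₂ ∧ (∀ y ∈ l₁, ¬P y) ∧ P x := by
  induction l with
  | nil => simp at h
  | cons a l ih =>
    by_cases ha : P a
    · exact ⟨[], a, l, rfl, by simp, ha⟩
    · obtain ⟨l₁, x, l₂, rfl, h1, h2⟩ := ih (by simpa [ha] using h)
      exact ⟨a :: l₁, x, l₂, rfl, by simpa [ha] using h1, h2⟩

theorem exists_last {α : Type*} {P : α → Prop} {l : List α} (h : ∃ x ∈ l, P x) :
    ∃ l₁ x l₂, l = l₁ ++ x :: l₂ ∧ (∀ y ∈ l₂, ¬P y) ∧ P x := by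
  obtain ⟨l₁, x, l₂, h1, h2, h3⟩ := exists_first (l := l.reverse) (P := P) (by simpa using h)
  refine ⟨l₂.reverse, x, l₁.reverse, ?_, by simpa using h2, h3⟩
  rw [← List.reverse_reverse l, h1]
  simp

/-- No open path can deviate from the minimal path towards a smaller vertex and then come back to
the minimal path. -/
theorem IsMinimalOpenPath.no_detour {ω : Config k} {S A B : Set (Vertex k)}
    {p t s : List (Vertex k)} {a b w : Vertex k} (h : IsMinimalOpenPath ω S A B (p ++ b :: t))
    (hab : Precedes a b) (hA : ∀ x ∈ (p ++ a :: s).head?, x ∈ A)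
    (hS : ∀ v ∈ p ++ a :: s, v ∈ S) (hchain : (p ++ a :: s).IsChain (OpenEdge ω))
    (hnd : (p ++ a :: s).Nodup) (hw : w ∈ a :: s) (hwγ : w ∈ p ++ b :: t) : False := by
  classical
  have hwt : w ∈ b :: t := by
    rcases List.mem_append.1 hwγ with hp | hp
    · exact ((List.nodup_append.1 hnd).2.2 w hp w hw rfl).elim
    · exact hp
  -- `f` is the first vertex of the detour on the remaining part of the minimal path. Following the
  -- detour up to `f` and the old path from there on gives a self-avoiding open path that is
  -- lexicographically smaller.
  obtain ⟨s1, f, s2, hs, hfirst, hf⟩ : ∃ s1 f s2, a :: s = s1 ++ f :: s2 ∧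
      (∀ x ∈ s1, x ∉ b :: t) ∧ f ∈ b :: t := by
    obtain ⟨s1, f, s2, h1, h2, h3⟩ := exists_first (P := (· ∈ b :: t)) ⟨w, hw, hwt⟩
    exact ⟨s1, f, s2, h1, h2, h3⟩
  obtain ⟨t1, t2, ht⟩ := List.append_of_mem hf
  have hc := h.isOpenChain
  have hn := h.nodup
  rw [ht] at h hc hn
  rw [hs] at hA hS hchain hnd
  have hpath : IsOpenPath ω S A B (p ++ s1 ++ f :: t2) := by
    refine isOpenPath_iff.2 ⟨⟨by simp, ?_, ?_, ?_, ?_⟩, ?_⟩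
    · intro x hx
      apply hA
      cases p <;> cases s1 <;> simpa using hx
    · intro x hx
      apply hc.last
      simpa [List.getLast?_append] using hx
    · intro v hv
      simp only [List.mem_append, List.mem_cons] at hv
      rcases hv with (hv | hv) | hv
      · exact hS v (by simp [hv])
      · exact hS v (by simp [hv])
      · exact hc.subset v (by simp; tauto)
    · have h1 : (p ++ s1 ++ [f]).IsChain (OpenEdge ω) :=
        hchain.prefix ⟨s2, by simp⟩
      have h2 : (f :: t2).IsChain (OpenEdge ω) :=
        hc.chain.suffix ⟨p ++ t1, by simp⟩
      simpa using List.IsChain.append_overlap (l₁ := p ++ s1) (l₂ := [f]) (l₃ := t2) h1 h2 (by simp)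
    · have h1 : (p ++ s1).Nodup := hnd.sublist (by simp)
      have h2 : (f :: t2).Nodup := hn.sublist (by simp)
      refine List.nodup_append.2 ⟨h1, h2, ?_⟩
      rintro x hx y hy rfl
      rcases List.mem_append.1 hx with hx | hx
      · exact (List.nodup_append.1 hn).2.2 x hx x (by simp at hy ⊢; tauto) rfl
      · exact hfirst x hx (by rw [ht]; simp at hy ⊢; tauto)
  refine h.not_lex hpath ?_
  rw [← ht]
  cases s1 with
  | nil =>
    simp only [List.nil_append, List.cons.injEq] at hs
    obtain ⟨rfl, -⟩ := hs
    simpa using lex_append_of_precedes hab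
  | cons c s1 =>
    simp only [List.cons_append, List.cons.injEq] at hs
    obtain ⟨rfl, -⟩ := hs
    simpa using lex_append_of_precedes hab (p := p)

/-! ### Resampling edges, and consecutive vertices of a path -/

/-- Resampling of the edges with an endpoint in `D`: they become open exactly if they are in
relation `F`. -/
noncomputable def rewire (ω : Config k) (D : Set (Vertex k)) (F : Vertex k → Vertex k → Prop) :
    Config k :=
  open Classical in fun e =>
    if ∃ x ∈ D, x ∈ e.1 then decide (∃ x y, e.1 = s(x, y) ∧ F x y) else ω e

theorem rewire_apply_of_notMem {ω : Config k} {D : Set (Vertex k)}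
    {F : Vertex k → Vertex k → Prop} {e : (slab k).edgeSet} (h : ∀ x ∈ D, x ∉ e.1) :
    rewire ω D F e = ω e := by
  simp only [rewire]
  rw [if_neg]
  simpa using h

theorem openEdge_rewire_of_notMem {ω : Config k} {D : Set (Vertex k)}
    {F : Vertex k → Vertex k → Prop} {x y : Vertex k} (hx : x ∉ D) (hy : y ∉ D) :
    OpenEdge (rewire ω D F) x y ↔ OpenEdge ω x y := by
  refine exists_congr fun h => ?_
  rw [rewire_apply_of_notMem]
  rintro v hv hvxy
  rcases Sym2.mem_iff.1 hvxy with rfl | rfl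
  exacts [hx hv, hy hv]

open Classical in
theorem openEdge_rewire_of_mem {ω : Config k} {D : Set (Vertex k)}
    {F : Vertex k → Vertex k → Prop} {x y : Vertex k} (hxy : x ∈ D ∨ y ∈ D) :
    OpenEdge (rewire ω D F) x y ↔ (slab k).Adj x y ∧ (F x y ∨ F y x) := by
  rw [OpenEdge, ← exists_prop]
  refine exists_congr fun h => ?_
  have : rewire ω D F ⟨s(x, y), h⟩ = decide (∃ a b, s(x, y) = s(a, b) ∧ F a b) :=
    if_pos (by rcases hxy with h | h <;> exact ⟨_, h, by simp⟩)
  rw [this, decide_eq_true_iff]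
  constructor
  · rintro ⟨a, b, h, hF⟩
    rcases Sym2.eq_iff.1 h with ⟨rfl, rfl⟩ | ⟨rfl, rfl⟩
    exacts [.inl hF, .inr hF]
  · rintro (h | h)
    exacts [⟨x, y, rfl, h⟩, ⟨y, x, Sym2.eq_swap, h⟩]

/-- `x` and `y` are consecutive entries of `l`. -/
def Consecutive {V : Type*} (l : List V) (x y : V) : Prop := ∃ l₁ l₂, l = l₁ ++ x :: y :: l₂

theorem Consecutive.mem_left {V : Type*} {l : List V} {x y : V} (h : Consecutive l x y) :
    x ∈ l := by
  obtain ⟨l₁, l₂, rfl⟩ := h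
  simp

theorem Consecutive.mem_right {V : Type*} {l : List V} {x y : V} (h : Consecutive l x y) :
    y ∈ l := by
  obtain ⟨l₁, l₂, rfl⟩ := h
  simp

theorem append_cons_inj_of_notMem {V : Type*} {p q s t : List V} {u : V} (hp : u ∉ p) (hq : u ∉ q)
    (h : p ++ u :: s = q ++ u :: t) : p = q ∧ s = t := by
  induction p generalizing q with
  | nil =>
    cases q with
    | nil => simpa using h
    | cons x q =>
      simp only [List.nil_append, List.cons_append, List.cons.injEq] at h
      exact (hq (by simp [h.1])).elim
  | cons y p ih =>
    cases q with
    | nil =>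
      simp only [List.nil_append, List.cons_append, List.cons.injEq] at h
      exact (hp (by simp [h.1])).elim
    | cons x q =>
      simp only [List.cons_append, List.cons.injEq, List.mem_cons, not_or] at h hp hq
      obtain ⟨h1, h2⟩ := ih hp.2 hq.2 h.2
      exact ⟨by rw [h.1, h1], h2⟩

/-- The implication may use the position of the pair in the list. This is needed for edges that are
open precisely because their endpoints are consecutive on a prescribed path. -/
theorem isChain_imp_of_consecutive {V : Type*} {r r' : V → V → Prop} {l : List V}
    (h : l.IsChain r) (himp : ∀ x y, Consecutive l x y → r x y → r' x y) : l.IsChain r' := by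
  suffices h : ∀ l' pre : List V, l'.IsChain r → pre ++ l' = l → l'.IsChain r' from
    h l [] ‹_› rfl
  clear h
  intro l'
  induction l' with
  | nil => simp
  | cons x l' ih =>
    rintro pre h rfl
    cases l' with
    | nil => simp
    | cons y l' =>
      obtain ⟨hxy, h⟩ := List.isChain_cons_cons.1 h
      exact .cons_cons (himp x y ⟨pre, l', rfl⟩ hxy) (ih (pre ++ [x]) h (by simp))

theorem Consecutive.eq_of_nodup {V : Type*} {p t : List V} {u a b : V}
    (hnd : (p ++ u :: b :: t).Nodup) (h : Consecutive (p ++ u :: b :: t) u a) : a = b := by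
  obtain ⟨l₁, l₂, h⟩ := h
  have h1 : u ∉ p := fun hu => (List.nodup_append.1 hnd).2.2 u hu u (by simp) rfl
  have h2 : u ∉ l₁ := fun hu => by
    rw [h] at hnd
    exact (List.nodup_append.1 hnd).2.2 u hu u (by simp) rfl
  obtain ⟨-, h4⟩ := append_cons_inj_of_notMem h1 h2 h
  simp only [List.cons.injEq] at h4
  exact h4.1.symm

theorem Consecutive.mem_of_nodup {V : Type*} {p t : List V} {u a : V}
    (hnd : (p ++ u :: t).Nodup) (h : Consecutive (p ++ u :: t) a u) : a ∈ p := by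
  obtain ⟨l₁, l₂, h⟩ := h
  have h' : p ++ u :: t = (l₁ ++ [a]) ++ u :: l₂ := by simpa using h
  have h1 : u ∉ p := fun hu => (List.nodup_append.1 hnd).2.2 u hu u (by simp) rfl
  have h2 : u ∉ l₁ ++ [a] := fun hu => by
    rw [h'] at hnd
    exact (List.nodup_append.1 hnd).2.2 u hu u (by simp) rfl
  obtain ⟨h3, -⟩ := append_cons_inj_of_notMem h1 h2 h'
  simp [h3]

theorem Consecutive.cases_cons {V : Type*} {Q : List V} {z x y : V}
    (h : Consecutive (z :: Q) x y) : (x = z ∧ Q.head? = some y) ∨ (x ∈ Q ∧ y ∈ Q) := by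
  obtain ⟨l₁, l₂, h⟩ := h
  cases l₁ with
  | nil =>
    simp only [List.nil_append, List.cons.injEq] at h
    obtain ⟨rfl, rfl⟩ := h
    exact .inl ⟨rfl, rfl⟩
  | cons c l₁ =>
    simp only [List.cons_append, List.cons.injEq] at h
    obtain ⟨-, rfl⟩ := h
    exact .inr (by simp)

theorem notMem_cluster_of_not_connected {ω : Config k} {R X Y : Set (Vertex k)}
    (h : ¬Connected ω R X Y) {v : Vertex k} (hv : v ∈ cluster ω R Y) : v ∉ cluster ω R X := by
  obtain ⟨y, hy, hyv⟩ := hv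
  rintro ⟨x, hx, hxv⟩
  exact h ⟨x, hx, y, hy, hxv.trans hyv.symm⟩

/-! ### Detours: rerouting the minimal path and attaching `C` to it -/

/-- The vertices of the minimal open path in `S` from `A` to `B` that are reached from `C` by an
open path in `R` which avoids the other vertices of the minimal path. -/
def attachSet (ω : Config k) (S R A B C : Set (Vertex k)) : Set (Vertex k) :=
  {y | y ∈ minimalPath ω S A B ∧ y ∈ cluster ω ((R \ minimalPath ω S A B) ∪ {y}) C}

/-- A vertex at which the cluster of `C`, grown outside the minimal path, first meets that path is
attached. Without such a vertex the whole cluster would stay in `R \ M`. -/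
theorem attachSet_nonempty {ω : Config k} {S R A B C : Set (Vertex k)} {y : Vertex k}
    (hy : y ∈ minimalPath ω S A B) (hC : y ∈ cluster ω R C) :
    (attachSet ω S R A B C).Nonempty := by
  set M := minimalPath ω S A B
  by_contra hempty
  have hno : ∀ y ∈ M, y ∉ cluster ω ((R \ M) ∪ {y}) C := fun y hy h => hempty ⟨y, hy, h⟩
  have hsub : cluster ω R C ⊆ cluster ω (R \ M) C := by
    refine cluster_subset_of_closed (fun x hx => ?_) fun x hx w hxw => ?_
    · by_cases hM : x ∈ M
      · exact (hno x hM (subset_cluster hx.1 (.inr rfl))).elim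
      · exact subset_cluster hx.1 ⟨hx.2, hM⟩
    · have hx' := cluster_subset hx
      by_cases hM : w ∈ M
      · refine (hno w hM (cluster_step (x := x) (cluster_mono Set.subset_union_left ?_ hx)
          ⟨.inl hx', .inr rfl, hxw.2.2⟩)).elim
        exact fun a b h => ⟨.inl h.1, .inl h.2.1, h.2.2⟩
      · exact cluster_step hx ⟨hx', ⟨hxw.2.1, hM⟩, hxw.2.2⟩
  exact (cluster_subset (hsub hC)).2 hy

/-- The data for a local modification of `ω` that joins `C` to the minimal open path
`α ++ d :: β` from `A` to `B`. All edges at `D` are closed, except that the new path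
`α ++ τ ++ z :: (E ++ β')` from `A` to `B` and the path `z :: Q` to `C` are opened. -/
structure IsDetour (ω : Config k) (S R A B C D : Set (Vertex k)) (α : List (Vertex k))
    (d : Vertex k) (β τ : List (Vertex k)) (z : Vertex k) (E β' Q : List (Vertex k)) : Prop where
  subset : S ⊆ R
  notMem_left : ∀ v ∈ D, v ∉ A
  not_connected : ¬Connected ω R C A
  isMinimal : IsMinimalOpenPath ω S A B (α ++ d :: β)
  notMem_of_before : ∀ v ∈ α, v ∉ D
  notMem_of_after : ∀ v ∈ β', v ∉ D
  after_subset : ∀ v ∈ β', v ∈ α ++ d :: β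
  head : (τ ++ z :: E).head? = some d
  mem : ∀ v ∈ τ ++ z :: E, v ∈ D
  mem_region : ∀ v ∈ τ ++ z :: E, v ∈ S
  nodup : (α ++ ((τ ++ z :: E) ++ β')).Nodup
  chain : (α ++ ((τ ++ z :: E) ++ β')).IsChain
    fun x y => (slab k).Adj x y ∧ (x ∉ D → y ∉ D → OpenEdge ω x y)
  last : ∀ b ∈ (α ++ ((τ ++ z :: E) ++ β')).getLast?, b ∈ B
  notMem_right : ∀ v ∈ (α ++ ((τ ++ z :: E) ++ β')).dropLast, v ∉ B
  branch_last : ∃ c ∈ Q.getLast?, c ∈ C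
  branch_mem : ∀ v ∈ Q, v ∈ R
  branch_chain : (z :: Q).IsChain
    fun x y => (slab k).Adj x y ∧ (x ∉ D → y ∉ D → OpenEdge ω x y)
  branch_cluster : ∀ v ∈ Q, v ∉ D → v ∈ cluster ω R C
  branch_disjoint : ∀ v ∈ Q, v ∈ D → v ∉ τ ++ z :: E
  branch_order : ∀ q ∈ Q.head?, ∀ b ∈ (E ++ β').head?, q ∉ S ∨ Precedes b q

namespace IsDetour

variable {ω : Config k} {S R A B C D : Set (Vertex k)} {α β τ E β' Q : List (Vertex k)}
  {d z : Vertex k}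

/-- The edges at `D` that the modification opens. -/
def newEdge (α τ : List (Vertex k)) (z : Vertex k) (E β' Q : List (Vertex k))
    (x y : Vertex k) : Prop :=
  Consecutive (α ++ ((τ ++ z :: E) ++ β')) x y ∨ Consecutive (z :: Q) x y

theorem path_mem_iff (h : IsDetour ω S R A B C D α d β τ z E β' Q) {v : Vertex k} (hv : v ∈ D) :
    v ∈ α ++ ((τ ++ z :: E) ++ β') ↔ v ∈ τ ++ z :: E := by
  have h1 := mt (h.notMem_of_before v) (not_not.2 hv)
  have h2 := mt (h.notMem_of_after v) (not_not.2 hv)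
  rw [List.mem_append, List.mem_append]
  tauto

theorem old_notMem_cluster (h : IsDetour ω S R A B C D α d β τ z E β' Q) {v : Vertex k}
    (hv : v ∈ α ++ d :: β) : v ∉ cluster ω R C :=
  notMem_cluster_of_not_connected h.not_connected
    (h.isMinimal.isOpenChain.subset_cluster h.subset v hv)

theorem path_mem_old (h : IsDetour ω S R A B C D α d β τ z E β' Q) {v : Vertex k}
    (hv : v ∈ α ++ ((τ ++ z :: E) ++ β')) (hD : v ∉ D) : v ∈ α ++ d :: β := by
  simp only [List.mem_append (s := α), List.mem_append (t := β')] at hv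
  rcases hv with hv | hv | hv
  · simp [hv]
  · exact (hD (h.mem v hv)).elim
  · exact h.after_subset v hv

/-- Inside `D` this is assumed. Outside `D` the branch lies in the old cluster of `C`, whereas the
path consists of vertices of the old minimal path, which is joined to `A`. -/
theorem branch_notMem_path (h : IsDetour ω S R A B C D α d β τ z E β' Q) {v : Vertex k}
    (hv : v ∈ Q) : v ∉ α ++ ((τ ++ z :: E) ++ β') := by
  intro hv'
  by_cases hD : v ∈ D
  · exact h.branch_disjoint v hv hD ((h.path_mem_iff hD).1 hv')
  · exact h.old_notMem_cluster (h.path_mem_old hv' hD) (h.branch_cluster v hv hD)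

theorem chain_open {F : Vertex k → Vertex k → Prop} {l : List (Vertex k)}
    (hl : l.IsChain fun x y => (slab k).Adj x y ∧ (x ∉ D → y ∉ D → OpenEdge ω x y))
    (hF : ∀ x y, Consecutive l x y → F x y) : l.IsChain (OpenEdge (rewire ω D F)) := by
  refine isChain_imp_of_consecutive hl ?_
  rintro x y hc ⟨hadj, hopen⟩
  by_cases hD : x ∈ D ∨ y ∈ D
  · exact (openEdge_rewire_of_mem hD).2 ⟨hadj, .inl (hF x y hc)⟩
  · rw [not_or] at hD
    exact (openEdge_rewire_of_notMem hD.1 hD.2).2 (hopen hD.1 hD.2)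

theorem isOpenPath (h : IsDetour ω S R A B C D α d β τ z E β' Q) :
    IsOpenPath (rewire ω D (newEdge α τ z E β' Q)) S A B (α ++ ((τ ++ z :: E) ++ β')) := by
  refine isOpenPath_iff.2 ⟨⟨by simp, ?_, h.last, ?_, chain_open h.chain fun _ _ => .inl⟩, h.nodup⟩
  · intro a ha
    apply h.isMinimal.isOpenChain.head
    rw [List.head?_append] at ha ⊢
    rw [List.head?_append, h.head] at ha
    simpa using ha
  · intro v hv
    by_cases hD : v ∈ D
    · exact h.mem_region v ((h.path_mem_iff hD).1 hv)
    · exact h.isMinimal.isOpenChain.subset v (h.path_mem_old hv hD)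

theorem connected (h : IsDetour ω S R A B C D α d β τ z E β' Q) :
    Connected (rewire ω D (newEdge α τ z E β' Q)) R C A := by
  obtain ⟨c, hc, hcC⟩ := h.branch_last
  have hcQ : c ∈ Q := List.mem_of_getLast? hc
  have hzR : z ∈ R := h.subset (h.mem_region z (by simp))
  have h1 := chain_subset_cluster (R := R)
    (chain_open (F := newEdge α τ z E β' Q) h.branch_chain fun _ _ => .inr)
    (fun v hv => (List.mem_cons.1 hv).elim (fun e => e ▸ hzR) (h.branch_mem v))
    (List.mem_cons_of_mem z hcQ) (subset_cluster hcC (h.branch_mem c hcQ)) z (by simp)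
  have h2 := (isOpenPath_iff.1 h.isOpenPath).1
  have h3 := chain_subset_cluster h2.chain (fun v hv => h.subset (h2.subset v hv))
    (x := z) (by simp) h1 _ (List.head_mem h2.ne_nil)
  exact connected_iff.2 ⟨_, ⟨h2.head _ (List.head?_eq_some_head _),
    h.subset (h2.subset _ (List.head_mem h2.ne_nil))⟩, h3⟩

/-- An open edge at `D` after the modification. -/
theorem edge_cases {x y : Vertex k} (hD : x ∈ D ∨ y ∈ D)
    (hxy : OpenEdge (rewire ω D (newEdge α τ z E β' Q)) x y) :
    (Consecutive (α ++ ((τ ++ z :: E) ++ β')) x y ∨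
      Consecutive (α ++ ((τ ++ z :: E) ++ β')) y x) ∨
    (Consecutive (z :: Q) x y ∨ Consecutive (z :: Q) y x) := by
  have := ((openEdge_rewire_of_mem hD).1 hxy).2
  unfold newEdge at this
  tauto

/-- A smaller path that avoids `D` would already be open in `ω`. Otherwise let `w` be its last
vertex before it first enters `D`. If the entry comes after the deviation has left `D` alone for at
least one step, `w` is joined to `A` in `ω`, hence is not on the branch; the open edges at `D` then
force `w` onto the new path, so onto the old one, contradicting `no_detour`. If the deviation enters
`D` at once, the only edges available from the common part are those of the new path itself, or else
the path starts in `D ∩ A = ∅`. -/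
theorem no_early_deviation (h : IsDetour ω S R A B C D α d β τ z E β' Q)
    {p s t t' : List (Vertex k)} {a b : Vertex k} (hpath :
      IsOpenPath (rewire ω D (newEdge α τ z E β' Q)) S A B (p ++ a :: s))
    (hκ : α ++ ((τ ++ z :: E) ++ β') = p ++ b :: t) (hγ : α ++ d :: β = p ++ b :: t')
    (hp : ∀ v ∈ p, v ∉ D) (hab : Precedes a b) : False := by
  obtain ⟨hc, hnd⟩ := isOpenPath_iff.1 hpath
  have hmin := h.isMinimal
  have hane : a ≠ b := fun e => precedes_irrefl b (e ▸ hab)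
  by_cases hD : ∃ v ∈ a :: s, v ∈ D
  · obtain ⟨s1, m, s2, hs, hs1, hm⟩ := exists_first hD
    have hnd' : (p ++ b :: t).Nodup := hκ ▸ h.nodup
    rcases List.eq_nil_or_concat s1 with rfl | ⟨s1, w, rfl⟩
    · simp only [List.nil_append, List.cons.injEq] at hs
      obtain ⟨rfl, rfl⟩ := hs
      rcases List.eq_nil_or_concat p with rfl | ⟨p, u, rfl⟩
      · exact h.notMem_left a hm (hc.head a (by simp))
      · have hκ : α ++ ((τ ++ z :: E) ++ β') = p ++ u :: b :: t := by rw [hκ]; simp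
        simp only [List.append_assoc, List.singleton_append, List.concat_eq_append] at hp hγ hc hnd hnd'
        have hu := hp u (by simp)
        have huγ : u ∈ α ++ d :: β := by rw [hγ]; simp
        have hua : OpenEdge (rewire ω D (newEdge α τ z E β' Q)) u a :=
          (hc.chain.suffix ⟨p, rfl⟩ : List.IsChain _ (u :: a :: s)).rel
        have hap : a ∉ p := fun hap => (List.nodup_append.1 hnd).2.2 a hap a (by simp) rfl
        have hunot : u ∉ Q := fun huQ =>
          h.old_notMem_cluster huγ (h.branch_cluster u huQ hu)
        have huz : u ≠ z := fun e => hu (e ▸ h.mem z (by simp))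
        rcases edge_cases (.inr hm) hua with (h1 | h1) | (h1 | h1)
        · rw [hκ] at h1
          exact hane (h1.eq_of_nodup hnd')
        · rw [hκ] at h1
          exact hap (h1.mem_of_nodup hnd')
        · rcases h1.cases_cons with h1 | h1
          exacts [huz h1.1, hunot h1.1]
        · have := h1.mem_right
          simp [huz, hunot] at this
    · simp only [List.append_assoc, List.singleton_append, List.concat_eq_append] at hs hs1
      have hpre : p ++ (s1 ++ [w]) <+: p ++ a :: s := ⟨m :: s2, by simp [hs]⟩
      have hw : w ∉ D := hs1 w (by simp)
      have hpreD : ∀ v ∈ p ++ (s1 ++ [w]), v ∉ D := fun v hv => by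
        rcases List.mem_append.1 hv with hv | hv
        exacts [hp v hv, hs1 v hv]
      have hchain : (p ++ (s1 ++ [w])).IsChain (OpenEdge ω) :=
        (hc.chain.prefix hpre).imp_of_mem_imp fun x y hx hy hxy =>
          (openEdge_rewire_of_notMem (hpreD x hx) (hpreD y hy)).1 hxy
      obtain ⟨r, hr⟩ : ∃ r, s1 ++ [w] = a :: r := by
        cases s1 with
        | nil => simp at hs; exact ⟨[], by simp [hs.1]⟩
        | cons c s1 => simp at hs; exact ⟨s1 ++ [w], by simp [hs.1]⟩
      have hwmem : w ∈ a :: r := by rw [← hr]; simp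
      rw [hr] at hpre hchain
      have hhead : ∀ x ∈ (p ++ a :: r).head?, x ∈ A := fun x hx => hc.head x (by
        cases p <;> simpa using hx)
      have hS : ∀ v ∈ p ++ a :: r, v ∈ S := fun v hv => hc.subset v (hpre.subset hv)
      have hopen : IsOpenChain ω S A {w} (p ++ a :: r) := by
        refine ⟨by simp, hhead, ?_, hS, hchain⟩
        intro x hx
        rw [← hr] at hx
        simpa using hx.symm
      have hwC : w ∉ cluster ω R C := notMem_cluster_of_not_connected h.not_connected
        (hopen.subset_cluster h.subset w (by simp at hwmem ⊢; tauto))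
      have hwQ : w ∉ Q := fun hwQ => hwC (h.branch_cluster w hwQ hw)
      have hwz : w ≠ z := fun e => hw (e ▸ h.mem z (by simp))
      have hwm : OpenEdge (rewire ω D (newEdge α τ z E β' Q)) w m :=
        (hc.chain.suffix ⟨p ++ s1, by simp [hs]⟩ : List.IsChain _ (w :: m :: s2)).rel
      have hwκ : w ∈ α ++ ((τ ++ z :: E) ++ β') := by
        rcases edge_cases (.inr hm) hwm with (h1 | h1) | (h1 | h1)
        · exact h1.mem_left
        · exact h1.mem_right
        · have := h1.mem_left
          simp [hwz, hwQ] at this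
        · have := h1.mem_right
          simp [hwz, hwQ] at this
      rw [hγ] at hmin
      exact hmin.no_detour hab hhead hS hchain (hnd.sublist hpre.sublist) hwmem
        (hγ ▸ h.path_mem_old hwκ hw)
  · push Not at hD
    have hall : ∀ v ∈ p ++ a :: s, v ∉ D := fun v hv => by
      rcases List.mem_append.1 hv with hv | hv
      exacts [hp v hv, hD v hv]
    rw [hγ] at hmin
    refine hmin.not_lex (isOpenPath_iff.2 ⟨⟨hc.ne_nil, hc.head, hc.last, hc.subset,
      hc.chain.imp_of_mem_imp fun x y hx hy hxy =>
        (openEdge_rewire_of_notMem (hall x hx) (hall y hy)).1 hxy⟩, hnd⟩)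
      (lex_append_of_precedes hab)

/-- At a vertex of `D` on the new path, the only open edges leaving that path belong to the branch
and start at the junction `z`. There `branch_order` says that the branch leaves `S` or that its step
is the larger one. -/
theorem no_inner_deviation (h : IsDetour ω S R A B C D α d β τ z E β' Q)
    {p s t : List (Vertex k)} {u a b : Vertex k} (hpath :
      IsOpenPath (rewire ω D (newEdge α τ z E β' Q)) S A B (p ++ u :: a :: s))
    (hκ : α ++ ((τ ++ z :: E) ++ β') = p ++ u :: b :: t) (hu : u ∈ D) (hab : Precedes a b) :
    False := by
  obtain ⟨hc, hnd⟩ := isOpenPath_iff.1 hpath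
  have hane : a ≠ b := fun e => precedes_irrefl b (e ▸ hab)
  have hnd' : (p ++ u :: b :: t).Nodup := hκ ▸ h.nodup
  have hua : OpenEdge (rewire ω D (newEdge α τ z E β' Q)) u a :=
    (hc.chain.suffix ⟨p, rfl⟩ : List.IsChain _ (u :: a :: s)).rel
  have hap : a ∉ p := fun hap => (List.nodup_append.1 hnd).2.2 a hap a (by simp) rfl
  have huQ : u ∉ Q := fun huQ => h.branch_notMem_path huQ (by rw [hκ]; simp)
  have hua' : u ≠ a := fun e => by
    subst e
    simp [List.nodup_append] at hnd
  rcases edge_cases (.inl hu) hua with (h1 | h1) | (h1 | h1)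
  · rw [hκ] at h1
    exact hane (h1.eq_of_nodup hnd')
  · rw [hκ] at h1
    exact hap (h1.mem_of_nodup hnd')
  · rcases h1.cases_cons with ⟨rfl, hq⟩ | h1
    · have hb : b ∈ (E ++ β').head? := by
        have h2 : (α ++ τ) ++ u :: (E ++ β') = p ++ u :: b :: t := by
          rw [← hκ]; simp
        have h3 : u ∉ p := fun hu => (List.nodup_append.1 hnd').2.2 u hu u (by simp) rfl
        have h4 : u ∉ α ++ τ := fun hu => by
          rw [← h2] at hnd'
          exact (List.nodup_append.1 hnd').2.2 u hu u (by simp) rfl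
        obtain ⟨-, h5⟩ := append_cons_inj_of_notMem h4 h3 h2
        simp [h5]
      rcases h.branch_order a hq b hb with h2 | h2
      · exact h2 (hc.subset a (by simp))
      · exact precedes_asymm hab h2
    · exact huQ h1.1
  · rcases h1.cases_cons with h1 | h1
    · have h2 : u ∈ Q := List.mem_of_mem_head? h1.2
      exact huQ h2
    · exact huQ h1.2

/-- The minimal path after the modification follows the detour through `D`. -/
theorem exists_eq_append (h : IsDetour ω S R A B C D α d β τ z E β' Q) {γ' : List (Vertex k)}
    (hγ' : IsMinimalOpenPath (rewire ω D (newEdge α τ z E β' Q)) S A B γ') :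
    ∃ η, γ' = α ++ ((τ ++ z :: E) ++ η) ∧ ∀ v ∈ η.head?, v ∈ β' := by
  rcases hγ'.2 _ h.isOpenPath with rfl | hlex
  · exact ⟨β', rfl, fun v hv => List.mem_of_mem_head? hv⟩
  rcases List.lex_cases hlex with ⟨b, t, hκ⟩ | ⟨p, a, s, b, t, rfl, hκ, hab⟩
  -- A proper prefix of the new path cannot end in `B`, which the new path meets only at its last
  -- vertex.
  · have hne := hγ'.isOpenChain.ne_nil
    refine (h.notMem_right (γ'.getLast hne) ?_
      (hγ'.isOpenChain.last _ (List.getLast?_eq_some_getLast _))).elim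
    rw [hκ, List.dropLast_append_of_ne_nil (by simp)]
    exact List.mem_append_left _ (List.getLast_mem _)
  have hinner : ∀ p' u, p = p' ++ [u] → u ∈ D → False := by
    rintro p' u rfl hu
    have := hγ'.1
    rw [List.append_assoc] at this
    rw [List.append_assoc p'] at hκ
    exact h.no_inner_deviation this hκ hu hab
  have hlast : ∀ l l' : List (Vertex k), l ≠ [] → (∀ v ∈ l, v ∈ D) → p = l' ++ l → False := by
    intro l l' hl hlD hpl
    rcases List.eq_nil_or_concat l with rfl | ⟨l, u, rfl⟩
    · exact hl rfl
    · exact hinner (l' ++ l) u (by simpa using hpl) (hlD u (by simp))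
  obtain ⟨l, hl⟩ : ∃ l, τ ++ z :: E = d :: l := by
    have := h.head
    cases hτ : τ ++ z :: E with
    | nil => simp [hτ] at this
    | cons x l => rw [hτ] at this; simp at this; exact ⟨l, by rw [this]⟩
  have hnoearly : ∀ c', α = p ++ c' → b :: t = c' ++ ((τ ++ z :: E) ++ β') → False := by
    rintro c' hα hb
    have hp : ∀ v ∈ p, v ∉ D := fun v hv => h.notMem_of_before v (by simp [hα, hv])
    obtain ⟨t', ht'⟩ : ∃ t', c' ++ d :: β = b :: t' := by
      cases c' with
      | nil => rw [hl] at hb; simp at hb; exact ⟨β, by simp [hb.1]⟩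
      | cons x c' => simp at hb; exact ⟨c' ++ d :: β, by simp [hb.1]⟩
    exact h.no_early_deviation hγ'.1 hκ (by rw [hα, List.append_assoc, ht']) hp hab
  -- The first difference may lie after, inside or before the piece in `D`; only the first position
  -- survives. A deviation right after the last vertex of the piece starts in `D` and is excluded as
  -- well, so the first vertex of `η` is on `β'`.
  rcases List.append_eq_append_iff.1 hκ with ⟨a', rfl, ha'⟩ | ⟨c', hα, hb⟩
  · rcases List.append_eq_append_iff.1 ha' with ⟨e', rfl, he'⟩ | ⟨e', he', -⟩
    · cases e' with
      | nil => exact (hlast (τ ++ z :: E) α (by simp) h.mem (by simp)).elim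
      | cons v e' =>
        refine ⟨v :: e' ++ a :: s, by simp, ?_⟩
        intro x hx
        obtain rfl : v = x := by simpa using hx
        rw [he']
        simp
    · by_cases hnil : a' = []
      · subst hnil
        exact (hnoearly [] (by simp) (by simpa using ha'.symm)).elim
      · exact (hlast a' α hnil (fun v hv => h.mem v (by rw [he']; simp [hv])) rfl).elim
  · exact (hnoearly c' hα hb).elim

/-- Induction along the tail, which starts on the old path and so outside `D` and the cluster of
`C`. To enter `D` it would need an edge of the new path, whose vertices in `D` are already used up,
or an edge of the branch, whose vertices outside `D` belong to the cluster of `C`. Outside `D`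
nothing has changed, so the tail cannot enter that cluster either. -/
theorem tail_notMem (h : IsDetour ω S R A B C D α d β τ z E β' Q) {η : List (Vertex k)}
    (hγ' : IsOpenPath (rewire ω D (newEdge α τ z E β' Q)) S A B (α ++ ((τ ++ z :: E) ++ η)))
    (hη : ∀ v ∈ η.head?, v ∈ β') : ∀ v ∈ η, v ∉ D ∧ v ∉ cluster ω R C := by
  obtain ⟨hc, hnd⟩ := isOpenPath_iff.1 hγ'
  have hchain : η.IsChain (OpenEdge (rewire ω D (newEdge α τ z E β' Q))) :=
    hc.chain.suffix ⟨α ++ (τ ++ z :: E), by simp⟩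
  have hdisj : ∀ v ∈ η, v ∉ τ ++ z :: E := fun v hv hv' =>
    (List.nodup_append.1 (List.nodup_append.1 hnd).2.1).2.2 v hv' v hv rfl
  have hS : ∀ v ∈ η, v ∈ R := fun v hv => h.subset (hc.subset v (by simp [hv]))
  have hhead : ∀ v ∈ η.head?, v ∉ D ∧ v ∉ cluster ω R C := fun v hv =>
    ⟨h.notMem_of_after v (hη v hv), h.old_notMem_cluster (h.after_subset v (hη v hv))⟩
  clear hη hγ' hc hnd
  induction η with
  | nil => simp
  | cons x η ih =>
    have hx := hhead x (by simp)
    intro v hv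
    rcases List.mem_cons.1 hv with rfl | hv
    · exact hx
    refine ih hchain.tail (fun v hv => hdisj v (by simp [hv])) (fun v hv => hS v (by simp [hv]))
      (fun y hy => ?_) v hv
    have hymem : y ∈ η := List.mem_of_mem_head? hy
    have hxy : OpenEdge (rewire ω D (newEdge α τ z E β' Q)) x y := by
      cases η with
      | nil => simp at hy
      | cons y' η => simp at hy; exact hy ▸ hchain.rel
    have hyD : y ∉ D := by
      intro hyD
      have hyκ : y ∉ α ++ ((τ ++ z :: E) ++ β') := fun hy' =>
        hdisj y (by simp [hymem]) ((h.path_mem_iff hyD).1 hy')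
      have hxQ : x ∉ z :: Q := fun hxQ => (List.mem_cons.1 hxQ).elim
        (fun e => hx.1 (e ▸ h.mem z (by simp))) fun hxQ => hx.2 (h.branch_cluster x hxQ hx.1)
      rcases edge_cases (.inr hyD) hxy with (h1 | h1) | (h1 | h1)
      exacts [hyκ h1.mem_right, hyκ h1.mem_left, hxQ h1.mem_left, hxQ h1.mem_right]
    refine ⟨hyD, fun hyC => hx.2 ?_⟩
    exact cluster_step hyC ⟨hS y (by simp [hymem]), hS x (by simp),
      ((openEdge_rewire_of_notMem hx.1 hyD).1 hxy).symm⟩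

/-- Suppose that `y ∉ D` were attached. Exploring from `C` off the new minimal path, one stays in
`D` or in the old cluster of `C`: from a vertex of `D` off the path only branch edges can be used.
No vertex of the minimal path outside `D` belongs to the old cluster, so `y` is never reached. -/
theorem attachSet_subset (h : IsDetour ω S R A B C D α d β τ z E β' Q) :
    attachSet (rewire ω D (newEdge α τ z E β' Q)) S R A B C ⊆ D := by
  rintro y ⟨hyM, hy⟩
  obtain ⟨γ', hγ', hyγ'⟩ := hyM
  rw [hγ'.minimalPath_eq] at hy
  obtain ⟨η, rfl, hη⟩ := h.exists_eq_append hγ'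
  have htail := h.tail_notMem hγ'.1 hη
  have hnotC : ∀ v ∈ α ++ ((τ ++ z :: E) ++ η), v ∉ D → v ∉ cluster ω R C := by
    intro v hv hD
    simp only [List.mem_append (s := α), List.mem_append (t := η)] at hv
    rcases hv with hv | hv | hv
    · exact h.old_notMem_cluster (by simp [hv])
    · exact (hD (h.mem v hv)).elim
    · exact (htail v hv).2
  by_contra hyD
  set M : Set (Vertex k) := {v | v ∈ α ++ ((τ ++ z :: E) ++ η)}
  have hDM : ∀ v ∈ D, v ∈ α ++ ((τ ++ z :: E) ++ β') → v ∈ M := fun v hv hv' => by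
    have := (h.path_mem_iff hv).1 hv'
    exact List.mem_append_right _ (List.mem_append_left _ this)
  have hzM : z ∈ M := hDM z (h.mem z (by simp)) (by simp)
  suffices hsub : cluster (rewire ω D (newEdge α τ z E β' Q)) ((R \ M) ∪ {y}) C ⊆
      {v | v ∉ M ∧ (v ∈ D ∨ v ∈ cluster ω R C)} from (hsub hy).1 hyγ'
  have hyC := hnotC y hyγ' hyD
  have hyR : y ∈ R := h.subset (hγ'.isOpenChain.subset y hyγ')
  refine cluster_subset_of_closed ?_ ?_
  · rintro c ⟨hcC, hc⟩
    have hcR : c ∈ R := by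
      rcases hc with hc | rfl
      exacts [hc.1, hyR]
    have hcC' := subset_cluster (ω := ω) hcC hcR
    rcases hc with hc | rfl
    · exact ⟨hc.2, .inr hcC'⟩
    · exact (hyC hcC').elim
  · rintro v ⟨hvM, hv⟩ w ⟨hvU, hwU, hvw⟩
    have hwR : w ∈ R := by
      rcases hwU with hw | rfl
      exacts [hw.1, hyR]
    have hvR : v ∈ R := by
      rcases hvU with hv | rfl
      exacts [hv.1, hyR]
    have hfin : w ≠ y → w ∉ M := fun hne => by
      rcases hwU with hw | hw
      exacts [hw.2, (hne hw).elim]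
    by_cases hvD : v ∈ D
    · have hvκ : v ∉ α ++ ((τ ++ z :: E) ++ β') := fun h' => hvM (hDM v hvD h')
      have hvz : v ≠ z := fun e => hvM (e ▸ hzM)
      have hw : w = z ∨ w ∈ Q := by
        rcases edge_cases (.inl hvD) hvw with (h1 | h1) | (h1 | h1)
        · exact (hvκ h1.mem_left).elim
        · exact (hvκ h1.mem_right).elim
        · exact List.mem_cons.1 h1.mem_right
        · exact List.mem_cons.1 h1.mem_left
      have hwI : w ∈ D ∨ w ∈ cluster ω R C := by
        rcases hw with rfl | hw
        · exact .inl (h.mem w (by simp))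
        · exact or_iff_not_imp_left.2 (h.branch_cluster w hw)
      refine ⟨hfin ?_, hwI⟩
      rintro rfl
      exact hwI.elim hyD hyC
    · have hvC := hv.resolve_left hvD
      by_cases hwD : w ∈ D
      · exact ⟨hfin fun e => hyD (e ▸ hwD), .inl hwD⟩
      · have hwC : w ∈ cluster ω R C := cluster_step hvC
          ⟨hvR, hwR, (openEdge_rewire_of_notMem hvD hwD).1 hvw⟩
        exact ⟨hfin fun e => hyC (e ▸ hwC), .inr hwC⟩

theorem attachSet_nonempty (h : IsDetour ω S R A B C D α d β τ z E β' Q) (hS : S.Finite) :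
    (attachSet (rewire ω D (newEdge α τ z E β' Q)) S R A B C).Nonempty := by
  obtain ⟨γ', hγ'⟩ := exists_isMinimalOpenPath hS ⟨_, h.isOpenPath⟩
  obtain ⟨a, ⟨haA, haR⟩, ha⟩ := connected_iff.1 h.connected
  obtain ⟨η, rfl, -⟩ := h.exists_eq_append hγ'
  obtain ⟨c, hc, hcC⟩ := h.branch_last
  have hcQ : c ∈ Q := List.mem_of_getLast? hc
  have hzR : z ∈ R := h.subset (h.mem_region z (by simp))
  have h1 := chain_subset_cluster (R := R)
    (chain_open (F := newEdge α τ z E β' Q) h.branch_chain fun _ _ => .inr)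
    (fun v hv => (List.mem_cons.1 hv).elim (fun e => e ▸ hzR) (h.branch_mem v))
    (List.mem_cons_of_mem z hcQ) (subset_cluster hcC (h.branch_mem c hcQ)) z (by simp)
  exact SlabPercolation.attachSet_nonempty ⟨_, hγ', by simp⟩ h1

end IsDetour

/-! ### Bridges, and criteria for detours -/

theorem exists_isOpenPath_of_mem_cluster {ω : Config k} {R X : Set (Vertex k)} {v : Vertex k}
    (hv : v ∈ cluster ω R X) : ∃ l, IsOpenPath ω R {v} X l := by
  obtain ⟨x, hx, h⟩ := hv
  obtain ⟨w, hw⟩ := h.symm.exists_isPath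
  exact ⟨w.support, v, ⟨rfl, cluster_subset ⟨x, hx, h⟩⟩, x, hx, w, hw, rfl⟩

/-- Opening a path from `X` to the cluster of `Y` after closing all other edges at the vertices of
the path outside of the cluster. -/
theorem bridge {ω : Config k} {R X Y : Set (Vertex k)} {l : List (Vertex k)} {c : Vertex k}
    (hnc : ¬Connected ω R X Y) (hl : l ≠ []) (hX : ∀ x ∈ l.head?, x ∈ X)
    (hR : ∀ v ∈ l, v ∈ R) (hlY : ∀ v ∈ l, v ∉ cluster ω R Y) (hc : c ∈ cluster ω R Y)
    (hchain : (l ++ [c]).IsChain (slab k).Adj) :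
    Connected (rewire ω {v | v ∈ l} (Consecutive (l ++ [c]))) R X Y ∧
    (X ∩ cluster (rewire ω {v | v ∈ l} (Consecutive (l ++ [c]))) R Y).Nonempty ∧
    X ∩ cluster (rewire ω {v | v ∈ l} (Consecutive (l ++ [c]))) R Y ⊆ {v | v ∈ l} := by
  set ω' := rewire ω {v | v ∈ l} (Consecutive (l ++ [c]))
  have hcR : c ∈ R := cluster_subset hc
  have hopen : (l ++ [c]).IsChain (OpenEdge ω') := by
    refine isChain_imp_of_consecutive hchain fun x y hxy hadj => ?_
    refine (openEdge_rewire_of_mem (.inl ?_)).2 ⟨hadj, .inl hxy⟩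
    obtain ⟨l₁, l₂, h⟩ := hxy
    have h' : l ++ [c] = (l₁ ++ [x]) ++ (y :: l₂) := by simpa using h
    rcases List.append_eq_append_iff.1 h' with ⟨a, ha, hb⟩ | ⟨a, ha, hb⟩
    · have : a = [] := by
        have := congrArg List.length hb
        simp at this
        exact List.length_eq_zero_iff.1 (by omega)
      subst this
      rw [List.append_nil] at ha
      change x ∈ l
      rw [← ha]
      simp
    · change x ∈ l
      rw [ha]
      simp
  -- The edges inside the cluster of `Y` are untouched, since `l` avoids it.
  have hsub : cluster ω R Y ⊆ cluster ω' R Y := by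
    refine (cluster_subset_of_closed (I := cluster ω R Y ∩ cluster ω' R Y) (fun x hx =>
      ⟨subset_cluster hx.1 hx.2, subset_cluster hx.1 hx.2⟩) fun x hx y hxy => ?_).trans
      Set.inter_subset_right
    have hy := cluster_step hx.1 hxy
    refine ⟨hy, cluster_step hx.2 ⟨hxy.1, hxy.2.1, ?_⟩⟩
    exact (openEdge_rewire_of_notMem (fun h => hlY x h hx.1) (fun h => hlY y h hy)).2 hxy.2.2
  have hall := chain_subset_cluster (R := R) (X := Y) hopen
    (fun v hv => by
      rcases List.mem_append.1 hv with hv | hv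
      · exact hR v hv
      · rwa [List.mem_singleton.1 hv]) (x := c) (by simp) (hsub hc)
  have hhead : l.head hl ∈ X := hX _ (List.head?_eq_some_head _)
  have hhead' : l.head hl ∈ cluster ω' R Y := hall _ (by simp)
  refine ⟨(connected_iff.2 ⟨_, ⟨hhead, cluster_subset hhead'⟩, hhead'⟩).symm,
    ⟨_, hhead, hhead'⟩, ?_⟩
  rintro v ⟨hvX, hv⟩
  -- The only open edges at `l` are those of the new path, so the cluster of `Y` gains at most
  -- vertices of `l`. As `X` did not meet the old cluster, it meets the new one only on `l`.
  have hclosed : cluster ω' R Y ⊆ cluster ω R Y ∪ {v | v ∈ l} := by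
    refine cluster_subset_of_closed (fun x hx => .inl (subset_cluster hx.1 hx.2)) ?_
    rintro x hx y ⟨hxR, hyR, hxy⟩
    by_cases hxl : x ∈ l
    · rcases ((openEdge_rewire_of_mem (.inl hxl)).1 hxy).2 with h | h
      · have := h.mem_right
        rcases List.mem_append.1 this with h | h
        · exact .inr h
        · exact .inl (List.mem_singleton.1 h ▸ hc)
      · have := h.mem_left
        rcases List.mem_append.1 this with h | h
        · exact .inr h
        · exact .inl (List.mem_singleton.1 h ▸ hc)
    · by_cases hyl : y ∈ l
      · exact .inr hyl
      · exact .inl (cluster_step (hx.resolve_right hxl)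
          ⟨hxR, hyR, (openEdge_rewire_of_notMem hxl hyl).1 hxy⟩)
  refine (hclosed hv).resolve_left fun hvY => ?_
  exact hnc (connected_iff.2 ⟨v, ⟨hvX, cluster_subset hvY⟩, hvY⟩).symm

theorem IsMinimalOpenPath.notMem_of_mem_dropLast {ω : Config k} {S A B : Set (Vertex k)}
    {γ : List (Vertex k)} {v : Vertex k} (h : IsMinimalOpenPath ω S A B γ)
    (hv : v ∈ γ.dropLast) : v ∉ B := by
  rw [← List.dropLast_append_getLast h.isOpenChain.ne_nil] at h
  exact h.notMem_of_prefix hv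

/-- Only the piece inside `D` has to be checked; the rest is inherited from the old minimal path. In
`hend`, either the piece ends in `B` and the old tail is dropped, or it rejoins the old path at `e`.
In the latter case `e ∉ B` guarantees that `β'` is nonempty, because the old path ends in `B`. -/
theorem IsDetour.of_path {ω : Config k} {S R A B C D : Set (Vertex k)} {α β τ E β' Q : List (Vertex k)}
    {d z : Vertex k} (hSR : S ⊆ R) (hDA : ∀ v ∈ D, v ∉ A) (hnc : ¬Connected ω R C A)
    (hmin : IsMinimalOpenPath ω S A B (α ++ d :: β)) (hα : ∀ v ∈ α, v ∉ D)
    (hβ' : ∀ v ∈ β', v ∉ D) (hhead : (τ ++ z :: E).head? = some d)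
    (hmem : ∀ v ∈ τ ++ z :: E, v ∈ D) (hreg : ∀ v ∈ τ ++ z :: E, v ∈ S)
    (hnd : (τ ++ z :: E).Nodup) (hchain : (τ ++ z :: E).IsChain (slab k).Adj)
    (hend : (β' = [] ∧ ∀ b ∈ (z :: E).getLast?, b ∈ B) ∨
      ∃ β₁ e, d :: β = β₁ ++ e :: β' ∧ (z :: E).getLast? = some e ∧ e ∉ B)
    (hB : ∀ v ∈ (τ ++ z :: E).dropLast, v ∉ B)
    (hQlast : ∃ c ∈ Q.getLast?, c ∈ C) (hQR : ∀ v ∈ Q, v ∈ R)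
    (hQchain : (z :: Q).IsChain
      fun x y => (slab k).Adj x y ∧ (x ∉ D → y ∉ D → OpenEdge ω x y))
    (hQC : ∀ v ∈ Q, v ∉ D → v ∈ cluster ω R C) (hQdisj : ∀ v ∈ Q, v ∈ D → v ∉ τ ++ z :: E)
    (horder : ∀ q ∈ Q.head?, ∀ b ∈ (E ++ β').head?, q ∉ S ∨ Precedes b q) :
    IsDetour ω S R A B C D α d β τ z E β' Q := by
  have hγ := hmin.isOpenChain
  have hβsub : ∃ β₁, d :: β = β₁ ++ β' := by
    rcases hend with ⟨rfl, -⟩ | ⟨β₁, e, h, -⟩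
    · exact ⟨d :: β, by simp⟩
    · exact ⟨β₁ ++ [e], by simpa using h⟩
  obtain ⟨β₂, hβ₂⟩ := hβsub
  have hafter : ∀ v ∈ β', v ∈ α ++ d :: β := fun v hv => by rw [hβ₂]; simp [hv]
  obtain ⟨w, hw⟩ : ∃ w, τ ++ z :: E = d :: w := by
    cases hτ : τ ++ z :: E with
    | nil => simp at hτ
    | cons x l => rw [hτ] at hhead; simp at hhead; exact ⟨l, by rw [hhead]⟩
  have hr : ∀ x y, OpenEdge ω x y → (slab k).Adj x y ∧ (x ∉ D → y ∉ D → OpenEdge ω x y) :=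
    fun x y h => ⟨h.1, fun _ _ => h⟩
  have hγr := hγ.chain.imp hr
  have hdrop : ∀ v ∈ α, v ∉ B := fun v hv => hmin.notMem_of_mem_dropLast (by
    rw [List.dropLast_append_of_ne_nil (by simp)]
    exact List.mem_append_left _ hv)
  have hchain1 : (α ++ (τ ++ z :: E)).IsChain
      fun x y => (slab k).Adj x y ∧ (x ∉ D → y ∉ D → OpenEdge ω x y) := by
    have h1 : (α ++ [d]).IsChain
        fun x y => (slab k).Adj x y ∧ (x ∉ D → y ∉ D → OpenEdge ω x y) :=
      hγr.prefix ⟨β, by simp⟩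
    have h2 : ([d] ++ w).IsChain
        fun x y => (slab k).Adj x y ∧ (x ∉ D → y ∉ D → OpenEdge ω x y) := by
      rw [List.singleton_append, ← hw]
      exact hchain.imp_of_mem_imp fun x y hx _ hxy => ⟨hxy, fun h => (h (hmem x hx)).elim⟩
    have := List.IsChain.append_overlap h1 h2 (by simp)
    rw [hw]
    simpa using this
  have hWlast : (τ ++ z :: E).getLast? = (z :: E).getLast? := by
    rw [List.getLast?_append_of_ne_nil _ (by simp)]
  refine ⟨hSR, hDA, hnc, hmin, hα, hβ', hafter, hhead, hmem, hreg, ?_, ?_, ?_, ?_, hQlast, hQR,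
    hQchain, hQC, hQdisj, horder⟩
  · have h1 : (α ++ β').Nodup := hmin.nodup.sublist (by rw [hβ₂]; simp)
    obtain ⟨h2, h3, h4⟩ := List.nodup_append.1 h1
    refine List.nodup_append.2 ⟨h2, List.nodup_append.2 ⟨hnd, h3, ?_⟩, ?_⟩
    · rintro x hx y hy rfl
      exact hβ' x hy (hmem x hx)
    · rintro x hx y hy rfl
      rcases List.mem_append.1 hy with hy | hy
      · exact hα x hx (hmem x hy)
      · exact h4 x hx x hy rfl
  · rcases hend with ⟨rfl, -⟩ | ⟨β₁, e, h, he, -⟩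
    · simpa using hchain1
    · obtain ⟨w', hw'⟩ := List.getLast?_eq_some_iff.1 (hWlast.trans he)
      rw [hw'] at hchain1 ⊢
      have h2 : ([e] ++ β').IsChain
          fun x y => (slab k).Adj x y ∧ (x ∉ D → y ∉ D → OpenEdge ω x y) :=
        hγr.suffix ⟨α ++ β₁, by simp [h]⟩
      have := List.IsChain.append_overlap (l₁ := α ++ w') (by simpa using hchain1) h2 (by simp)
      simpa using this
  · rcases hend with ⟨rfl, h⟩ | ⟨β₁, e, h, he, heB⟩
    · intro b hb
      rw [List.append_nil, List.getLast?_append_of_ne_nil _ (by simp), hWlast] at hb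
      exact h b hb
    · have hne : β' ≠ [] := by
        rintro rfl
        exact heB (hγ.last e (by rw [h]; simp))
      intro b hb
      rw [List.getLast?_append_of_ne_nil _ (by simp), List.getLast?_append_of_ne_nil _ hne] at hb
      refine hγ.last b ?_
      rw [hβ₂, List.getLast?_append_of_ne_nil _ (by simp [hne]),
        List.getLast?_append_of_ne_nil _ hne]
      exact hb
  · intro v hv
    rcases hend with ⟨rfl, h⟩ | ⟨β₁, e, h, he, heB⟩
    · rw [List.append_nil, List.dropLast_append_of_ne_nil (by simp)] at hv
      rcases List.mem_append.1 hv with hv | hv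
      exacts [hdrop v hv, hB v hv]
    · have hne : β' ≠ [] := by
        rintro rfl
        exact heB (hγ.last e (by rw [h]; simp))
      rw [List.dropLast_append_of_ne_nil (by simp), List.dropLast_append_of_ne_nil hne] at hv
      rcases List.mem_append.1 hv with hv | hv
      · exact hdrop v hv
      rcases List.mem_append.1 hv with hv | hv
      · obtain ⟨w', hw'⟩ := List.getLast?_eq_some_iff.1 (hWlast.trans he)
        rw [hw'] at hv hB
        rcases List.mem_append.1 hv with hv | hv
        · exact hB v (by simpa using hv)
        · rwa [List.mem_singleton.1 hv]
      · refine hmin.notMem_of_mem_dropLast ?_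
        rw [hβ₂, List.dropLast_append_of_ne_nil (by simp [hne]),
          List.dropLast_append_of_ne_nil hne]
        simp [hv]

/-! ### Tripods in the 3 × 3 × 2 grid -/

/-- The neighbours of a vertex of the `3 × 3 × 2` grid; `x + 3 y + 9 h` encodes `(x, y, h)`. -/
def gridNeighbors (v : ℕ) : List ℕ :=
  let cons (b : Bool) (u : ℕ) (l : List ℕ) : List ℕ := bif b then l else u :: l
  cons (Nat.blt v 9) (v - 9) <| cons (Nat.ble 9 v) (v + 9) <|
  cons (Nat.beq (v % 3) 2) (v + 1) <| cons (Nat.beq (v % 3) 0) (v - 1) <|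
  cons (Nat.beq (v / 3 % 3) 2) (v + 3) <| cons (Nat.beq (v / 3 % 3) 0) (v - 3) []

/-- Membership in a set of vertices of the grid that is encoded by its bits. -/
def bitMem (v m : ℕ) : Bool := Nat.beq (Nat.land (Nat.shiftRight m v) 1) 1

/-- Insertion into a set of vertices of the grid that is encoded by its bits. -/
def bitInsert (v m : ℕ) : ℕ := Nat.lor (Nat.shiftLeft 1 v) m

/-- Breadth first search in the grid. The frontier consists of reversed paths; the search avoids
the vertices in `seen`. -/
def gridBfs (t : ℕ) : ℕ → ℕ → List (List ℕ) → List ℕ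
  | 0, _, _ => []
  | fuel + 1, seen, frontier =>
    -- The default `18` is not a vertex of the grid, so an empty path never reaches a target in the
    -- grid.
    match frontier.find? (fun p => Nat.beq (p.headD 18) t) with
    | some p => p.reverse
    | none =>
      let next := frontier.foldl (fun (acc : ℕ × List (List ℕ)) p =>
        (gridNeighbors (p.headD 0)).foldl (fun (acc : ℕ × List (List ℕ)) u =>
          bif bitMem u acc.1 then acc else (bitInsert u acc.1, (u :: p) :: acc.2)) acc) (seen, [])
      gridBfs t fuel next.1 next.2

/-- Depth first search in the grid for a path to `e` that avoids the vertices in `seen` and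
leaves a path from `s` to `c`. -/
def gridLink (e s c : ℕ) : ℕ → ℕ → List ℕ → ℕ → Option (List ℕ × List ℕ)
  | 0, _, _, _ => none
  | fuel + 1, seen, path, v =>
    bif Nat.beq v e then
      match gridBfs c 12 (bitInsert s (bitInsert v seen)) [[s]] with
      | [] => none
      | q => some ((v :: path).reverse, q)
    else (gridNeighbors v).findSome? fun u =>
      bif Nat.beq u c || Nat.beq u s || bitMem u seen then none
      else gridLink e s c fuel (bitInsert v seen) (v :: path) u

/-- Consecutive vertices of the list are neighbours in the grid. -/
def isGridChain : List ℕ → Bool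
  | x :: y :: l => (gridNeighbors x).any (Nat.beq y) && isGridChain (y :: l)
  | _ => true

/-- The list consists of distinct vertices of the grid, none of which is in `seen`. -/
def isGridNodup : ℕ → List ℕ → Bool
  | _, [] => true
  | seen, x :: l => Nat.blt x 18 && !bitMem x seen && isGridNodup (bitInsert x seen) l

/-- `T` leads from `d` to a junction, from where `P` leads to `e` and `Q` leads to `c`; the three
lists are disjoint. -/
def isGridTripod (d e c : ℕ) (T P Q : List ℕ) : Bool :=
  Nat.beq (T.headD 18) d && Nat.beq (P.getLastD 18) e && Nat.beq (Q.getLastD 18) c &&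
  isGridChain (T ++ P) && isGridChain (T.getLastD 0 :: Q) && isGridNodup 0 (T ++ P ++ Q)

/-- Search for two tripods with the roles of the first steps exchanged. -/
def gridSwap (d e c : ℕ) : Bool :=
  ([d] :: ((gridNeighbors d).filter fun u => !(Nat.beq u e || Nat.beq u c)).map
    fun u => [d, u]).any fun T =>
    let m := T.foldr bitInsert 0
    let l := (gridNeighbors (T.getLastD 0)).filter fun u => !bitMem u m
    l.any fun n => l.any fun s => Nat.blt n s && !(Nat.beq n c || Nat.beq s e ||
      Nat.beq s c || Nat.beq n e) &&
      -- The fuel limits this leg to 7 vertices, and the search for the other leg to 12. The search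
      -- needs no correctness proof: its output is tested by `isGridTripod`, and insufficient fuel
      -- could only make the check fail.
      match gridLink e s c 7 m [] n with
      | none => false
      | some (P, Q) =>
        match gridLink e n c 7 m [] s with
        | none => false
        | some (P', Q') => isGridTripod d e c T P Q && isGridTripod d e c T P' Q' &&
            Nat.beq (P.headD 18) (Q'.headD 18) && Nat.beq (Q.headD 18) (P'.headD 18)

/-- The search succeeds for all vertices `e` and `c` such that `d`, `e`, `c` are distinct. -/
def gridCheck (d : ℕ) : Bool :=
  (List.range 18).all fun e => (List.range 18).all fun c =>
    Nat.beq d e || Nat.beq d c || Nat.beq e c || gridSwap d e c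

/-- Corner, two kinds of side midpoint and centre of a layer represent all vertices up to
reflection. Reflections do not exchange the two horizontal axes, so `1` and `3` are separate cases.
-/
theorem gridCheck_zero : gridCheck 0 = true := by decide +kernel
theorem gridCheck_one : gridCheck 1 = true := by decide +kernel
theorem gridCheck_three : gridCheck 3 = true := by decide +kernel
theorem gridCheck_four : gridCheck 4 = true := by decide +kernel

theorem isChain_of_isGridChain : ∀ {l : List ℕ}, isGridChain l = true →
    l.IsChain fun x y => y ∈ gridNeighbors x
  | [], _ => .nil
  | [_], _ => .singleton _
  | x :: y :: l, h => by
    simp only [isGridChain, Bool.and_eq_true, List.any_eq_true] at h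
    obtain ⟨⟨u, hu, huy⟩, h⟩ := h
    rw [← Nat.eq_of_beq_eq_true huy] at hu
    exact .cons_cons hu (isChain_of_isGridChain h)

theorem bitMem_eq_testBit (v m : ℕ) : bitMem v m = m.testBit v := by
  have h : Nat.land (m >>> v) 1 = 1 &&& (m >>> v) := Nat.land_comm _ _
  have e : bitMem v m = Nat.beq (1 &&& (m >>> v)) 1 := by rw [← h]; rfl
  rw [e, Nat.testBit, Nat.one_and_eq_mod_two]
  rcases Nat.mod_two_eq_zero_or_one (m >>> v) with h | h <;> rw [h] <;> rfl

theorem testBit_bitInsert (v u m : ℕ) :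
    (bitInsert v m).testBit u = (decide (v = u) || m.testBit u) := by
  change ((1 <<< v) ||| m).testBit u = _
  rw [Nat.testBit_or, Nat.one_shiftLeft, Nat.testBit_two_pow]

theorem nodup_of_isGridNodup : ∀ {l : List ℕ} {m : ℕ}, isGridNodup m l = true →
    l.Nodup ∧ ∀ x ∈ l, x < 18 ∧ m.testBit x = false
  | [], _, _ => by simp
  | x :: l, m, h => by
    simp only [isGridNodup, Bool.and_eq_true, Bool.not_eq_true', bitMem_eq_testBit] at h
    obtain ⟨⟨h1, h2⟩, h3⟩ := h
    obtain ⟨h4, h5⟩ := nodup_of_isGridNodup h3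
    have h6 : x < 18 := by simpa using h1
    simp only [testBit_bitInsert, Bool.or_eq_false_iff, decide_eq_false_iff_not] at h5
    refine ⟨List.nodup_cons.2 ⟨fun hx => (h5 x hx).2.1 rfl, h4⟩, ?_⟩
    intro y hy
    rcases List.mem_cons.1 hy with rfl | hy
    · exact ⟨h6, h2⟩
    · exact ⟨(h5 y hy).1, (h5 y hy).2.2⟩

/-- A tripod in a graph: the path `τ ++ [z]` leads from `d` to `z`, and the disjoint paths
`z :: p :: P` and `z :: q :: Q` lead from `z` to `e` and `c`. -/
structure IsTripod {V : Type*} (Adj : V → V → Prop) (d e c : V) (τ : List V) (z p : V)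
    (P : List V) (q : V) (Q : List V) : Prop where
  head : (τ ++ [z]).head? = some d
  last_left : (p :: P).getLast? = some e
  last_right : (q :: Q).getLast? = some c
  chain_left : (τ ++ z :: p :: P).IsChain Adj
  chain_right : (z :: q :: Q).IsChain Adj
  nodup : (τ ++ z :: p :: P ++ q :: Q).Nodup

theorem IsTripod.map {V W : Type*} {Adj : V → V → Prop} {Adj' : W → W → Prop} {d e c : V}
    {τ : List V} {z p : V} {P : List V} {q : V} {Q : List V} (h : IsTripod Adj d e c τ z p P q Q)
    (φ : V → W) (hφ : ∀ x ∈ τ ++ z :: p :: P ++ q :: Q, ∀ y ∈ τ ++ z :: p :: P ++ q :: Q,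
      Adj x y → Adj' (φ x) (φ y))
    (hinj : Set.InjOn φ {x | x ∈ τ ++ z :: p :: P ++ q :: Q}) :
    IsTripod Adj' (φ d) (φ e) (φ c) (τ.map φ) (φ z) (φ p) (P.map φ) (φ q) (Q.map φ) where
  head := by simpa using congrArg (Option.map φ) h.head
  last_left := by rw [← List.map_cons, List.getLast?_map, h.last_left]; rfl
  last_right := by rw [← List.map_cons, List.getLast?_map, h.last_right]; rfl
  chain_left := by
    have h' : (τ ++ z :: p :: P).IsChain fun x y => Adj' (φ x) (φ y) :=
      h.chain_left.imp_of_mem_imp fun x y hx hy hxy =>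
        hφ x (List.mem_append_left _ hx) y (List.mem_append_left _ hy) hxy
    simpa using (List.isChain_map φ).2 h'
  chain_right := by
    have h' : (z :: q :: Q).IsChain fun x y => Adj' (φ x) (φ y) :=
      h.chain_right.imp_of_mem_imp fun x y hx hy hxy =>
        hφ x (by simp at hx ⊢; tauto) y (by simp at hy ⊢; tauto) hxy
    simpa using (List.isChain_map φ).2 h'
  nodup := by
    have := h.nodup.map_on (f := φ) fun x hx y hy => hinj hx hy
    simpa using this

theorem exists_isTripod_of_isGridTripod {d e c : ℕ} {T P Q : List ℕ} (hd : d < 18) (he : e < 18)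
    (hc : c < 18) (h : isGridTripod d e c T P Q = true) :
    ∃ τ z p P' q Q', T = τ ++ [z] ∧ P = p :: P' ∧ Q = q :: Q' ∧
      IsTripod (fun x y => y ∈ gridNeighbors x) d e c τ z p P' q Q' ∧
      ∀ v ∈ τ ++ z :: p :: P' ++ q :: Q', v < 18 := by
  simp only [isGridTripod, Bool.and_eq_true] at h
  obtain ⟨⟨⟨⟨⟨h1, h2⟩, h3⟩, h4⟩, h5⟩, h6⟩ := h
  replace h1 := Nat.eq_of_beq_eq_true h1
  replace h2 := Nat.eq_of_beq_eq_true h2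
  replace h3 := Nat.eq_of_beq_eq_true h3
  rcases List.eq_nil_or_concat T with rfl | ⟨τ, z, rfl⟩
  · simp at h1; omega
  rcases P with _ | ⟨p, P⟩
  · simp at h2; omega
  rcases Q with _ | ⟨q, Q⟩
  · simp at h3; omega
  have h7 := nodup_of_isGridNodup h6
  have h4' := isChain_of_isGridChain h4
  have h5' := isChain_of_isGridChain h5
  simp only [List.getLastD_eq_getLast?, List.getLast?_append, List.getLast?_singleton,
    Option.some_or, Option.getD_some, List.concat_eq_append] at h5'
  refine ⟨τ, z, p, P, q, Q, by simp, rfl, rfl, ⟨?_, ?_, ?_, by simpa using h4', h5',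
    by simpa using h7.1⟩, fun v hv => (h7.2 v (by simpa using hv)).1⟩
  · rw [← h1]
    cases τ <;> simp
  · rw [← h2, List.getLastD_eq_getLast?]
    simp [List.getLast?_cons]
  · rw [← h3, List.getLastD_eq_getLast?]
    simp [List.getLast?_cons]

/-- The two tripods share stem and junction, with the first steps of their legs exchanged. However
an embedding orders the images of `n` and `s`, one of the two tripods has the smaller step on its
leg to `e`. -/
theorem exists_isTripod_pair_of_gridCheck {d e c : ℕ} (h : gridCheck d = true) (hd : d < 18)
    (he : e < 18) (hc : c < 18) (hde : d ≠ e) (hdc : d ≠ c) (hec : e ≠ c) :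
    ∃ τ z n P s Q P' Q',
      IsTripod (fun x y => y ∈ gridNeighbors x) d e c τ z n P s Q ∧
      IsTripod (fun x y => y ∈ gridNeighbors x) d e c τ z s P' n Q' ∧
      (∀ v ∈ τ ++ z :: n :: P ++ s :: Q, v < 18) ∧ ∀ v ∈ τ ++ z :: s :: P' ++ n :: Q', v < 18 := by
  have h1 : gridSwap d e c = true := by
    simp only [gridCheck, List.all_eq_true, List.mem_range] at h
    have := h e he c hc
    simpa [hde, hdc, hec] using this
  simp only [gridSwap, List.any_eq_true, Bool.and_eq_true] at h1
  obtain ⟨T, -, n, -, s, -, -, h2⟩ := h1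
  split at h2
  · simp at h2
  split at h2
  · simp at h2
  rename_i P Q _ _ P' Q' _
  simp only [Bool.and_eq_true] at h2
  obtain ⟨⟨⟨h3, h4⟩, h5⟩, h6⟩ := h2
  obtain ⟨τ, z, p, P, q, Q, rfl, rfl, rfl, h7, h8⟩ :=
    exists_isTripod_of_isGridTripod hd he hc h3
  obtain ⟨τ', z', p', P', q', Q', h9, rfl, rfl, h10, h11⟩ :=
    exists_isTripod_of_isGridTripod hd he hc h4
  obtain ⟨hτ, hz⟩ := List.append_inj' h9 rfl
  obtain rfl : z = z' := by simpa using hz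
  subst hτ
  replace h5 : p = q' := by simpa using h5
  replace h6 : q = p' := by simpa using h6
  subst h5 h6
  exact ⟨τ, z, p, P, q, Q, P', Q', h7, h10, h8, h11⟩

/-- Reflection of the `3 × 3 × 2` grid in some of the coordinates. -/
def gridReflect (a b h : Bool) (v : ℕ) : ℕ :=
  (if a then 2 - v % 3 else v % 3) + 3 * (if b then 2 - v / 3 % 3 else v / 3 % 3) +
    9 * (if h then 1 - v / 9 else v / 9)

theorem gridReflect_lt : ∀ a b h : Bool, ∀ v < 18, gridReflect a b h v < 18 := by decide

theorem gridReflect_gridReflect : ∀ a b h : Bool, ∀ v < 18,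
    gridReflect a b h (gridReflect a b h v) = v := by decide

theorem gridReflect_mem_gridNeighbors : ∀ a b h : Bool, ∀ v < 18, ∀ u < 18,
    u ∈ gridNeighbors v → gridReflect a b h u ∈ gridNeighbors (gridReflect a b h v) := by
  decide +kernel

theorem exists_gridReflect_mem : ∀ v < 18, ∃ a b h : Bool,
    gridReflect a b h v ∈ [0, 1, 3, 4] := by decide

/-- Three distinct vertices of a copy of the `3 × 3 × 2` grid are joined by a tripod such that the
step towards the second vertex precedes the step towards the third one. -/
theorem exists_isTripod {V : Type*} {Adj lt : V → V → Prop} (hlt : ∀ a b, a ≠ b → lt a b ∨ lt b a)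
    {φ : ℕ → V} (hadj : ∀ x < 18, ∀ y < 18, y ∈ gridNeighbors x → Adj (φ x) (φ y))
    (hinj : Set.InjOn φ (Set.Iio 18)) {d e c : V} (hd : d ∈ φ '' Set.Iio 18)
    (he : e ∈ φ '' Set.Iio 18) (hc : c ∈ φ '' Set.Iio 18) (hde : d ≠ e) (hdc : d ≠ c)
    (hec : e ≠ c) :
    ∃ τ z p P q Q, IsTripod Adj d e c τ z p P q Q ∧ lt p q ∧
      ∀ v ∈ τ ++ z :: p :: P ++ q :: Q, v ∈ φ '' Set.Iio 18 := by
  obtain ⟨d, hd, rfl⟩ := hd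
  obtain ⟨e, he, rfl⟩ := he
  obtain ⟨c, hc, rfl⟩ := hc
  simp only [Set.mem_Iio] at hd he hc
  obtain ⟨a, b, h, hmem⟩ := exists_gridReflect_mem d hd
  set ρ := gridReflect a b h
  have hρ : ∀ v < 18, ρ v < 18 := gridReflect_lt a b h
  have hρρ : ∀ v < 18, ρ (ρ v) = v := gridReflect_gridReflect a b h
  have hcheck : gridCheck (ρ d) = true := by
    simp only [List.mem_cons, List.not_mem_nil, or_false] at hmem
    rcases hmem with h | h | h | h <;> rw [h]
    exacts [gridCheck_zero, gridCheck_one, gridCheck_three, gridCheck_four]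
  have hne : ∀ {x y}, x < 18 → y < 18 → φ x ≠ φ y → ρ x ≠ ρ y := fun hx hy hxy h => hxy <| by
    rw [← hρρ _ hx, h, hρρ _ hy]
  obtain ⟨τ, z, n, P, s, Q, P', Q', h1, h2, h3, h4⟩ := exists_isTripod_pair_of_gridCheck hcheck
    (hρ d hd) (hρ e he) (hρ c hc) (hne hd he hde) (hne hd hc hdc) (hne he hc hec)
  have key : ∀ {τ z p P q Q}, IsTripod (fun x y => y ∈ gridNeighbors x) (ρ d) (ρ e) (ρ c)
      τ z p P q Q → (∀ v ∈ τ ++ z :: p :: P ++ q :: Q, v < 18) → lt (φ (ρ p)) (φ (ρ q)) →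
      ∃ τ z p P q Q, IsTripod Adj (φ d) (φ e) (φ c) τ z p P q Q ∧ lt p q ∧
        ∀ v ∈ τ ++ z :: p :: P ++ q :: Q, v ∈ φ '' Set.Iio 18 := by
    intro τ z p P q Q h1 h2 h3
    have h5 := h1.map (Adj' := Adj) (φ ∘ ρ) (fun x hx y hy hxy =>
      hadj _ (hρ x (h2 x hx)) _ (hρ y (h2 y hy))
        (gridReflect_mem_gridNeighbors a b h x (h2 x hx) y (h2 y hy) hxy))
      (fun x hx y hy hxy => by
        have := hinj (hρ x (h2 x hx)) (hρ y (h2 y hy)) hxy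
        rw [← hρρ x (h2 x hx), this, hρρ y (h2 y hy)])
    simp only [Function.comp_apply, hρρ d hd, hρρ e he, hρρ c hc] at h5
    refine ⟨_, _, _, _, _, _, h5, h3, fun v hv => ?_⟩
    have hv' : v ∈ (τ ++ z :: p :: P ++ q :: Q).map (φ ∘ ρ) := by simpa using hv
    obtain ⟨u, hu, rfl⟩ := List.mem_map.1 hv'
    exact ⟨ρ u, hρ u (h2 u hu), rfl⟩
  have hns : φ (ρ n) ≠ φ (ρ s) := fun h => by
    have hn := h3 n (by simp)
    have hs := h3 s (by simp)
    have h5 : n = s := by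
      rw [← hρρ n hn, hinj (hρ n hn) (hρ s hs) h, hρρ s hs]
    subst h5
    have := h1.nodup
    simp [List.nodup_append] at this
  rcases hlt _ _ hns with h | h
  · exact key h1 h3 h
  · exact key h2 h4 h

/-! ### Boxes, columns and blocks of the slab -/

/-- With all edges open, `openGraph` is the graph induced on the box. One moves along the two
horizontal axes and then vertically by way of height `0`. -/
theorem box_preconnected {a b c d : ℤ} {u v : Vertex k} (hu : u ∈ box k a b c d)
    (hv : v ∈ box k a b c d) :
    (openGraph (fun _ => true : Config k) (box k a b c d)).Reachable u v := by
  set G := openGraph (fun _ => true : Config k) (box k a b c d)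
  have hadj : ∀ {x y : Vertex k}, x ∈ box k a b c d → y ∈ box k a b c d → (slab k).Adj x y →
      G.Reachable x y := fun hx hy h => SimpleGraph.Adj.reachable (G := G) ⟨hx, hy, h, rfl⟩
  have h1 : ∀ (n : ℕ) (x y : ℤ) (h : Fin (k + 1)), (x, y, h) ∈ box k a b c d →
      (x + n, y, h) ∈ box k a b c d → G.Reachable (x, y, h) (x + n, y, h) := by
    intro n
    induction n with
    | zero => intro x y h _ _; simp
    | succ n ih =>
      intro x y h hx hx'
      have hm : (x + n, y, h) ∈ box k a b c d := by
        simp only [box, Set.mem_ofPred_eq] at hx hx' ⊢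
        omega
      refine (ih x y h hx hm).trans (hadj hm hx' ?_)
      simp [slab, height]
  have h2 : ∀ (n : ℕ) (x y : ℤ) (h : Fin (k + 1)), (x, y, h) ∈ box k a b c d →
      (x, y + n, h) ∈ box k a b c d → G.Reachable (x, y, h) (x, y + n, h) := by
    intro n
    induction n with
    | zero => intro x y h _ _; simp
    | succ n ih =>
      intro x y h hx hx'
      have hm : (x, y + n, h) ∈ box k a b c d := by
        simp only [box, Set.mem_ofPred_eq] at hx hx' ⊢
        omega
      refine (ih x y h hx hm).trans (hadj hm hx' ?_)
      simp [slab, height]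
  have h3 : ∀ (n : ℕ) (hn : n < k + 1) (x y : ℤ), (x, y, 0) ∈ box k a b c d →
      G.Reachable (x, y, 0) (x, y, ⟨n, hn⟩) := by
    intro n
    induction n with
    | zero => intro _ x y _; rfl
    | succ n ih =>
      intro hn x y hx
      refine (ih (by omega) x y hx).trans (hadj hx hx ?_)
      simp [slab, height]
  obtain ⟨x, y, h⟩ := u
  obtain ⟨x', y', h'⟩ := v
  have hmix : (x', y, h) ∈ box k a b c d := by
    simp only [box, Set.mem_ofPred_eq] at hu hv ⊢
    omega
  have e1 : G.Reachable (x, y, h) (x', y, h) := by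
    rcases le_total x x' with hle | hle
    · have := h1 (x' - x).toNat x y h hu
      rw [show x + ((x' - x).toNat : ℤ) = x' by omega] at this
      exact this hmix
    · have := h1 (x - x').toNat x' y h hmix
      rw [show x' + ((x - x').toNat : ℤ) = x by omega] at this
      exact (this hu).symm
  have hmix' : (x', y', h) ∈ box k a b c d := hv
  have e2 : G.Reachable (x', y, h) (x', y', h) := by
    rcases le_total y y' with hle | hle
    · have := h2 (y' - y).toNat x' y h hmix
      rw [show y + ((y' - y).toNat : ℤ) = y' by omega] at this
      exact this hmix'
    · have := h2 (y - y').toNat x' y' h hmix'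
      rw [show y' + ((y - y').toNat : ℤ) = y by omega] at this
      exact (this hmix).symm
  exact e1.trans (e2.trans (((h3 h h.2 x' y' hv).symm).trans (h3 h' h'.2 x' y' hv)))

theorem exists_path_in_box {a b c d : ℤ} {u v : Vertex k} (hu : u ∈ box k a b c d)
    (hv : v ∈ box k a b c d) : ∃ l : List (Vertex k), l.head? = some u ∧ l.getLast? = some v ∧
      (∀ w ∈ l, w ∈ box k a b c d) ∧ l.IsChain (slab k).Adj ∧ l.Nodup := by
  obtain ⟨w, hw⟩ := (box_preconnected hu hv).exists_isPath
  have h : IsOpenPath (fun _ => true : Config k) (box k a b c d) {u} {v} w.support :=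
    ⟨u, ⟨rfl, hu⟩, v, ⟨rfl, hv⟩, w, hw, rfl⟩
  obtain ⟨h1, h2⟩ := isOpenPath_iff.1 h
  refine ⟨w.support, ?_, ?_, h1.subset, h1.chain.imp fun _ _ h => h.1, h2⟩
  · rw [List.head?_eq_some_head h1.ne_nil, w.head_support]
  · rw [List.getLast?_eq_some_getLast h1.ne_nil, w.getLast_support]

/-- The vertices whose projection is at sup-norm distance at most `m` from that of `x`. -/
def column (x : Vertex k) (m : ℕ) : Set (Vertex k) := {v | distStar x v ≤ m}

theorem mem_column {x v : Vertex k} {m : ℕ} : v ∈ column x m ↔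
    v ∈ box k (x.1 - m) (x.1 + m) (x.2.1 - m) (x.2.1 + m) := by
  simp only [column, distStar, box, Set.mem_ofPred_eq, max_le_iff, abs_le]
  omega

theorem distStar_comm (x y : Vertex k) : distStar x y = distStar y x := by
  simp only [distStar, abs_sub_comm]

theorem distStar_triangle (x y z : Vertex k) : distStar x z ≤ distStar x y + distStar y z := by
  simp only [distStar, max_le_iff]
  constructor
  · have := abs_sub_le x.1 y.1 z.1
    have := le_max_left |x.1 - y.1| |x.2.1 - y.2.1|
    have := le_max_left |y.1 - z.1| |y.2.1 - z.2.1|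
    omega
  · have := abs_sub_le x.2.1 y.2.1 z.2.1
    have := le_max_right |x.1 - y.1| |x.2.1 - y.2.1|
    have := le_max_right |y.1 - z.1| |y.2.1 - z.2.1|
    omega

theorem distStar_self (x : Vertex k) : distStar x x = 0 := by simp [distStar]

theorem distStar_le_one_of_adj {x y : Vertex k} (h : (slab k).Adj x y) : distStar x y ≤ 1 := by
  change (x.1 - y.1) ^ 2 + (x.2.1 - y.2.1) ^ 2 + (height x - height y) ^ 2 = 1 at h
  simp only [distStar, max_le_iff]
  constructor <;> rw [← sq_le_one_iff_abs_le_one] <;> nlinarith [sq_nonneg (x.1 - y.1),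
    sq_nonneg (x.2.1 - y.2.1), sq_nonneg (height x - height y)]

theorem column_mono {x : Vertex k} {m m' : ℕ} (h : m ≤ m') : column x m ⊆ column x m' :=
  fun v hv => le_trans (b := (m : ℤ)) hv (by exact_mod_cast h)

/-- The intersection of a box with a column is again a box, hence connected. -/
theorem exists_path_in_column {m n : ℕ} {R : Set (Vertex k)} (hR : IsBox k n R) {x u v : Vertex k}
    (hu : u ∈ R) (hv : v ∈ R) (hxu : u ∈ column x m) (hxv : v ∈ column x m) :
    ∃ l : List (Vertex k), l.head? = some u ∧ l.getLast? = some v ∧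
      (∀ w ∈ l, w ∈ R ∧ w ∈ column x m) ∧ l.IsChain (slab k).Adj ∧ l.Nodup := by
  obtain ⟨a, b, c, d, -, -, rfl⟩ := hR
  have key : ∀ w : Vertex k, w ∈ box k (max a (x.1 - m)) (min b (x.1 + m)) (max c (x.2.1 - m))
      (min d (x.2.1 + m)) ↔ w ∈ box k a b c d ∧ w ∈ column x m := by
    intro w
    rw [mem_column]
    simp only [box, Set.mem_ofPred_eq, max_le_iff, le_min_iff]
    tauto
  obtain ⟨l, h1, h2, h3, h4⟩ := exists_path_in_box ((key u).2 ⟨hu, hxu⟩) ((key v).2 ⟨hv, hxv⟩)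
  exact ⟨l, h1, h2, fun w hw => (key w).1 (h3 w hw), h4⟩

/-- A `3 × 3 × 2` block of the slab with lowest corner `(x, y, h)`. -/
def block (x y : ℤ) (h : ℕ) (hk : h + 1 ≤ k) (v : ℕ) : Vertex k :=
  (x + (v % 3 : ℕ), y + (v / 3 % 3 : ℕ), ⟨h + v / 9 % 2, by omega⟩)

theorem mem_block {x y : ℤ} {h : ℕ} {hk : h + 1 ≤ k} {v : Vertex k} :
    v ∈ block x y h hk '' Set.Iio 18 ↔ (x ≤ v.1 ∧ v.1 ≤ x + 2) ∧ (y ≤ v.2.1 ∧ v.2.1 ≤ y + 2) ∧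
      ((h : ℤ) ≤ height v ∧ height v ≤ h + 1) := by
  constructor
  · rintro ⟨n, hn, rfl⟩
    simp only [block, height, Set.mem_Iio] at hn ⊢
    push_cast
    omega
  · obtain ⟨a, b, c⟩ := v
    simp only [height]
    rintro ⟨h1, h2, h3⟩
    refine ⟨(a - x).toNat + 3 * (b - y).toNat + 9 * ((c : ℕ) - h), ?_, ?_⟩
    · simp only [Set.mem_Iio]; omega
    · simp only [block, Prod.mk.injEq, Fin.ext_iff]
      omega

theorem block_injOn {x y : ℤ} {h : ℕ} {hk : h + 1 ≤ k} :
    Set.InjOn (block x y h hk) (Set.Iio 18) := by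
  intro n hn m hm hnm
  simp only [block, Prod.mk.injEq, Fin.mk.injEq, Set.mem_Iio] at hn hm hnm
  omega

theorem gridNeighbors_cases {n m : ℕ} (h : m ∈ gridNeighbors n) :
    (m = n + 1 ∧ n % 3 ≠ 2) ∨ (m = n - 1 ∧ n % 3 ≠ 0) ∨ (m = n + 3 ∧ n / 3 % 3 ≠ 2) ∨
    (m = n - 3 ∧ n / 3 % 3 ≠ 0) ∨ (m = n + 9 ∧ n < 9) ∨ (m = n - 9 ∧ 9 ≤ n) := by
  have key : ∀ (b : Bool) (w : ℕ) (l : List ℕ), m ∈ (bif b then l else w :: l) →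
      (b = false ∧ m = w) ∨ m ∈ l := by
    intro b w l
    cases b <;> simp
  rcases key _ _ _ h with ⟨e, h⟩ | h
  · rw [← Bool.not_eq_true, Nat.blt_eq] at e; omega
  rcases key _ _ _ h with ⟨e, h⟩ | h
  · rw [← Bool.not_eq_true, Nat.ble_eq] at e; omega
  rcases key _ _ _ h with ⟨e, h⟩ | h
  · rw [← Bool.not_eq_true, Nat.beq_eq] at e; omega
  rcases key _ _ _ h with ⟨e, h⟩ | h
  · rw [← Bool.not_eq_true, Nat.beq_eq] at e; omega
  rcases key _ _ _ h with ⟨e, h⟩ | h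
  · rw [← Bool.not_eq_true, Nat.beq_eq] at e; omega
  rcases key _ _ _ h with ⟨e, h⟩ | h
  · rw [← Bool.not_eq_true, Nat.beq_eq] at e; omega
  simp at h

theorem block_adj {x y : ℤ} {h : ℕ} {hk : h + 1 ≤ k} : ∀ n < 18, ∀ m < 18, m ∈ gridNeighbors n →
    (slab k).Adj (block x y h hk n) (block x y h hk m) := by
  intro n hn m hm hnm
  have hsuff : ∀ n < 18, ∀ m < 18, (m = n + 1 ∧ n % 3 < 2) ∨ (m = n + 3 ∧ n / 3 % 3 < 2) ∨
      m = n + 9 → (slab k).Adj (block x y h hk n) (block x y h hk m) := by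
    intro n hn m hm h'
    have e : ((x + (n % 3 : ℕ) : ℤ) - (x + (m % 3 : ℕ)) = -1 ∧ n / 3 % 3 = m / 3 % 3 ∧
          n / 9 % 2 = m / 9 % 2) ∨
        ((y + (n / 3 % 3 : ℕ) : ℤ) - (y + (m / 3 % 3 : ℕ)) = -1 ∧ n % 3 = m % 3 ∧
          n / 9 % 2 = m / 9 % 2) ∨
        (((h + n / 9 % 2 : ℕ) : ℤ) - (h + m / 9 % 2 : ℕ) = -1 ∧ n % 3 = m % 3 ∧
          n / 3 % 3 = m / 3 % 3) := by
      push_cast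
      omega
    change (_ - _) ^ 2 + (_ - _) ^ 2 + (_ - _) ^ 2 = (1 : ℤ)
    simp only [block, height]
    rcases e with ⟨e1, e2, e3⟩ | ⟨e1, e2, e3⟩ | ⟨e1, e2, e3⟩
    · rw [e1, e2, e3]; ring
    · rw [e1, e2, e3]; ring
    · rw [e1, e2, e3]; ring
  rcases gridNeighbors_cases hnm with h' | h' | h' | h' | h' | h'
  · exact hsuff n hn m hm (by omega)
  · exact (hsuff m hm n hn (by omega)).symm
  · exact hsuff n hn m hm (by omega)
  · exact (hsuff m hm n hn (by omega)).symm
  · exact hsuff n hn m hm (by omega)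
  · exact (hsuff m hm n hn (by omega)).symm

/-- Adjacency in linear form, suitable for `omega`. -/
theorem adj_bounds {x y : Vertex k} (h : (slab k).Adj x y) :
    (-1 ≤ x.1 - y.1 ∧ x.1 - y.1 ≤ 1) ∧ (-1 ≤ x.2.1 - y.2.1 ∧ x.2.1 - y.2.1 ≤ 1) ∧
      (-1 ≤ height x - height y ∧ height x - height y ≤ 1) ∧
      (height x ≠ height y → x.1 = y.1 ∧ x.2.1 = y.2.1) := by
  change (x.1 - y.1) ^ 2 + (x.2.1 - y.2.1) ^ 2 + (height x - height y) ^ 2 = 1 at h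
  have h1 := sq_nonneg (x.1 - y.1)
  have h2 := sq_nonneg (x.2.1 - y.2.1)
  have h3 := sq_nonneg (height x - height y)
  refine ⟨?_, ?_, ?_, fun hne => ?_⟩
  · constructor <;> nlinarith
  · constructor <;> nlinarith
  · constructor <;> nlinarith
  · have h4 : 0 < (height x - height y) ^ 2 := by
      have : height x - height y ≠ 0 := sub_ne_zero.2 hne
      positivity
    have h5 : (x.1 - y.1) ^ 2 = 0 := by omega
    have h6 : (x.2.1 - y.2.1) ^ 2 = 0 := by omega
    have h7 := pow_eq_zero_iff (two_ne_zero) |>.1 h5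
    have h8 := pow_eq_zero_iff (two_ne_zero) |>.1 h6
    omega

/-- Two neighbours of `a` differ by at most 2 in each horizontal coordinate, and by `hh` the three
heights span at most 1. So the vertices fit in a 3 × 3 × 2 block, which can be shifted into `S`
because its sides have length at least 2 and `k ≥ 1`. -/
theorem exists_block (hk : 1 ≤ k) {n : ℕ} (hn : 2 ≤ n) {S : Set (Vertex k)} (hS : IsBox k n S)
    {a q g : Vertex k} (ha : a ∈ S) (hq : q ∈ S) (hg : g ∈ S) (haq : (slab k).Adj a q)
    (hag : (slab k).Adj a g) (hh : height q - height g ≤ 1 ∧ height g - height q ≤ 1) :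
    ∃ (x y : ℤ) (h : ℕ) (hk : h + 1 ≤ k), (∀ v ∈ block x y h hk '' Set.Iio 18, v ∈ S) ∧
      (∀ v ∈ block x y h hk '' Set.Iio 18, distStar a v ≤ 2) ∧
      a ∈ block x y h hk '' Set.Iio 18 ∧ q ∈ block x y h hk '' Set.Iio 18 ∧
      g ∈ block x y h hk '' Set.Iio 18 := by
  obtain ⟨a₁, b₁, c₁, d₁, h1, h2, rfl⟩ := hS
  have e1 := adj_bounds haq
  have e2 := adj_bounds hag
  simp only [box, Set.mem_ofPred_eq] at ha hq hg
  have hb : ∀ v : Vertex k, 0 ≤ height v ∧ height v ≤ k := fun v => by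
    have := v.2.2.2
    simp only [height]
    omega
  have ha' := hb a
  have hq' := hb q
  have hg' := hb g
  -- The leftmost position that still covers the three vertices, pushed back to `a₁` if it would
  -- leave `S`.
  obtain ⟨x, hx⟩ : ∃ x : ℤ, a₁ ≤ x ∧ x + 2 ≤ b₁ ∧ (x ≤ a.1 ∧ a.1 ≤ x + 2) ∧
      (x ≤ q.1 ∧ q.1 ≤ x + 2) ∧ (x ≤ g.1 ∧ g.1 ≤ x + 2) :=
    ⟨max a₁ (max a.1 (max q.1 g.1) - 2), by omega⟩
  obtain ⟨y, hy⟩ : ∃ y : ℤ, c₁ ≤ y ∧ y + 2 ≤ d₁ ∧ (y ≤ a.2.1 ∧ a.2.1 ≤ y + 2) ∧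
      (y ≤ q.2.1 ∧ q.2.1 ≤ y + 2) ∧ (y ≤ g.2.1 ∧ g.2.1 ≤ y + 2) :=
    ⟨max c₁ (max a.2.1 (max q.2.1 g.2.1) - 2), by omega⟩
  obtain ⟨h, hh'⟩ : ∃ h : ℤ, 0 ≤ h ∧ h + 1 ≤ k ∧ (h ≤ height a ∧ height a ≤ h + 1) ∧
      (h ≤ height q ∧ height q ≤ h + 1) ∧ (h ≤ height g ∧ height g ≤ h + 1) :=
    ⟨min (k - 1) (min (height a) (min (height q) (height g))), by omega⟩
  refine ⟨x, y, h.toNat, by omega, fun v hv => ?_, fun v hv => ?_, mem_block.2 (by omega),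
    mem_block.2 (by omega), mem_block.2 (by omega)⟩
  · rw [mem_block] at hv
    simp only [box, Set.mem_ofPred_eq]
    omega
  · rw [mem_block] at hv
    simp only [distStar, max_le_iff, abs_le]
    omega

/-- The predecessor and the successor of a vertex on a path cannot both be opposite to a third
neighbour in the vertical direction. -/
theorem exists_neighbor_height {a q g g' : Vertex k} (haq : (slab k).Adj a q)
    (hag : (slab k).Adj a g) (hag' : (slab k).Adj a g') (hne : g ≠ g') :
    (height q - height g ≤ 1 ∧ height g - height q ≤ 1) ∨
      (height q - height g' ≤ 1 ∧ height g' - height q ≤ 1) := by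
  have e1 := adj_bounds haq
  have e2 := adj_bounds hag
  have e3 := adj_bounds hag'
  by_contra hc
  apply hne
  have : g.1 = g'.1 ∧ g.2.1 = g'.2.1 ∧ height g = height g' := by omega
  obtain ⟨x, y, h⟩ := g
  obtain ⟨x', y', h'⟩ := g'
  simp only [height, Nat.cast_inj, Fin.val_inj] at this
  obtain ⟨rfl, rfl, rfl⟩ := this
  rfl

/-! ### Local modifications at a contact -/

/-- The configurations agree except at edges with an endpoint in `D`. -/
def AgreeOff (D : Set (Vertex k)) (ω ω' : Config k) : Prop :=
  ∀ e : (slab k).edgeSet, (∀ v ∈ D, v ∉ e.1) → ω' e = ω e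

theorem agreeOff_rewire {D D' : Set (Vertex k)} (h : D ⊆ D') (ω : Config k)
    (F : Vertex k → Vertex k → Prop) : AgreeOff D' ω (rewire ω D F) :=
  fun _ he => rewire_apply_of_notMem fun v hv => he v (h hv)

/-- If `X` comes close to the cluster of `Y`, then a local modification joins them, after which all
vertices of `X` in the cluster of `Y` are close. -/
theorem exists_bridge {n m : ℕ} {ω : Config k} {R X Y : Set (Vertex k)} (hR : IsBox k n R)
    (hnc : ¬Connected ω R X Y) {x u w : Vertex k} (hu : u ∈ X) (huR : u ∈ R)
    (hw : w ∈ cluster ω R Y) (hxu : u ∈ column x m) (hxw : w ∈ column x m) :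
    ∃ ω', AgreeOff (column x m) ω ω' ∧ Connected ω' R X Y ∧
      (X ∩ cluster ω' R Y).Nonempty ∧ X ∩ cluster ω' R Y ⊆ column x m := by
  obtain ⟨l, h1, h2, h3, h4, -⟩ := exists_path_in_column hR huR (cluster_subset hw) hxu hxw
  -- Only the part before the first vertex in the cluster of `Y` is rewired, since `bridge` requires
  -- a path that avoids the cluster.
  obtain ⟨l₁, c, l₂, rfl, hl₁, hc⟩ := exists_first (P := (· ∈ cluster ω R Y)) (l := l)
    ⟨w, List.mem_of_getLast? h2, hw⟩
  have hne : l₁ ≠ [] := by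
    rintro rfl
    obtain rfl : c = u := by simpa using h1
    exact hnc (connected_iff.2 ⟨c, ⟨hu, huR⟩, hc⟩).symm
  have hhead : ∀ x ∈ l₁.head?, x ∈ X := by
    intro x hx
    rw [List.head?_append, hx] at h1
    obtain rfl : x = u := by simpa using h1
    exact hu
  have hsub : {v | v ∈ l₁} ⊆ column x m := fun v hv => (h3 v (List.mem_append_left _ hv)).2
  obtain ⟨h5, h6, h7⟩ := bridge hnc hne hhead (fun v hv => (h3 v (List.mem_append_left _ hv)).1)
    hl₁ hc (h4.prefix ⟨l₂, by simp⟩)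
  exact ⟨_, agreeOff_rewire hsub _ _, h5, h6, h7.trans hsub⟩

theorem IsDetour.exists_config {n : ℕ} {ω : Config k} {S R A B C D : Set (Vertex k)}
    {α β τ E β' Q : List (Vertex k)} {d z x : Vertex k} (hS : S.Finite)
    (h : IsDetour ω S R A B C D α d β τ z E β' Q) (hD : D ⊆ column x n) :
    ∃ ω', AgreeOff (column x n) ω ω' ∧ Connected ω' R C A ∧
      (attachSet ω' S R A B C).Nonempty ∧ attachSet ω' S R A B C ⊆ column x n :=
  ⟨_, agreeOff_rewire hD _ _, h.connected, h.attachSet_nonempty hS, h.attachSet_subset.trans hD⟩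

/-- The detour through a block of the slab in which the minimal path, entering the block at `d` and
leaving it at `e`, is joined to the continuation `c :: M` of a path to `C`. -/
theorem exists_isDetour_of_block {ω : Config k} {S R A B C D : Set (Vertex k)}
    {α β₁ β' s M : List (Vertex k)} {d e c : Vertex k} {x y : ℤ} {h : ℕ} {hk : h + 1 ≤ k}
    (hSR : S ⊆ R) (hnc : ¬Connected ω R C A)
    (hD : D = block x y h hk '' Set.Iio 18 ∪ {v | v ∈ s}) (hDA : ∀ v ∈ D, v ∉ A)
    (hblock : ∀ v ∈ block x y h hk '' Set.Iio 18, v ∈ S)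
    (hγ : IsMinimalOpenPath ω S A B (α ++ d :: (β₁ ++ e :: β')))
    (hα : ∀ v ∈ α, v ∉ D) (hd : d ∈ block x y h hk '' Set.Iio 18)
    (he : e ∈ block x y h hk '' Set.Iio 18) (hβ' : ∀ v ∈ β', v ∉ D)
    (hc : c ∈ block x y h hk '' Set.Iio 18)
    (hcγ : c ∉ α ++ d :: (β₁ ++ e :: β')) (hM : ∀ v ∈ M, v ∉ block x y h hk '' Set.Iio 18)
    (hMR : ∀ v ∈ M, v ∈ R) (hMC : ∀ v ∈ M, v ∈ s ∨ v ∈ cluster ω R C)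
    (hMlast : ∃ v ∈ (c :: M).getLast?, v ∈ C)
    (hMchain : (c :: M).IsChain
      fun x y => (slab k).Adj x y ∧ (x ∉ D → y ∉ D → OpenEdge ω x y)) :
    ∃ τ z E β'' Q, IsDetour ω S R A B C D α d (β₁ ++ e :: β') τ z E β'' Q := by
  have hblockD : ∀ v ∈ block x y h hk '' Set.Iio 18, v ∈ D := fun v hv => hD ▸ .inl hv
  have hde : d ≠ e := by
    rintro rfl
    have := hγ.nodup
    simp [List.nodup_append] at this
  have hdc : d ≠ c := by
    rintro rfl
    exact hcγ (by simp)
  have hec : e ≠ c := by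
    rintro rfl
    exact hcγ (by simp)
  obtain ⟨τ, z, p, P, q, Q, ht, hpq, htmem⟩ := exists_isTripod precedes_trichotomous
    (block_adj (x := x) (y := y) (h := h) (hk := hk)) block_injOn hd he hc hde hdc hec
  obtain ⟨Q', hQ'⟩ := List.getLast?_eq_some_iff.1 ht.last_right
  have hW : ∀ v ∈ τ ++ z :: p :: P, v ∈ block x y h hk '' Set.Iio 18 := fun v hv =>
    htmem v (List.mem_append_left _ hv)
  have hQ : ∀ v ∈ q :: Q, v ∈ block x y h hk '' Set.Iio 18 := fun v hv =>
    htmem v (List.mem_append_right _ hv)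
  have hWnd : (τ ++ z :: p :: P).Nodup := (List.nodup_append.1 ht.nodup).1
  have hWhead : (τ ++ z :: p :: P).head? = some d := by
    have := ht.head
    rw [← this]
    cases τ <;> simp
  -- properties of the branch `q :: Q ++ M`
  have hBlast : ∃ v ∈ (q :: Q ++ M).getLast?, v ∈ C := by
    rw [hQ', List.append_assoc, List.singleton_append,
      List.getLast?_append_of_ne_nil _ (by simp)]
    exact hMlast
  have hBR : ∀ v ∈ q :: Q ++ M, v ∈ R := fun v hv => by
    rcases List.mem_append.1 hv with hv | hv
    exacts [hSR (hblock v (hQ v hv)), hMR v hv]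
  have hBchain : (z :: (q :: Q ++ M)).IsChain
      fun x y => (slab k).Adj x y ∧ (x ∉ D → y ∉ D → OpenEdge ω x y) := by
    have h1 : (z :: q :: Q).IsChain
        fun x y => (slab k).Adj x y ∧ (x ∉ D → y ∉ D → OpenEdge ω x y) :=
      ht.chain_right.imp_of_mem_imp fun x y hx _ hxy => ⟨hxy, fun hxD => (hxD <| by
        rcases List.mem_cons.1 hx with rfl | hx
        · exact hblockD _ (hW _ (by simp))
        · exact hblockD _ (hQ _ hx)).elim⟩
    rw [hQ', ← List.cons_append] at h1
    have := List.IsChain.append_overlap h1 (by simpa using hMchain) (by simp)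
    rw [hQ']
    simpa using this
  have hBC : ∀ v ∈ q :: Q ++ M, v ∉ D → v ∈ cluster ω R C := fun v hv hvD => by
    rcases List.mem_append.1 hv with hv | hv
    · exact (hvD (hblockD v (hQ v hv))).elim
    · exact (hMC v hv).resolve_left fun hvs => hvD (hD ▸ .inr hvs)
  have hBdisj : ∀ v ∈ q :: Q ++ M, v ∉ τ ++ z :: p :: P := fun v hv hvW => by
    rcases List.mem_append.1 hv with hv | hv
    · exact (List.nodup_append.1 ht.nodup).2.2 v hvW v hv rfl
    · exact hM v hv (hW v hvW)
  -- A path through the tripod may hit `B` before it reaches `e`. It is then cut at its first vertex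
  -- `b` in `B`, since a detour may meet `B` only at its end.
  by_cases hB : ∃ v ∈ τ ++ z :: p :: P, v ∈ B
  · obtain ⟨W₁, b, W₂, hWeq, hW₁, hb⟩ := exists_first hB
    have hpre : ∀ v ∈ W₁ ++ [b], v ∈ τ ++ z :: p :: P := fun v hv => by
      rw [hWeq]
      simp only [List.mem_append, List.mem_cons, List.not_mem_nil, or_false] at hv ⊢
      tauto
    have hprefix : W₁ ++ [b] <+: τ ++ z :: p :: P := ⟨W₂, by simp [hWeq]⟩
    have hprehead : (W₁ ++ [b]).head? = some d := by
      rw [← hWhead, hWeq]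
      cases W₁ <;> simp
    have hleft : ∀ a', W₁ = (τ ++ [z]) ++ a' → p :: P = a' ++ b :: W₂ →
        ∃ τ z E β'' Q, IsDetour ω S R A B C D α d (β₁ ++ e :: β') τ z E β'' Q := by
      rintro a' rfl ha'
      have heq : τ ++ z :: (a' ++ [b]) = τ ++ [z] ++ a' ++ [b] := by simp
      refine ⟨τ, z, a' ++ [b], [], q :: Q ++ M, IsDetour.of_path hSR hDA hnc hγ hα (by simp)
        (by rw [heq, hprehead])
        (fun v hv => hblockD v (hW v (hpre v (heq ▸ hv))))
        (fun v hv => hblock v (hW v (hpre v (heq ▸ hv))))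
        (heq ▸ hWnd.sublist hprefix.sublist) (heq ▸ ht.chain_left.prefix hprefix) (.inl ⟨rfl, ?_⟩)
        ?_ hBlast hBR hBchain hBC (fun v hv _ hv' => hBdisj v hv (hpre v (heq ▸ hv'))) ?_⟩
      · intro v hv
        rw [List.getLast?_cons, List.getLast?_append_of_ne_nil _ (by simp)] at hv
        obtain rfl : b = v := by simpa using hv
        exact hb
      · intro v hv
        rw [heq, List.dropLast_concat] at hv
        exact hW₁ v hv
      · intro v hv u hu
        obtain rfl : q = v := by simpa using hv
        obtain rfl : p = u := by
          cases a' with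
          | nil => simp at ha' hu; rw [ha'.1, hu]
          | cons w a' => simp at ha' hu; rw [ha'.1, hu]
        exact .inr hpq
    have hWeq' : (τ ++ [z]) ++ (p :: P) = W₁ ++ b :: W₂ := by rw [← hWeq]; simp
    rcases List.append_eq_append_iff.1 hWeq' with ⟨a', h1, h2⟩ | ⟨c', h1, h2⟩
    · exact hleft a' h1 h2
    · cases c' with
      | nil => exact hleft [] (by simpa using h1.symm) (by simpa using h2.symm)
      | cons w c' =>
        -- Here `b` lies on the stem or is `z`. It becomes the new junction, the path ends there,
        -- and the rest of the stem is handed over to the branch. The path has no next vertex, so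
        -- the order condition is empty.
        obtain ⟨rfl, rfl⟩ : b = w ∧ W₂ = c' ++ p :: P := by simpa using h2
        obtain ⟨r, hr⟩ : ∃ r, b :: c' = r ++ [z] := by
          rcases List.eq_nil_or_concat (b :: c') with h | ⟨r, z', h⟩
          · simp at h
          · refine ⟨r, ?_⟩
            rw [h] at h1
            have := congrArg List.getLast? h1
            simp only [List.getLast?_concat, List.concat_eq_append, ← List.append_assoc] at this
            rw [h, List.concat_eq_append, Option.some.inj this]
        have hsuf : b :: c' <:+: τ ++ z :: p :: P := ⟨W₁, p :: P, by rw [hWeq]; simp⟩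
        refine ⟨W₁, b, [], [], c' ++ (q :: Q ++ M), IsDetour.of_path hSR hDA hnc hγ hα (by simp)
          hprehead (fun v hv => hblockD v (hW v (hpre v hv)))
          (fun v hv => hblock v (hW v (hpre v hv)))
          (hWnd.sublist hprefix.sublist) (ht.chain_left.prefix hprefix)
          (.inl ⟨rfl, fun v hv => ?_⟩) (fun v hv => hW₁ v (by simpa using hv)) ?_ ?_ ?_ ?_ ?_
          (by simp)⟩
        · obtain rfl : b = v := by simpa using hv
          exact hb
        · rw [List.getLast?_append_of_ne_nil _ (by simp)]
          exact hBlast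
        · intro v hv
          rcases List.mem_append.1 hv with hv | hv
          · exact hSR (hblock v (hW v (hsuf.subset (List.mem_cons_of_mem _ hv))))
          · exact hBR v hv
        · have h3 : (r ++ [z]).IsChain
              fun x y => (slab k).Adj x y ∧ (x ∉ D → y ∉ D → OpenEdge ω x y) := by
            rw [← hr]
            exact (ht.chain_left.infix hsuf).imp_of_mem_imp fun x y hx _ hxy =>
              ⟨hxy, fun hxD => (hxD (hblockD _ (hW _ (hsuf.subset hx)))).elim⟩
          have := List.IsChain.append_overlap h3
            (l₃ := q :: Q ++ M) (by simpa using hBchain) (by simp)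
          rw [← hr] at this
          simpa using this
        · intro v hv hvD
          rcases List.mem_append.1 hv with hv | hv
          · exact (hvD (hblockD v (hW v (hsuf.subset (List.mem_cons_of_mem _ hv))))).elim
          · exact hBC v hv hvD
        · intro v hv _ hv'
          rcases List.mem_append.1 hv with hv | hv
          · rw [hWeq] at hWnd
            rcases List.mem_append.1 hv' with hv' | hv'
            · exact (List.nodup_append.1 hWnd).2.2 v hv' v (by simp [hv]) rfl
            · have := (List.nodup_cons.1 (List.nodup_append.1 hWnd).2.1).1
              rw [List.mem_singleton.1 hv'] at hv
              exact this (by simp [hv])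
          · exact hBdisj v hv (hpre v hv')
  · push Not at hB
    refine ⟨τ, z, p :: P, β', q :: Q ++ M, IsDetour.of_path hSR hDA hnc hγ hα hβ' hWhead
      (fun v hv => hblockD v (hW v hv)) (fun v hv => hblock v (hW v hv)) hWnd ht.chain_left
      (.inr ⟨d :: β₁, e, by simp, ?_, ?_⟩) (fun v hv => hB v (List.mem_of_mem_dropLast hv)) hBlast
      hBR hBchain hBC (fun v hv _ => hBdisj v hv) ?_⟩
    · rw [List.getLast?_cons, ht.last_left]; rfl
    · exact hB e (List.mem_append_right _ (List.mem_cons_of_mem _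
        (List.mem_of_getLast? ht.last_left)))
    · intro v hv u hu
      obtain rfl : q = v := by simpa using hv
      obtain rfl : p = u := by simpa using hu
      exact .inr hpq

/-- In each consecutive pair the first vertex belongs to `l`, so nothing is asked at `c`. -/
theorem isChain_concat_imp {V : Type*} {r r' : V → V → Prop} {l : List V} {c : V}
    (h : (l ++ [c]).IsChain r) (himp : ∀ x ∈ l, ∀ y, r x y → r' x y) : (l ++ [c]).IsChain r' := by
  induction l with
  | nil => simp
  | cons x l ih =>
    cases l with
    | nil =>
      simp only [List.cons_append, List.nil_append, List.isChain_cons_cons] at h ⊢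
      exact ⟨himp x (by simp) c h.1, by simp⟩
    | cons y l =>
      simp only [List.cons_append, List.isChain_cons_cons] at h ⊢
      exact ⟨himp x (by simp) y h.1, ih h.2 fun z hz => himp z (List.mem_cons_of_mem _ hz)⟩

/-- If the cluster of `C` comes close to the minimal path from `A` to `B`, away from `A`, then a
local modification joins `C` to `A` in such a way that the minimal path is attached to `C` only
locally. -/
theorem exists_detour (hk : 1 ≤ k) {n n' m : ℕ} (hn : 2 ≤ n) {ω : Config k}
    {S R A B C : Set (Vertex k)} (hS : IsBox k n S) (hR : IsBox k n' R) (hSR : S ⊆ R)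
    (hfin : S.Finite) (hnc : ¬Connected ω R C A) {x y : Vertex k} (hx : x ∈ cluster ω R C)
    (hy : y ∈ minimalPath ω S A B) (hxy : y ∈ column x m) (hA : ∀ v ∈ column x (m + 2), v ∉ A) :
    ∃ ω', AgreeOff (column x (m + 2)) ω ω' ∧ Connected ω' R C A ∧
      (attachSet ω' S R A B C).Nonempty ∧ attachSet ω' S R A B C ⊆ column x (m + 2) := by
  obtain ⟨γ, hγ, hyγ⟩ := hy
  have hγc := hγ.isOpenChain
  have hγC : ∀ v ∈ γ, v ∉ cluster ω R C := fun v hv =>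
    notMem_cluster_of_not_connected hnc (hγc.subset_cluster hSR v hv)
  obtain ⟨L, hL1, hL2, hL3, hL4, -⟩ := exists_path_in_column hR (hSR (hγc.subset y hyγ))
    (cluster_subset hx) hxy (m := m) (x := x) (v := x) (by simp [column, distStar_self])
  -- Between the last vertex `a` on the minimal path and the next vertex `c` in the cluster of `C`,
  -- the segment `s` avoids both. It is the gap that has to be opened; `M` continues it by an open
  -- path to `C`.
  obtain ⟨l₀, a, l₁, rfl, hl₁, ha⟩ := exists_last (P := (· ∈ γ)) (l := L)
    ⟨y, List.mem_of_mem_head? hL1, hyγ⟩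
  have hxl₁ : x ∈ l₁ := by
    rw [List.getLast?_append_of_ne_nil _ (by simp), List.getLast?_cons] at hL2
    cases hl : l₁.getLast? with
    | none =>
      rw [hl] at hL2
      obtain rfl : a = x := by simpa using hL2
      exact (hγC a ha hx).elim
    | some z =>
      rw [hl] at hL2
      obtain rfl : z = x := by simpa using hL2
      exact List.mem_of_getLast? hl
  obtain ⟨s, c, l₂, rfl, hs, hc⟩ := exists_first (P := (· ∈ cluster ω R C)) ⟨x, hxl₁, hx⟩
  obtain ⟨lc, hlc⟩ := exists_isOpenPath_of_mem_cluster hc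
  obtain ⟨hlc, -⟩ := isOpenPath_iff.1 hlc
  obtain ⟨lc', rfl⟩ : ∃ lc', lc = c :: lc' := by
    cases lc with
    | nil => exact (hlc.ne_nil rfl).elim
    | cons c' lc =>
      have : c' = c := hlc.head c' (by simp)
      exact ⟨lc, by rw [this]⟩
  have hlcC : ∀ v ∈ c :: lc', v ∈ cluster ω R C :=
    chain_subset_cluster hlc.chain hlc.subset (x := c) (by simp) hc
  obtain ⟨M, hM⟩ : ∃ M, M = s ++ c :: lc' := ⟨_, rfl⟩
  have hMγ : ∀ v ∈ M, v ∉ γ := fun v hv hvγ => by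
    rcases List.mem_append.1 (hM ▸ hv) with h | h
    · exact hl₁ v (by simp [h]) hvγ
    · exact hγC v hvγ (hlcC v h)
  have hMR : ∀ v ∈ M, v ∈ R := fun v hv => by
    rcases List.mem_append.1 (hM ▸ hv) with h | h
    · exact (hL3 v (by simp [h])).1
    · exact hlc.subset v h
  have hMC : ∀ v ∈ M, v ∈ s ∨ v ∈ cluster ω R C := fun v hv =>
    (List.mem_append.1 (hM ▸ hv)).imp_right (hlcC v)
  have hMlast : ∃ v ∈ M.getLast?, v ∈ C := by
    rw [hM, List.getLast?_append_of_ne_nil _ (by simp)]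
    have hv := List.getLast?_eq_some_getLast hlc.ne_nil
    exact ⟨_, hv, hlc.last _ hv⟩
  have hMadj : (a :: M).IsChain (slab k).Adj := by
    have h1 : ((a :: s) ++ [c]).IsChain (slab k).Adj := hL4.infix ⟨l₀, l₂, by simp⟩
    have := List.IsChain.append_overlap h1 (l₃ := lc') (hlc.chain.imp fun _ _ h => h.1) (by simp)
    simpa [hM] using this
  have hMchain : ∀ D : Set (Vertex k), a ∈ D → (∀ v ∈ s, v ∈ D) → (a :: M).IsChain
      fun x y => (slab k).Adj x y ∧ (x ∉ D → y ∉ D → OpenEdge ω x y) := fun D haD hsD => by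
    have h1 : ((a :: s) ++ [c]).IsChain (slab k).Adj := hL4.infix ⟨l₀, l₂, by simp⟩
    have h2 := isChain_concat_imp h1
      (r' := fun x y => (slab k).Adj x y ∧ (x ∉ D → y ∉ D → OpenEdge ω x y))
      fun x hx y hxy => ⟨hxy, fun hxD => (hxD <| by
        rcases List.mem_cons.1 hx with rfl | hx
        exacts [haD, hsD x hx]).elim⟩
    have := List.IsChain.append_overlap h2 (l₃ := lc')
      (hlc.chain.imp fun _ _ h => ⟨h.1, fun _ _ => h⟩) (by simp)
    simpa [hM] using this
  have hsγ : ∀ v ∈ s, v ∉ γ := fun v hv => hMγ v (by simp [hM, hv])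
  have hscol : ∀ v ∈ s, v ∈ column x m := fun v hv => (hL3 v (by simp [hv])).2
  have hacol : a ∈ column x m := (hL3 a (by simp)).2
  have hmono : column x m ⊆ column x (m + 2) := column_mono (by omega)
  obtain ⟨α₀, β₀, hsplit⟩ := List.append_of_mem ha
  -- If the order at `a` is right, or `a` is the end of the path, or the branch leaves `S` at once,
  -- then the minimal path is kept and the branch is attached directly at `a`.
  by_cases hord : ∀ q ∈ M.head?, ∀ b ∈ β₀.head?, q ∉ S ∨ Precedes b q
  · subst hsplit
    have hDcol : {v | v = a ∨ v ∈ s} ⊆ column x (m + 2) := by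
      rintro v (rfl | hv)
      exacts [hmono hacol, hmono (hscol v hv)]
    have hnd := List.nodup_append.1 hγ.nodup
    refine IsDetour.exists_config (D := {v | v = a ∨ v ∈ s}) (τ := []) (z := a) (E := [])
      (β' := β₀) (Q := M) hfin
      (IsDetour.of_path hSR (fun v hv => hA v (hDcol hv)) hnc hγ ?_ ?_ rfl ?_ ?_ (by simp)
      (by simp) ?_ (by simp) hMlast hMR (hMchain _ (.inl rfl) fun v hv => .inr hv) ?_ ?_ ?_) hDcol
    · rintro v hv (rfl | h)
      · exact hnd.2.2 v hv v (by simp) rfl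
      · exact hsγ v h (by simp [hv])
    · rintro v hv (rfl | h)
      · exact (List.nodup_cons.1 hnd.2.1).1 hv
      · exact hsγ v h (by simp [hv])
    · intro v hv
      exact .inl (by simpa using hv)
    · intro v hv
      obtain rfl : v = a := by simpa using hv
      exact hγc.subset v (by simp)
    · cases β₀ with
      | nil =>
        refine .inl ⟨rfl, fun b hb => ?_⟩
        obtain rfl : a = b := by simpa using hb
        exact hγc.last a (by simp)
      | cons b β₀ =>
        refine .inr ⟨[], a, rfl, rfl, hγ.notMem_of_mem_dropLast ?_⟩
        rw [List.dropLast_append_of_ne_nil (by simp)]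
        simp
    · exact fun v hv hvD => (hMC v hv).resolve_left fun h => hvD (.inr h)
    · intro v hv _ hva
      obtain rfl : v = a := by simpa using hva
      exact hMγ v hv ha
    · simpa using hord
  -- Now the branch would leave `a` towards some `q ∈ S` with the wrong order. As `a` is near `x` it
  -- is not in `A`, so it has a predecessor besides its successor `b`. One of these two, called `g`,
  -- differs in height from `q` by at most 1 and so shares a block with `a` and `q`.
  · push Not at hord
    obtain ⟨q, hq, b, hb, hqS, -⟩ := hord
    have hqM : q ∈ M := List.mem_of_mem_head? hq
    have haq : (slab k).Adj a q := by
      cases M with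
      | nil => simp at hq
      | cons q' M =>
        obtain rfl : q' = q := by simpa using hq
        exact hMadj.rel
    obtain ⟨g, hgγ, hag, hne, hh⟩ : ∃ g ∈ γ, (slab k).Adj a g ∧ a ≠ g ∧
        (height q - height g ≤ 1 ∧ height g - height q ≤ 1) := by
      obtain ⟨β, rfl⟩ : ∃ β, β₀ = b :: β := by
        cases β₀ with
        | nil => simp at hb
        | cons b' β => exact ⟨β, by simpa using hb⟩
      rcases List.eq_nil_or_concat α₀ with rfl | ⟨α, g', rfl⟩
      · exact (hA a (hmono hacol) (hγc.head a (by simp [hsplit]))).elim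
      · simp only [List.concat_eq_append, List.append_assoc, List.cons_append,
          List.nil_append] at hsplit
        have hch := hγc.chain
        have hnd := hγ.nodup
        rw [hsplit] at hch hnd
        have hch' : (g' :: a :: b :: β).IsChain (OpenEdge ω) := hch.suffix ⟨α, rfl⟩
        have hnd' : (g' :: a :: b :: β).Nodup := (List.nodup_append.1 hnd).2.1
        have hg' : (slab k).Adj a g' := hch'.rel.1.symm
        have hb' : (slab k).Adj a b := hch'.tail.rel.1
        have hgb : b ≠ g' := by
          rintro rfl
          simp at hnd'
        rcases exists_neighbor_height haq hb' hg' hgb with h | h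
        · exact ⟨b, by simp [hsplit], hb', hb'.ne, h⟩
        · exact ⟨g', by simp [hsplit], hg', hg'.ne, h⟩
    obtain ⟨x', y', h, hk', hbS, hbd, hab, hqb, hgb⟩ := exists_block hk hn hS (hγc.subset a ha) hqS
      (hγc.subset g hgγ) haq hag hh
    set K := block x' y' h hk' '' Set.Iio 18
    have hDcol : K ∪ {v | v ∈ s} ⊆ column x (m + 2) := by
      rintro v (hv | hv)
      · have h1 := hbd v hv
        have h2 := distStar_triangle x a v
        have h3 : distStar x a ≤ m := hacol
        change distStar x v ≤ ((m + 2 : ℕ) : ℤ)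
        push_cast
        omega
      · exact hmono (hscol v hv)
    have hDγ : ∀ v ∈ K ∪ {v | v ∈ s}, v ∈ γ → v ∈ K := fun v hv hvγ =>
      hv.resolve_right fun h => hsγ v h hvγ
    -- `d` and `e` are the first and the last visit of the minimal path to the modified region. Both
    -- lie in the block, because `s` avoids the path; a visit after `d` exists because the path
    -- visits both `a` and `g` in the block.
    obtain ⟨α, d, β, rfl, hα, hd⟩ := exists_first (P := (· ∈ K ∪ {v | v ∈ s})) ⟨a, ha, .inl hab⟩
    obtain ⟨β₁, e, β', rfl, hβ', he⟩ : ∃ β₁ e β', β = β₁ ++ e :: β' ∧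
        (∀ v ∈ β', v ∉ K ∪ {v | v ∈ s}) ∧ e ∈ K ∪ {v | v ∈ s} := by
      refine exists_last (P := (· ∈ K ∪ {v | v ∈ s})) ?_
      by_cases had : a = d
      · refine ⟨g, ?_, .inl hgb⟩
        rcases List.mem_append.1 hgγ with h | h
        · exact (hα g h (.inl hgb)).elim
        · exact (List.mem_cons.1 h).resolve_left fun h => hne (had.trans h.symm)
      · refine ⟨a, ?_, .inl hab⟩
        rcases List.mem_append.1 ha with h | h
        · exact (hα a h (.inl hab)).elim
        · exact (List.mem_cons.1 h).resolve_left had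
    -- The branch is entered at its last vertex in the block, so that its continuation is disjoint
    -- from the tripod.
    obtain ⟨M₁, c', M₂, hMeq, hM₂, hc'⟩ := exists_last (P := (· ∈ K)) ⟨q, hqM, hqb⟩
    have hsub : ∀ v ∈ c' :: M₂, v ∈ M := fun v hv => by rw [hMeq]; exact List.mem_append_right _ hv
    obtain ⟨τ, z, E, β'', Q, hdet⟩ := exists_isDetour_of_block (M := M₂) hSR hnc rfl
      (fun v hv => hA v (hDcol hv)) hbS hγ hα (hDγ d hd (by simp)) (hDγ e he (by simp)) hβ' hc'
      (hMγ c' (hsub c' (by simp))) hM₂ (fun v hv => hMR v (hsub v (by simp [hv])))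
      (fun v hv => hMC v (hsub v (by simp [hv])))
      (by rwa [hMeq, List.getLast?_append_of_ne_nil _ (by simp)] at hMlast)
      ((hMchain _ (.inl hab) fun v hv => .inr hv).suffix ⟨a :: M₁, by simp [hMeq]⟩)
    exact hdet.exists_config hfin hDcol

/-! ### Comparing probabilities by modification -/

section Bernoulli

open MeasureTheory Finset

variable {α : Type*}

/-- The configuration that is unchanged on `I` and closed elsewhere. -/
noncomputable def clip (I : Set α) (ω : α → Bool) : α → Bool :=
  open Classical in fun e => if e ∈ I then ω e else false

theorem clip_of_mem {I : Set α} {ω : α → Bool} {e : α} (he : e ∈ I) : clip I ω e = ω e :=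
  if_pos he

theorem clip_of_notMem {I : Set α} {ω : α → Bool} {e : α} (he : e ∉ I) : clip I ω e = false :=
  if_neg he

theorem clip_clip (I : Set α) (ω : α → Bool) : clip I (clip I ω) = clip I ω := by
  ext e
  by_cases he : e ∈ I
  · simp only [clip_of_mem he]
  · simp only [clip_of_notMem he]

/-- The configuration on all of `α` that is closed outside of `I`. -/
def extendFalse [DecidableEq α] (I : Finset α) (η : I → Bool) : α → Bool :=
  fun e => if h : e ∈ I then η ⟨e, h⟩ else false

/-- The mass of a configuration under the product of Bernoulli laws on a finite set. -/
noncomputable def weight {I : Type*} [Fintype I] (p : ℝ) (η : I → Bool) : ℝ :=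
  ∏ i, if η i then p else 1 - p

theorem clip_extendFalse [DecidableEq α] (I : Finset α) (η : I → Bool) :
    clip I (extendFalse I η) = extendFalse I η := by
  ext e
  by_cases he : e ∈ I <;> simp [clip, extendFalse, he]

theorem extendFalse_restrict [DecidableEq α] (I : Finset α) (ω : α → Bool) :
    extendFalse I (I.restrict ω) = clip I ω := by
  ext e
  by_cases he : e ∈ I <;> simp [clip, extendFalse, he]

/-- Invariance under `clip I` says that the event depends only on the finitely many coordinates in
`I`. Its probability is then a finite sum, and comparing events becomes counting. -/
theorem real_eq_sum_weight [DecidableEq α] (I : Finset α) (p : unitInterval)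
    {E : Set (α → Bool)} [DecidablePred fun η => extendFalse I η ∈ E]
    (hE : ∀ ω, clip I ω ∈ E ↔ ω ∈ E) :
    (Measure.infinitePi fun _ : α => ProbabilityTheory.bernoulliMeasure true false p).real E =
      ∑ η with extendFalse I η ∈ E, weight (p : ℝ) η := by
  have hpre : E = I.restrict ⁻¹' {η | extendFalse I η ∈ E} := by
    ext ω
    change ω ∈ E ↔ extendFalse I (I.restrict ω) ∈ E
    rw [extendFalse_restrict, hE]
  have hmeas : MeasurableSet {η : I → Bool | extendFalse I η ∈ E} := (Set.toFinite _).measurableSet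
  conv_lhs => rw [hpre]
  rw [measureReal_def, ← Measure.map_apply (measurable_restrict _) hmeas,
    Measure.infinitePi_map_restrict, ← measureReal_def]
  have hset : {η : I → Bool | extendFalse I η ∈ E} =
      ((univ.filter fun η => extendFalse I η ∈ E : Finset (I → Bool)) : Set (I → Bool)) := by
    ext; simp
  rw [hset, ← sum_measureReal_singleton]
  refine sum_congr rfl fun η _ => ?_
  rw [measureReal_def, Measure.pi_singleton, ENNReal.toReal_prod, weight]
  refine prod_congr rfl fun i _ => ?_
  rw [← measureReal_def, ProbabilityTheory.bernoulliMeasure_real_apply _ (measurableSet_singleton _)]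
  cases η i <;> simp

theorem weight_nonneg {I : Type*} [Fintype I] {p : ℝ} (h0 : 0 ≤ p) (h1 : p ≤ 1) (η : I → Bool) :
    0 ≤ weight p η :=
  prod_nonneg fun i _ => by split <;> linarith

/-- Each factor lies between `ε` and `1`, so changing at most `N` of them costs at most `ε ^ N`. -/
theorem pow_mul_weight_le {I : Type*} [Fintype I] {p ε : ℝ} (hε : 0 < ε) (h0 : ε ≤ p)
    (h1 : p ≤ 1 - ε) {η η' : I → Bool} {F : Finset I} {N : ℕ} (hF : F.card ≤ N)
    (h : ∀ i ∉ F, η i = η' i) : ε ^ N * weight p η ≤ weight p η' := by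
  classical
  have hb : ∀ b : Bool, ε ≤ (if b then p else 1 - p) ∧ (if b then p else 1 - p) ≤ 1 := by
    intro b
    cases b <;> simp <;> constructor <;> linarith
  have hw : ∀ ζ : I → Bool, weight p ζ =
      (∏ i ∈ F, if ζ i then p else 1 - p) * ∏ i ∈ Fᶜ, if ζ i then p else 1 - p :=
    fun ζ => (prod_mul_prod_compl F _).symm
  have hc : (∏ i ∈ Fᶜ, if η i then p else 1 - p) = ∏ i ∈ Fᶜ, if η' i then p else 1 - p :=
    prod_congr rfl fun i hi => by rw [h i (by simpa using hi)]
  have hpos : 0 ≤ ∏ i ∈ Fᶜ, if η' i then p else 1 - p :=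
    prod_nonneg fun i _ => hε.le.trans (hb _).1
  rw [hw η, hw η', hc, ← mul_assoc]
  refine mul_le_mul_of_nonneg_right ?_ hpos
  calc ε ^ N * ∏ i ∈ F, (if η i then p else 1 - p)
      ≤ ε ^ F.card * 1 := by
        refine mul_le_mul (pow_le_pow_of_le_one hε.le (by linarith) hF)
          (prod_le_one (fun i _ => hε.le.trans (hb _).1) fun i _ => (hb _).2)
          (prod_nonneg fun i _ => hε.le.trans (hb _).1) (by positivity)
    _ = ∏ i ∈ F, ε := by simp
    _ ≤ ∏ i ∈ F, if η' i then p else 1 - p := prod_le_prod (fun _ _ => hε.le) fun i _ => (hb _).1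

/-- Such a configuration is determined by the set of its open coordinates in `F`. -/
theorem card_filter_agree_le {I : Type*} [Fintype I] [DecidableEq I] (η : I → Bool)
    (F : Finset I) : (univ.filter fun η' : I → Bool => ∀ i ∉ F, η' i = η i).card ≤ 2 ^ F.card := by
  rw [← card_powerset]
  refine card_le_card_of_injOn (fun η' => F.filter fun i => η' i = true)
    (fun η' _ => mem_coe.2 (mem_powerset.2 (filter_subset _ _)))
    fun a ha b hb hab => ?_
  simp only [coe_filter, mem_univ, true_and, Set.mem_ofPred_eq] at ha hb
  ext i
  by_cases hi : i ∈ F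
  · have := Finset.ext_iff.1 hab i
    simp only [mem_filter, hi, true_and] at this
    exact Bool.eq_iff_iff.2 this
  · rw [ha i hi, hb i hi]

/-- Double counting of the pairs `(η, x)` with `x ∈ u η`: there are at least `t` pairs over each `η
∈ E`, and the map `f` sends at most `m * 2 ^ N` pairs to the same configuration. -/
theorem mul_sum_weight_le {I ι : Type*} [Fintype I] [DecidableEq I] {p ε : ℝ} (hε : 0 < ε)
    (h0 : ε ≤ p) (h1 : p ≤ 1 - ε) {E Y : Finset (I → Bool)} {t m N : ℕ}
    (u : (I → Bool) → Finset ι) (f : (I → Bool) → ι → I → Bool) (X : (I → Bool) → Finset ι)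
    (G : (I → Bool) → ι → Finset I) (hu : ∀ η ∈ E, t ≤ (u η).card)
    (hX : ∀ η ∈ Y, (X η).card ≤ m)
    (hf : ∀ η ∈ E, ∀ x ∈ u η, f η x ∈ Y ∧ x ∈ X (f η x) ∧ (G (f η x) x).card ≤ N ∧
      ∀ i ∉ G (f η x) x, η i = f η x i) :
    t * ε ^ N * ∑ η ∈ E, weight p η ≤ m * 2 ^ N * ∑ η ∈ Y, weight p η := by
  have hp0 : 0 ≤ p := hε.le.trans h0
  have hp1 : p ≤ 1 := by linarith
  set s := E.sigma u
  have hs : ∀ a ∈ s, f a.1 a.2 ∈ Y ∧ a.2 ∈ X (f a.1 a.2) ∧ (G (f a.1 a.2) a.2).card ≤ N ∧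
      ∀ i ∉ G (f a.1 a.2) a.2, a.1 i = f a.1 a.2 i := fun a ha =>
    hf _ (mem_sigma.1 ha).1 _ (mem_sigma.1 ha).2
  -- Given the image, at most `m` values of `x` are possible, and given `x` the original
  -- configuration is known off a set of at most `N` coordinates.
  have hfib : ∀ η ∈ Y, ((s.filter fun a => f a.1 a.2 = η).card : ℝ) ≤ m * 2 ^ N := by
    intro η hη
    suffices h : (s.filter fun a => f a.1 a.2 = η).card ≤ m * 2 ^ N by exact_mod_cast h
    set T := ((X η).filter fun x => (G η x).card ≤ N).sigma fun x =>
      univ.filter fun η' : I → Bool => ∀ i ∉ G η x, η' i = η i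
    calc (s.filter fun a => f a.1 a.2 = η).card ≤ T.card := by
          refine card_le_card_of_injOn (fun a => ⟨a.2, a.1⟩) (fun a ha => ?_) ?_
          · obtain ⟨ha', rfl⟩ := mem_filter.1 (mem_coe.1 ha)
            obtain ⟨-, h2, h3, h4⟩ := hs a ha'
            exact mem_sigma.2 ⟨mem_filter.2 ⟨h2, h3⟩, mem_filter.2 ⟨mem_univ _, h4⟩⟩
          · rintro ⟨a, x⟩ - ⟨b, y⟩ - hab
            simp only [Sigma.mk.injEq, heq_eq_eq] at hab
            obtain ⟨rfl, rfl⟩ := hab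
            rfl
      _ ≤ ∑ x ∈ (X η).filter fun x => (G η x).card ≤ N, 2 ^ N := by
          rw [card_sigma]
          exact sum_le_sum fun x hx => (card_filter_agree_le η (G η x)).trans
            (Nat.pow_le_pow_right (by norm_num) (mem_filter.1 hx).2)
      _ ≤ m * 2 ^ N := by
          rw [sum_const, smul_eq_mul]
          exact Nat.mul_le_mul_right _ ((card_filter_le _ _).trans (hX η hη))
  calc t * ε ^ N * ∑ η ∈ E, weight p η
      = ∑ η ∈ E, t * (ε ^ N * weight p η) := by
        rw [mul_sum]
        exact sum_congr rfl fun _ _ => by ring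
    _ ≤ ∑ η ∈ E, ∑ x ∈ u η, ε ^ N * weight p η := by
        refine sum_le_sum fun η hη => ?_
        rw [sum_const, nsmul_eq_mul]
        exact mul_le_mul_of_nonneg_right (by exact_mod_cast hu η hη)
          (mul_nonneg (by positivity) (weight_nonneg hp0 hp1 η))
    _ = ∑ a ∈ s, ε ^ N * weight p a.1 := (sum_sigma' _ _ _)
    _ ≤ ∑ a ∈ s, weight p (f a.1 a.2) := by
        refine sum_le_sum fun a ha => ?_
        obtain ⟨-, -, h3, h4⟩ := hs a ha
        exact pow_mul_weight_le hε h0 h1 h3 h4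
    _ = ∑ η ∈ Y, ∑ a ∈ s with f a.1 a.2 = η, weight p (f a.1 a.2) :=
        (sum_fiberwise_of_maps_to (fun a ha => (hs a ha).1) _).symm
    _ ≤ ∑ η ∈ Y, m * 2 ^ N * weight p η := by
        refine sum_le_sum fun η hη => ?_
        rw [sum_congr rfl fun a ha => by rw [(mem_filter.1 ha).2], sum_const, nsmul_eq_mul]
        exact mul_le_mul_of_nonneg_right (hfib η hη) (weight_nonneg hp0 hp1 _)
    _ = m * 2 ^ N * ∑ η ∈ Y, weight p η := by rw [mul_sum]

/-- If each configuration of `E` can be modified in `t` ways, so as to lie in `Y`, and the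
modification can be undone up to boundedly many choices, then `E` is not much likelier than `Y`. -/
theorem mul_real_le_of_modification {ι : Type*} {I : Set α} (hI : I.Finite) {p : unitInterval}
    {ε : ℝ} (hε : 0 < ε) (h0 : ε ≤ (p : ℝ)) (h1 : (p : ℝ) ≤ 1 - ε) {E Y : Set (α → Bool)}
    (hE : ∀ ω, clip I ω ∈ E ↔ ω ∈ E) (hY : ∀ ω, clip I ω ∈ Y ↔ ω ∈ Y) {t m N : ℕ}
    (X : (α → Bool) → Set ι) (hXfin : ∀ ω ∈ Y, (X ω).Finite) (hX : ∀ ω ∈ Y, (X ω).ncard ≤ m)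
    (F : (α → Bool) → ι → Set α)
    (h : ∀ ω ∈ E, clip I ω = ω → ∃ u : Finset ι, t ≤ u.card ∧ ∀ x ∈ u, ∃ ω' ∈ Y, clip I ω' = ω' ∧
      x ∈ X ω' ∧ (F ω' x).Finite ∧ (F ω' x).ncard ≤ N ∧ ∀ e ∉ F ω' x, ω' e = ω e) :
    t * ε ^ N *
        (Measure.infinitePi fun _ : α => ProbabilityTheory.bernoulliMeasure true false p).real E ≤
      m * 2 ^ N *
        (Measure.infinitePi fun _ : α => ProbabilityTheory.bernoulliMeasure true false p).real Y := by
  classical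
  obtain ⟨I, rfl⟩ := hI.exists_finset_coe
  rw [real_eq_sum_weight I p hE, real_eq_sum_weight I p hY]
  set G : (I → Bool) → ι → Finset I := fun η x =>
    univ.filter fun i => (i : α) ∈ F (extendFalse I η) x
  set X' : (I → Bool) → Finset ι := fun η =>
    if h : extendFalse I η ∈ Y then (hXfin _ h).toFinset else ∅
  have hX' : ∀ η, extendFalse I η ∈ Y → ∀ x, x ∈ X' η ↔ x ∈ X (extendFalse I η) := fun η hη x => by
    simp [X', hη]
  -- The conditions are moved inside the existential, with dummy values elsewhere, so that `choose`
  -- yields functions defined everywhere.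
  have h' : ∀ η : I → Bool, ∃ u : Finset ι, extendFalse I η ∈ E → t ≤ u.card ∧ ∀ x ∈ u,
      ∃ η' : I → Bool, extendFalse I η' ∈ Y ∧ x ∈ X' η' ∧
        (G η' x).card ≤ N ∧ ∀ i ∉ G η' x, η i = η' i := by
    intro η
    by_cases hη : extendFalse I η ∈ E
    · obtain ⟨u, hu, hux⟩ := h _ hη (clip_extendFalse I η)
      refine ⟨u, fun _ => ⟨hu, fun x hx => ?_⟩⟩
      obtain ⟨ω', hω', hcl, hxX, hfin, hN, hag⟩ := hux x hx
      have hext : extendFalse I (I.restrict ω') = ω' := by rw [extendFalse_restrict, hcl]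
      have hY' : extendFalse I (I.restrict ω') ∈ Y := by rwa [hext]
      refine ⟨I.restrict ω', hY', (hX' _ hY' x).2 (by rwa [hext]), ?_, fun i hi => ?_⟩
      · refine le_trans ?_ hN
        rw [Set.ncard_eq_toFinset_card _ hfin]
        exact card_le_card_of_injOn (fun i => (i : α)) (fun i hi => by simpa [G, hext] using hi)
          Subtype.val_injective.injOn
      · have := hag i (by simpa [G, hext] using hi)
        simpa [extendFalse] using this.symm
    · exact ⟨∅, fun h => (hη h).elim⟩
  choose u hu using h'
  have h'' : ∀ (η : I → Bool) (x : ι), ∃ η' : I → Bool, extendFalse I η ∈ E → x ∈ u η →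
      extendFalse I η' ∈ Y ∧ x ∈ X' η' ∧ (G η' x).card ≤ N ∧ ∀ i ∉ G η' x, η i = η' i := by
    intro η x
    by_cases hη : extendFalse I η ∈ E ∧ x ∈ u η
    · obtain ⟨η', h⟩ := (hu _ hη.1).2 _ hη.2
      exact ⟨η', fun _ _ => h⟩
    · exact ⟨η, fun h1 h2 => (hη ⟨h1, h2⟩).elim⟩
  choose f hf using h''
  refine mul_sum_weight_le hε h0 h1 u f X' G (fun η hη => (hu η (mem_filter.1 hη).2).1)
    (fun η hη => ?_) fun η hη x hx => ?_
  · have hY' := (mem_filter.1 hη).2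
    refine le_trans (le_of_eq ?_) (hX _ hY')
    rw [Set.ncard_eq_toFinset_card _ (hXfin _ hY')]
    simp [X', hY']
  · have := hf η x (mem_filter.1 hη).2 hx
    exact ⟨mem_filter.2 ⟨mem_univ _, this.1⟩, this.2⟩

end Bernoulli

/-! ### Counting vertices and edges -/

theorem column_eq (x : Vertex k) (m : ℕ) : column x m =
    ((Finset.Icc (x.1 - m) (x.1 + m) ×ˢ (Finset.Icc (x.2.1 - m) (x.2.1 + m) ×ˢ
      (Finset.univ : Finset (Fin (k + 1)))) : Finset (Vertex k)) : Set (Vertex k)) := by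
  ext v
  rw [mem_column]
  simp [box]

theorem column_finite (x : Vertex k) (m : ℕ) : (column x m).Finite := by
  rw [column_eq]
  exact Finset.finite_toSet _

/-- The number of vertices of a column of radius `m`. -/
def columnCard (k m : ℕ) : ℕ := (2 * m + 1) * ((2 * m + 1) * (k + 1))

theorem ncard_column (x : Vertex k) (m : ℕ) : (column x m).ncard = columnCard k m := by
  rw [column_eq, Set.ncard_coe_finset, Finset.card_product, Finset.card_product, Int.card_Icc,
    Int.card_Icc, Finset.card_univ, Fintype.card_fin, columnCard]
  congr 1
  · omega
  · congr 1
    omega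

theorem IsBox.finite {n : ℕ} {S : Set (Vertex k)} (h : IsBox k n S) : S.Finite := by
  obtain ⟨a, b, c, d, -, -, rfl⟩ := h
  refine (Finset.finite_toSet (Finset.Icc a b ×ˢ (Finset.Icc c d ×ˢ
    (Finset.univ : Finset (Fin (k + 1)))))).subset fun v hv => ?_
  simpa [box] using hv

/-- The edges with both endpoints in `R`. -/
def regionEdges (R : Set (Vertex k)) : Set (slab k).edgeSet := {e | ∀ v ∈ e.1, v ∈ R}

/-- The edges with an endpoint in `D`. -/
def incident (D : Set (Vertex k)) : Set (slab k).edgeSet := {e | ∃ v ∈ D, v ∈ e.1}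

theorem regionEdges_finite_and_ncard_le {D : Set (Vertex k)} (hD : D.Finite) :
    (regionEdges D).Finite ∧ (regionEdges D).ncard ≤ D.ncard * D.ncard := by
  have hmaps : ∀ e ∈ regionEdges D,
      (e : Sym2 (Vertex k)) ∈ (fun q : Vertex k × Vertex k => s(q.1, q.2)) '' (D ×ˢ D) := by
    rintro ⟨e, he⟩ h
    induction e with
    | h x y => exact ⟨(x, y), ⟨h x (by simp), h y (by simp)⟩, rfl⟩
  have hfin := (hD.prod hD).image fun q : Vertex k × Vertex k => s(q.1, q.2)
  refine ⟨Set.Finite.of_injOn hmaps Subtype.val_injective.injOn hfin, ?_⟩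
  calc (regionEdges D).ncard ≤ _ :=
        Set.ncard_le_ncard_of_injOn _ hmaps Subtype.val_injective.injOn hfin
    _ ≤ (D ×ˢ D).ncard := Set.ncard_image_le (hD.prod hD)
    _ = D.ncard * D.ncard := Set.ncard_prod

/-- A bound for the number of edges at a column of radius `m`. -/
def incidentBound (k m : ℕ) : ℕ := columnCard k (m + 1) * columnCard k (m + 1)

theorem incident_column_subset (x : Vertex k) (m : ℕ) :
    incident (column x m) ⊆ regionEdges (column x (m + 1)) := by
  rintro ⟨e, he⟩ ⟨v, hv, hve⟩ w hw
  induction e with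
  | h a b =>
    have hab : (slab k).Adj a b := he
    have h1 : distStar v w ≤ 1 := by
      rcases Sym2.mem_iff.1 hve with rfl | rfl <;> rcases Sym2.mem_iff.1 hw with rfl | rfl
      · simp [distStar_self]
      · exact distStar_le_one_of_adj hab
      · exact distStar_le_one_of_adj hab.symm
      · simp [distStar_self]
    have h2 := distStar_triangle x v w
    have h3 : distStar x v ≤ m := hv
    change distStar x w ≤ ((m + 1 : ℕ) : ℤ)
    push_cast
    omega

theorem incident_column_finite (x : Vertex k) (m : ℕ) : (incident (column x m)).Finite :=
  (regionEdges_finite_and_ncard_le (column_finite x (m + 1))).1.subset (incident_column_subset x m)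

theorem ncard_incident_column_le (x : Vertex k) (m : ℕ) :
    (incident (column x m)).ncard ≤ incidentBound k m := by
  have h := regionEdges_finite_and_ncard_le (column_finite x (m + 1))
  rw [ncard_column] at h
  exact (Set.ncard_le_ncard (incident_column_subset x m) h.1).trans h.2

/-! ### Events that depend on the edges in `R` only -/

section Clip

variable {R U S A B C : Set (Vertex k)} (ω : Config k)

theorem openGraph_clip (hU : U ⊆ R) : openGraph (clip (regionEdges R) ω) U = openGraph ω U := by
  ext x y
  refine and_congr_right fun hx => and_congr_right fun hy => exists_congr fun h => ?_
  rw [clip_of_mem]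
  intro v hv
  rcases Sym2.mem_iff.1 hv with rfl | rfl
  exacts [hU hx, hU hy]

theorem cluster_clip (hU : U ⊆ R) : cluster (clip (regionEdges R) ω) U A = cluster ω U A := by
  simp only [cluster, openGraph_clip ω hU]

theorem connected_clip (hU : U ⊆ R) :
    Connected (clip (regionEdges R) ω) U A B ↔ Connected ω U A B := by
  simp only [Connected, openGraph_clip ω hU]

theorem minimalPath_clip (hS : S ⊆ R) :
    minimalPath (clip (regionEdges R) ω) S A B = minimalPath ω S A B := by
  simp only [minimalPath, IsMinimalOpenPath, IsOpenPath]
  rw [openGraph_clip ω hS]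

theorem minimalPath_subset : minimalPath ω S A B ⊆ S := by
  rintro v ⟨γ, hγ, hv⟩
  exact hγ.isOpenChain.subset v hv

theorem attachSet_clip (hS : S ⊆ R) :
    attachSet (clip (regionEdges R) ω) S R A B C = attachSet ω S R A B C := by
  ext y
  simp only [attachSet, minimalPath_clip ω hS]
  refine and_congr_right fun hy => ?_
  rw [cluster_clip]
  rintro v (hv | rfl)
  exacts [hv.1, hS (minimalPath_subset ω hy)]

end Clip

/-! ### Closing edges around a cluster -/

/-- The edges that join `H` to `V`. -/
def between (H V : Set (Vertex k)) : Set (slab k).edgeSet := {e | ∃ x ∈ H, ∃ y ∈ V, e.1 = s(x, y)}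

/-- The configuration in which the edges between `H` and `V` have been closed. -/
noncomputable def closeBetween (ω : Config k) (H V : Set (Vertex k)) : Config k :=
  open Classical in fun e => if e ∈ between H V then false else ω e

section Close

variable {ω : Config k} {H V R S X A B C : Set (Vertex k)}

theorem closeBetween_of_notMem {e : (slab k).edgeSet} (he : e ∉ between H V) :
    closeBetween ω H V e = ω e := if_neg he

theorem closeBetween_of_mem {e : (slab k).edgeSet} (he : e ∈ between H V) :
    closeBetween ω H V e = false := if_pos he

theorem openEdge_of_closeBetween {x y : Vertex k} (h : OpenEdge (closeBetween ω H V) x y) :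
    OpenEdge ω x y := by
  obtain ⟨hadj, h⟩ := h
  refine ⟨hadj, ?_⟩
  by_cases he : (⟨s(x, y), hadj⟩ : (slab k).edgeSet) ∈ between H V
  · rw [closeBetween_of_mem he] at h
    cases h
  · rwa [closeBetween_of_notMem he] at h

theorem OpenEdge.closeBetween {x y : Vertex k} (h : OpenEdge ω x y) (h1 : x ∉ V ∨ y ∉ H)
    (h2 : y ∉ V ∨ x ∉ H) : OpenEdge (closeBetween ω H V) x y := by
  obtain ⟨hadj, h⟩ := h
  refine ⟨hadj, ?_⟩
  rwa [closeBetween_of_notMem]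
  rintro ⟨a, ha, b, hb, hab⟩
  rcases Sym2.eq_iff.1 hab with ⟨rfl, rfl⟩ | ⟨rfl, rfl⟩
  · exact h2.elim (fun h => h hb) fun h => h ha
  · exact h1.elim (fun h => h hb) fun h => h ha

theorem cluster_closeBetween_subset : cluster (closeBetween ω H V) R X ⊆ cluster ω R X :=
  cluster_mono subset_rfl fun _ _ h => ⟨h.1, h.2.1, openEdge_of_closeBetween h.2.2⟩

theorem cluster_diff_subset : cluster ω (R \ V) X ⊆ cluster ω R X :=
  cluster_mono Set.sdiff_subset fun _ _ h => ⟨h.1.1, h.2.1.1, h.2.2⟩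

/-- No edge inside `R \ V` is closed. The closed edges can therefore be recomputed from the new
configuration once `V` is known, which makes the closing reversible up to boundedly many choices. -/
theorem cluster_diff_closeBetween :
    cluster (closeBetween ω (cluster ω (R \ V) X) V) (R \ V) X = cluster ω (R \ V) X :=
  cluster_closeBetween_subset.antisymm <| cluster_mono subset_rfl fun _ _ h =>
    ⟨h.1, h.2.1, OpenEdge.closeBetween h.2.2 (.inl h.1.2) (.inl h.2.1.2)⟩

/-- Every open edge of `R` that leaves the cluster in `R \ V` leads into `V`, and these edges are
now closed. -/
theorem cluster_closeBetween (hX : ∀ x ∈ X, x ∉ V) :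
    cluster (closeBetween ω (cluster ω (R \ V) X) V) R X = cluster ω (R \ V) X := by
  refine (cluster_subset_of_closed (I := cluster ω (R \ V) X)
    (fun x hx => subset_cluster hx.1 ⟨hx.2, hX x hx.1⟩) fun x hx y hxy => ?_).antisymm ?_
  · refine cluster_step hx ⟨cluster_subset hx, ⟨hxy.2.1, fun hyV => ?_⟩,
      openEdge_of_closeBetween hxy.2.2⟩
    obtain ⟨hadj, h⟩ := hxy.2.2
    rw [closeBetween_of_mem (show (⟨s(x, y), hadj⟩ : (slab k).edgeSet) ∈
      between (cluster ω (R \ V) X) V from ⟨x, hx, y, hyV, rfl⟩)] at h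
    cases h
  · conv_lhs => rw [← cluster_diff_closeBetween]
    exact cluster_diff_subset

theorem isOpenPath_of_closeBetween {γ : List (Vertex k)}
    (h : IsOpenPath (closeBetween ω H V) S A B γ) : IsOpenPath ω S A B γ := by
  rw [isOpenPath_iff] at h ⊢
  exact ⟨⟨h.1.ne_nil, h.1.head, h.1.last, h.1.subset,
    h.1.chain.imp fun _ _ => openEdge_of_closeBetween⟩, h.2⟩

/-- The minimal path is not affected by closing edges at a set that it does not visit. -/
theorem minimalPath_closeBetween (hS : S.Finite) (hH : ∀ v ∈ minimalPath ω S A B, v ∉ H) :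
    minimalPath (closeBetween ω H V) S A B = minimalPath ω S A B := by
  have hmin : ∀ γ, IsMinimalOpenPath ω S A B γ → IsMinimalOpenPath (closeBetween ω H V) S A B γ := by
    intro γ hγ
    have hγH : ∀ v ∈ γ, v ∉ H := fun v hv => hH v ⟨γ, hγ, hv⟩
    have hγ' := hγ.isOpenChain
    exact ⟨isOpenPath_iff.2 ⟨⟨hγ'.ne_nil, hγ'.head, hγ'.last, hγ'.subset,
      hγ'.chain.imp_of_mem_imp fun x y hx hy hxy =>
        hxy.closeBetween (.inr (hγH y hy)) (.inr (hγH x hx))⟩, hγ.nodup⟩,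
      fun γ' h' => hγ.2 γ' (isOpenPath_of_closeBetween h')⟩
  ext v
  constructor
  · rintro ⟨γ, hγ, hv⟩
    obtain ⟨γ', hγ'⟩ := exists_isMinimalOpenPath hS ⟨γ, isOpenPath_of_closeBetween hγ.1⟩
    rw [hγ.eq (hmin γ' hγ')] at hv
    exact ⟨γ', hγ', hv⟩
  · rintro ⟨γ, hγ, hv⟩
    exact ⟨γ, hmin γ hγ, hv⟩

theorem clip_closeBetween {I : Set (slab k).edgeSet} (h : clip I ω = ω) :
    clip I (closeBetween ω H V) = closeBetween ω H V := by
  ext e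
  by_cases he : e ∈ I
  · rw [clip_of_mem he]
  · rw [clip_of_notMem he]
    by_cases he' : e ∈ between H V
    · rw [closeBetween_of_mem he']
    · rw [closeBetween_of_notMem he', ← h, clip_of_notMem he]

end Close

/-! ### Contacts and traces -/

/-- The vertices near which either the cluster of `A` approaches `C` or the cluster of `C`
approaches the minimal path from `A` to `B`. -/
def contacts (ω : Config k) (S R A B C : Set (Vertex k)) (m : ℕ) : Set (Vertex k) :=
  {x | (x ∈ C ∧ x ∈ R ∧ ∃ w ∈ cluster ω R A, w ∈ column x m) ∨
    (x ∈ cluster ω R C ∧ ∃ y ∈ minimalPath ω S A B, y ∈ column x m)}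

/-- The possible locations of a modification that has joined `A` to `C`. -/
def traces (ω : Config k) (S R A B C : Set (Vertex k)) (m : ℕ) : Set (Vertex k) :=
  ({x | (A ∩ cluster ω R C).Nonempty ∧ A ∩ cluster ω R C ⊆ column x m} ∪
    {x | (C ∩ cluster ω R A).Nonempty ∧ C ∩ cluster ω R A ⊆ column x m}) ∪
    {x | (attachSet ω S R A B C).Nonempty ∧ attachSet ω S R A B C ⊆ column x m}

/-- Any single vertex of `Z` locates `x` to within distance `m`. Nonemptiness of `Z` is what makes
the set bounded. -/
theorem setOf_subset_column_finite_and_ncard_le (Z : Set (Vertex k)) (m : ℕ) :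
    {x | Z.Nonempty ∧ Z ⊆ column x m}.Finite ∧
      {x | Z.Nonempty ∧ Z ⊆ column x m}.ncard ≤ columnCard k m := by
  rcases Z.eq_empty_or_nonempty with rfl | ⟨z, hz⟩
  · simp
  · have hsub : {x | Z.Nonempty ∧ Z ⊆ column x m} ⊆ column z m := fun x hx => by
      have : distStar x z ≤ m := hx.2 hz
      rwa [distStar_comm] at this
    exact ⟨(column_finite z m).subset hsub,
      (Set.ncard_le_ncard hsub (column_finite z m)).trans (ncard_column z m).le⟩

theorem traces_finite (ω : Config k) (S R A B C : Set (Vertex k)) (m : ℕ) :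
    (traces ω S R A B C m).Finite :=
  ((setOf_subset_column_finite_and_ncard_le _ m).1.union
    (setOf_subset_column_finite_and_ncard_le _ m).1).union
    (setOf_subset_column_finite_and_ncard_le _ m).1

theorem ncard_traces_le (ω : Config k) (S R A B C : Set (Vertex k)) (m : ℕ) :
    (traces ω S R A B C m).ncard ≤ 3 * columnCard k m := by
  have h1 := (setOf_subset_column_finite_and_ncard_le (A ∩ cluster ω R C) m).2
  have h2 := (setOf_subset_column_finite_and_ncard_le (C ∩ cluster ω R A) m).2
  have h3 := (setOf_subset_column_finite_and_ncard_le (attachSet ω S R A B C) m).2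
  refine (Set.ncard_union_le _ _).trans ?_
  have := Set.ncard_union_le {x | (A ∩ cluster ω R C).Nonempty ∧ A ∩ cluster ω R C ⊆ column x m}
    {x | (C ∩ cluster ω R A).Nonempty ∧ C ∩ cluster ω R A ⊆ column x m}
  omega

/-- Near each contact, the configuration can be modified so as to join `A` to `C` in a way that
leaves a trace of the location. -/
theorem exists_modification (hk : 1 ≤ k) {n n' m : ℕ} (hn : 2 ≤ n) {ω : Config k}
    {S R A B C : Set (Vertex k)} (hS : IsBox k n S) (hR : IsBox k n' R) (hSR : S ⊆ R)
    (hAR : A ⊆ R) (hnc : ¬Connected ω R C A) {x : Vertex k} (hx : x ∈ contacts ω S R A B C m) :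
    ∃ ω', AgreeOff (column x (m + 2)) ω ω' ∧ Connected ω' R C A ∧
      x ∈ traces ω' S R A B C (m + 2) := by
  have hmono : column x m ⊆ column x (m + 2) := column_mono (by omega)
  rcases hx with ⟨hxC, hxR, w, hw, hxw⟩ | ⟨hxC, y, hy, hxy⟩
  -- Radius `m` would suffice here; `m + 2` is taken to match the detour case.
  · obtain ⟨ω', h1, h2, h3, h4⟩ := exists_bridge (m := m + 2) hR hnc hxC hxR hw
      (by simp [column, distStar_self]; positivity) (hmono hxw)
    exact ⟨ω', h1, h2, .inl (.inr ⟨h3, h4⟩)⟩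
  -- A detour must not touch `A`. If `A` is near, it is bridged directly to the cluster of `C`
  -- instead.
  · by_cases hA : ∃ u ∈ column x (m + 2), u ∈ A
    · obtain ⟨u, hu, huA⟩ := hA
      obtain ⟨ω', h1, h2, h3, h4⟩ := exists_bridge (m := m + 2) hR (mt Connected.symm hnc) huA
        (hAR huA) hxC hu (by simp [column, distStar_self]; positivity)
      exact ⟨ω', h1, h2.symm, .inl (.inl ⟨h3, h4⟩)⟩
    · push Not at hA
      obtain ⟨ω', h1, h2, h3, h4⟩ := exists_detour hk hn hS hR hSR hS.finite hnc hxC hy hxy hA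
      exact ⟨ω', h1, h2, .inr ⟨h3, h4⟩⟩

theorem contacts_subset {ω : Config k} {S R A B C : Set (Vertex k)} {m : ℕ} :
    contacts ω S R A B C m ⊆ R := by
  rintro x (hx | hx)
  exacts [hx.2.1, cluster_subset hx.1]

theorem contacts_clip {S R A B C : Set (Vertex k)} {m : ℕ} (hSR : S ⊆ R) (ω : Config k) :
    contacts (clip (regionEdges R) ω) S R A B C m = contacts ω S R A B C m := by
  simp only [contacts, cluster_clip ω subset_rfl, minimalPath_clip ω hSR]

theorem connected_neighborhood_clip {S R A B C : Set (Vertex k)} {r : ℕ} (hSR : S ⊆ R)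
    (ω : Config k) : Connected (clip (regionEdges R) ω) R C
        (neighborhood S (minimalPath (clip (regionEdges R) ω) S A B) r) ↔
      Connected ω R C (neighborhood S (minimalPath ω S A B) r) := by
  rw [minimalPath_clip ω hSR, connected_clip ω subset_rfl]

/-! ### Probability estimates for many and for few contacts -/

section Measure

variable {p : unitInterval} {ε : ℝ} {S R A B C : Set (Vertex k)} {n n' m r t : ℕ}

/-- Many contacts without a connection are unlikely in comparison with a connection. -/
theorem mul_real_contacts_le (hk : 1 ≤ k) (hn : 2 ≤ n) (hε : 0 < ε) (h0 : ε ≤ (p : ℝ))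
    (h1 : (p : ℝ) ≤ 1 - ε) (hS : IsBox k n S) (hR : IsBox k n' R) (hSR : S ⊆ R) (hAR : A ⊆ R)
    (t m : ℕ) :
    t * ε ^ incidentBound k (m + 2) * (percolation k p).real
        {ω | ¬Connected ω R C A ∧ t ≤ (contacts ω S R A B C m).ncard} ≤
      (3 * columnCard k (m + 2) : ℕ) * 2 ^ incidentBound k (m + 2) *
        (percolation k p).real {ω | Connected ω R C A} := by
  refine mul_real_le_of_modification (I := regionEdges R)
    (regionEdges_finite_and_ncard_le hR.finite).1 hε h0 h1 (fun ω => ?_)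
    (fun ω => connected_clip ω subset_rfl) (fun ω => traces ω S R A B C (m + 2))
    (fun ω _ => traces_finite ..) (fun ω _ => ncard_traces_le ..)
    (fun _ x => incident (column x (m + 2))) ?_
  · simp only [Set.mem_ofPred_eq, connected_clip ω subset_rfl, contacts_clip hSR]
  · rintro ω ⟨hnc, ht⟩ hω
    have hfin := hR.finite.subset (contacts_subset (ω := ω) (S := S) (A := A) (B := B) (C := C)
      (m := m))
    refine ⟨hfin.toFinset, by rwa [← Set.ncard_eq_toFinset_card _ hfin], fun x hx => ?_⟩
    obtain ⟨ω', h2, h3, h4⟩ := exists_modification hk hn hS hR hSR hAR hnc (hfin.mem_toFinset.1 hx)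
    refine ⟨clip (regionEdges R) ω', (connected_clip ω' subset_rfl).2 h3, clip_clip _ _, ?_,
      incident_column_finite _ _, ncard_incident_column_le _ _, fun e he => ?_⟩
    · simpa only [traces, cluster_clip ω' subset_rfl, attachSet_clip ω' hSR] using h4
    · by_cases heI : e ∈ regionEdges R
      · rw [clip_of_mem heI]
        exact h2 e fun v hv hve => he ⟨v, hv, hve⟩
      · rw [clip_of_notMem heI, ← hω, clip_of_notMem heI]

theorem between_finite_and_ncard_le {H V U : Set (Vertex k)} (hU : U.Finite) (ht : U.ncard ≤ t)
    (h : ∀ x ∈ H, ∀ y ∈ V, (slab k).Adj x y → ∃ u ∈ U, x ∈ column u m) :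
    (between H V).Finite ∧ (between H V).ncard ≤ t * incidentBound k m := by
  have hsub : between H V ⊆ ⋃ u ∈ hU.toFinset, incident (column u m) := by
    rintro ⟨e, he⟩ ⟨x, hx, y, hy, rfl⟩
    obtain ⟨u, hu, hxu⟩ := h x hx y hy he
    exact Set.mem_biUnion (hU.mem_toFinset.2 hu) ⟨x, hxu, by simp⟩
  have hfin : (⋃ u ∈ hU.toFinset, incident (column u m)).Finite :=
    Set.Finite.biUnion (Finset.finite_toSet _) fun u _ => incident_column_finite u m
  refine ⟨hfin.subset hsub, (Set.ncard_le_ncard hsub hfin).trans ?_⟩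
  refine (Finset.set_ncard_biUnion_le _ _).trans ?_
  refine (Finset.sum_le_card_nsmul _ _ _ fun u _ => ncard_incident_column_le u m).trans ?_
  rw [smul_eq_mul, ← Set.ncard_eq_toFinset_card _ hU]
  exact Nat.mul_le_mul_right _ ht

/-- A single modification without a location to remember: the trace takes values in `Unit` and `t =
m = 1`. The set of changed edges is recovered from the image because neither `V` nor the cluster in
`R \ V` changes. -/
theorem mul_real_le_of_closing {X : Set (Vertex k)} (hR : R.Finite) (hε : 0 < ε)
    (h0 : ε ≤ (p : ℝ)) (h1 : (p : ℝ) ≤ 1 - ε) {E Y : Set (Config k)}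
    (hE : ∀ ω, clip (regionEdges R) ω ∈ E ↔ ω ∈ E) (hY : ∀ ω, clip (regionEdges R) ω ∈ Y ↔ ω ∈ Y)
    {N : ℕ} (V : Config k → Set (Vertex k))
    (hV : ∀ ω ∈ E, V (closeBetween ω (cluster ω (R \ V ω) X) (V ω)) = V ω)
    (hEY : ∀ ω ∈ E, closeBetween ω (cluster ω (R \ V ω) X) (V ω) ∈ Y)
    (hN : ∀ ω ∈ E, (between (cluster ω (R \ V ω) X) (V ω)).Finite ∧
      (between (cluster ω (R \ V ω) X) (V ω)).ncard ≤ N) :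
    ε ^ N * (percolation k p).real E ≤ 2 ^ N * (percolation k p).real Y := by
  have := mul_real_le_of_modification (I := regionEdges R) (t := 1) (m := 1) (N := N)
    (regionEdges_finite_and_ncard_le hR).1 hε h0 h1 hE hY (fun _ => (Set.univ : Set Unit))
    (fun _ _ => Set.finite_univ) (fun _ _ => by simp)
    (fun ω _ => between (cluster ω (R \ V ω) X) (V ω)) fun ω hω hcl =>
      ⟨{()}, by simp, fun x _ => ⟨_, hEY ω hω, clip_closeBetween hcl, trivial, ?_, ?_, ?_⟩⟩
  · simpa [percolation] using this
  all_goals rw [hV ω hω, cluster_diff_closeBetween]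
  · exact (hN ω hω).1
  · exact (hN ω hω).2
  · exact fun e he => closeBetween_of_notMem he

/-- If there are few contacts, the cluster of `A` can be separated from the vicinity of `C`. -/
theorem mul_real_separate_le (hε : 0 < ε) (h0 : ε ≤ (p : ℝ)) (h1 : (p : ℝ) ≤ 1 - ε)
    (hR : R.Finite) (hSR : S ⊆ R) (hCR : C ⊆ R) (hAC : FarApart (r + 2) A C) (t : ℕ) :
    ε ^ (t * incidentBound k (r + 1)) * (percolation k p).real
        {ω | ¬Connected ω R C A ∧ (contacts ω S R A B C (r + 1)).ncard < t} ≤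
      2 ^ (t * incidentBound k (r + 1)) * (percolation k p).real
        {ω | ¬Connected ω R C A ∧ ∀ v ∈ cluster ω R A, ∀ c ∈ C, v ∉ column c r} := by
  have hAV : ∀ a ∈ A, a ∉ {v | ∃ c ∈ C, v ∈ column c r} := by
    rintro a ha ⟨c, hc, h⟩
    have h2 := hAC a ha c hc
    have h3 : distStar c a ≤ r := h
    rw [distStar_comm] at h3
    push_cast at h2
    omega
  refine mul_real_le_of_closing (R := R) (X := A) hR hε h0 h1 (fun ω => ?_) (fun ω => ?_)
    (fun _ => {v | ∃ c ∈ C, v ∈ column c r}) (fun _ _ => rfl) ?_ ?_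
  · simp only [Set.mem_ofPred_eq, connected_clip ω subset_rfl, contacts_clip hSR]
  · simp only [Set.mem_ofPred_eq, connected_clip ω subset_rfl, cluster_clip ω subset_rfl]
  · rintro ω ⟨hnc, -⟩
    have hcl := cluster_closeBetween (ω := ω) (R := R) hAV
    refine ⟨fun hc => ?_, fun v hv c hc hvc => ?_⟩
    · obtain ⟨c, ⟨hc, -⟩, h⟩ := connected_iff.1 hc.symm
      rw [hcl] at h
      exact (cluster_subset h).2 ⟨c, hc, by simp [column, distStar_self]⟩
    · rw [hcl] at hv
      exact (cluster_subset hv).2 ⟨c, hc, hvc⟩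
  -- Each closed edge lies near some `c ∈ C`, and this `c` is a contact. So fewer than `t` columns
  -- contain an endpoint of every closed edge.
  · rintro ω ⟨hnc, ht⟩
    refine between_finite_and_ncard_le (hR.subset contacts_subset) ht.le ?_
    rintro x hx y ⟨c, hc, hyc⟩ hxy
    have hxc : x ∈ column c (r + 1) := by
      have h2 := distStar_triangle c y x
      have h3 := distStar_le_one_of_adj hxy.symm
      have h4 : distStar c y ≤ r := hyc
      change distStar c x ≤ ((r + 1 : ℕ) : ℤ)
      push_cast
      omega
    exact ⟨c, .inl ⟨hc, hCR hc, x, cluster_diff_subset hx, hxc⟩, hxc⟩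

/-- If there are few contacts, the cluster of `C` can be separated from the vicinity of the minimal
path. -/
theorem mul_real_separate_path_le (hε : 0 < ε) (h0 : ε ≤ (p : ℝ)) (h1 : (p : ℝ) ≤ 1 - ε)
    (hR : R.Finite) (hSR : S ⊆ R) (t : ℕ) :
    ε ^ (t * incidentBound k (r + 1)) * (percolation k p).real
        {ω | (¬Connected ω R C A ∧ ∀ v ∈ cluster ω R A, ∀ c ∈ C, v ∉ column c r) ∧
          (contacts ω S R A B C (r + 1)).ncard < t} ≤
      2 ^ (t * incidentBound k (r + 1)) * (percolation k p).real
        {ω | ¬Connected ω R C (neighborhood S (minimalPath ω S A B) r)} := by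
  have hΓ : ∀ ω : Config k, ∀ v ∈ minimalPath ω S A B, v ∈ cluster ω R A := by
    rintro ω v ⟨γ, hγ, hv⟩
    exact hγ.isOpenChain.subset_cluster hSR v hv
  -- The edges closed are at the cluster of `C`, which the minimal path avoids as long as `C` is not
  -- joined to `A`.
  have hmin : ∀ ω : Config k, ¬Connected ω R C A → ∀ V : Set (Vertex k),
      minimalPath (closeBetween ω (cluster ω (R \ V) C) V) S A B = minimalPath ω S A B :=
    fun ω hnc V => minimalPath_closeBetween (hR.subset hSR) fun v hv hvH =>
      notMem_cluster_of_not_connected hnc (hΓ ω v hv) (cluster_diff_subset hvH)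
  refine mul_real_le_of_closing (R := R) (X := C) hR hε h0 h1 (fun ω => ?_) (fun ω => ?_)
    (fun ω => neighborhood S (minimalPath ω S A B) r) ?_ ?_ ?_
  · simp only [Set.mem_ofPred_eq, connected_clip ω subset_rfl, contacts_clip hSR,
      cluster_clip ω subset_rfl]
  · exact not_congr (connected_neighborhood_clip hSR ω)
  · rintro ω ⟨⟨hnc, -⟩, -⟩
    simp only [hmin ω hnc]
  · rintro ω ⟨⟨hnc, hsep⟩, -⟩
    -- This is what the previous separation was for: if `C` itself met the neighbourhood of the
    -- path, no closing could disconnect them.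
    have hCV : ∀ c ∈ C, c ∉ neighborhood S (minimalPath ω S A B) r := by
      rintro c hc ⟨-, y, hy, hcy⟩
      exact hsep y (hΓ ω y hy) c hc hcy
    intro hc
    simp only [hmin ω hnc] at hc
    obtain ⟨v, ⟨hv, -⟩, h⟩ := connected_iff.1 hc
    rw [cluster_closeBetween hCV] at h
    exact (cluster_subset h).2 hv
  -- Here the endpoint in the cluster of `C` is itself a contact.
  · rintro ω ⟨⟨hnc, -⟩, ht⟩
    refine between_finite_and_ncard_le (hR.subset contacts_subset) ht.le ?_
    rintro x hx v ⟨-, y, hy, hvy⟩ hxv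
    have hxy : y ∈ column x (r + 1) := by
      have h2 := distStar_triangle x v y
      have h3 := distStar_le_one_of_adj hxv
      change distStar x y ≤ ((r + 1 : ℕ) : ℤ)
      push_cast
      omega
    exact ⟨x, .inr ⟨cluster_diff_subset hx, y, hy, hxy⟩, by simp [column, distStar_self]; positivity⟩

end Measure

/-! ### Construction of the gluing function -/

section Gluing

open Filter Topology Set

variable {c : ℝ} {K : ℕ → ℝ}

/-- The supremum of the functions `c * x` and `1 - 1 / (n + 1) - K n * (1 - x)`. -/
noncomputable def gluing (c : ℝ) (K : ℕ → ℝ) (x : ℝ) : ℝ :=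
  ⨆ n : ℕ, max (c * x) (1 - 1 / ((n : ℝ) + 1) - K n * (1 - x))

theorem gluing_le {x q : ℝ} (h1 : c * x ≤ q)
    (h2 : ∀ n : ℕ, 1 - q ≤ 1 / ((n : ℝ) + 1) + K n * (1 - x)) : gluing c K x ≤ q :=
  ciSup_le fun n => max_le h1 (by linarith [h2 n])

theorem gluing_bddAbove (hc0 : 0 ≤ c) (hc1 : c ≤ 1) (hK : ∀ n, 1 ≤ K n) {x : ℝ} (hx : x ≤ 1) :
    BddAbove (range fun n : ℕ => max (c * x) (1 - 1 / ((n : ℝ) + 1) - K n * (1 - x))) := by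
  refine ⟨1, ?_⟩
  rintro _ ⟨n, rfl⟩
  have h1 : (0 : ℝ) ≤ 1 / ((n : ℝ) + 1) := by positivity
  refine max_le (by nlinarith) ?_
  nlinarith [mul_nonneg (zero_le_one.trans (hK n)) (sub_nonneg.2 hx)]

theorem le_gluing (hc0 : 0 ≤ c) (hc1 : c ≤ 1) (hK : ∀ n, 1 ≤ K n) {x : ℝ} (hx : x ≤ 1) (n : ℕ) :
    max (c * x) (1 - 1 / ((n : ℝ) + 1) - K n * (1 - x)) ≤ gluing c K x :=
  le_ciSup (gluing_bddAbove hc0 hc1 hK hx) n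

/-- Each affine piece is at most `0` at the origin, thanks to `K n ≥ 1`, so its ratio to `x` is
nondecreasing, and so is that of the supremum. This yields both strict monotonicity and the bound by
`x`. -/
theorem mul_gluing_le (hc0 : 0 ≤ c) (hc1 : c ≤ 1) (hK : ∀ n, 1 ≤ K n) {x y : ℝ} (hx : 0 ≤ x)
    (hxy : x ≤ y) (hy : y ≤ 1) : y * gluing c K x ≤ x * gluing c K y := by
  rcases hx.eq_or_lt with rfl | hx
  · rw [zero_mul]
    refine mul_nonpos_of_nonneg_of_nonpos hxy (gluing_le (by simp) fun n => ?_)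
    have h1 : (0 : ℝ) ≤ 1 / ((n : ℝ) + 1) := by positivity
    linarith [hK n]
  · have hy0 := hx.trans_le hxy
    rw [mul_comm, ← le_div_iff₀ hy0]
    refine ciSup_le fun n => ?_
    rw [le_div_iff₀ hy0]
    have h1 := le_gluing hc0 hc1 hK hy n
    have h2 := (le_max_left _ _).trans h1
    have h3 := (le_max_right _ _).trans h1
    have h4 : (0 : ℝ) ≤ 1 / ((n : ℝ) + 1) := by positivity
    rw [max_mul_of_nonneg _ _ hy0.le]
    refine max_le (by nlinarith) ?_
    have h5 : 0 ≤ (y - x) * (K n - 1 + 1 / ((n : ℝ) + 1)) :=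
      mul_nonneg (sub_nonneg.2 hxy) (by linarith [hK n])
    nlinarith [mul_le_mul_of_nonneg_left h3 hx.le]

/-- A supremum of affine functions; convexity supplies continuity in the open interval. -/
theorem convexOn_gluing (hc0 : 0 ≤ c) (hc1 : c ≤ 1) (hK : ∀ n, 1 ≤ K n) :
    ConvexOn ℝ (Ioo 0 1) (gluing c K) := by
  refine ⟨convex_Ioo 0 1, fun x hx y hy a b ha hb hab => ?_⟩
  refine ciSup_le fun n => ?_
  have h1 := le_gluing hc0 hc1 hK hx.2.le n
  have h2 := le_gluing hc0 hc1 hK hy.2.le n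
  have e1 := mul_le_mul_of_nonneg_left ((le_max_left _ _).trans h1) ha
  have e2 := mul_le_mul_of_nonneg_left ((le_max_right _ _).trans h1) ha
  have e3 := mul_le_mul_of_nonneg_left ((le_max_left _ _).trans h2) hb
  have e4 := mul_le_mul_of_nonneg_left ((le_max_right _ _).trans h2) hb
  obtain rfl : b = 1 - a := by linarith
  simp only [smul_eq_mul]
  exact max_le (by nlinarith) (by nlinarith)

/-- Continuity at `0` follows by squeezing between `0` and `x`, at `1` from the pieces with large
`n`, and in between from convexity. The positive slope `c` turns monotonicity of the ratio into
strict monotonicity. -/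
theorem isGluingFunction_gluing (hc0 : 0 < c) (hc1 : c ≤ 1) (hK : ∀ n, 1 ≤ K n) :
    IsGluingFunction (gluing c K) := by
  have hlow : ∀ x ≤ 1, c * x ≤ gluing c K x := fun x hx =>
    (le_max_left _ _).trans (le_gluing hc0.le hc1 hK hx 0)
  have h0 : gluing c K 0 = 0 := by
    refine le_antisymm ?_ (by simpa using hlow 0 zero_le_one)
    simpa using mul_gluing_le hc0.le hc1 hK le_rfl zero_le_one le_rfl
  have h1le : gluing c K 1 ≤ 1 := gluing_le (by simpa) fun n => by
    have : (0 : ℝ) ≤ 1 / ((n : ℝ) + 1) := by positivity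
    linarith
  have h1 : gluing c K 1 = 1 := by
    refine h1le.antisymm (le_of_forall_pos_le_add fun η hη => ?_)
    obtain ⟨n, hn⟩ := exists_nat_one_div_lt hη
    have := (le_max_right _ _).trans (le_gluing hc0.le hc1 hK le_rfl n)
    linarith
  have hup : ∀ x ∈ Icc (0 : ℝ) 1, gluing c K x ≤ x := fun x hx => by
    simpa [h1] using mul_gluing_le hc0.le hc1 hK hx.1 hx.2 le_rfl
  refine ⟨fun x hx => ?_, fun x hx y hy hxy => ?_, h0, h1⟩
  · rcases hx.1.eq_or_lt with rfl | hx0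
    · rw [ContinuousWithinAt, h0]
      refine tendsto_of_tendsto_of_tendsto_of_le_of_le' tendsto_const_nhds
        (tendsto_id.mono_left nhdsWithin_le_nhds) ?_ ?_
      · filter_upwards [self_mem_nhdsWithin] with y hy
        exact (mul_nonneg hc0.le hy.1).trans (hlow y hy.2)
      · filter_upwards [self_mem_nhdsWithin] with y hy
        exact hup y hy
    rcases hx.2.eq_or_lt with rfl | hx1
    · rw [ContinuousWithinAt, h1]
      refine tendsto_order.2 ⟨fun a ha => ?_, fun b hb => ?_⟩
      · obtain ⟨n, hn⟩ := exists_nat_one_div_lt (sub_pos.2 ha)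
        have hcont : ContinuousAt (fun x => 1 - 1 / ((n : ℝ) + 1) - K n * (1 - x)) 1 := by fun_prop
        have := hcont.eventually_const_lt (u := a) (by simp only [sub_self, mul_zero]; linarith)
        filter_upwards [nhdsWithin_le_nhds this, self_mem_nhdsWithin] with y hy hy'
        exact hy.trans_le ((le_max_right _ _).trans (le_gluing hc0.le hc1 hK hy'.2 n))
      · filter_upwards [self_mem_nhdsWithin] with y hy
        exact ((hup y hy).trans hy.2).trans_lt hb
    · exact (((convexOn_gluing hc0.le hc1 hK).continuousOn isOpen_Ioo).continuousAt
        (Ioo_mem_nhds hx0 hx1)).continuousWithinAt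
  · have hy0 := hx.1.trans_lt hxy
    have := mul_gluing_le hc0.le hc1 hK hx.1 hxy.le hy.2
    have hpos := (mul_pos hc0 hy0).trans_le (hlow y hy.2)
    nlinarith

/-- Only the countably many values `η = 1 / (n + 1)` are used. Lowering `c` to at most `1` and
raising `K` to at least `1` weakens the hypotheses on `q` and gives the normalisation that `gluing`
needs. -/
theorem exists_isGluingFunction {c : ℝ} (hc : 0 < c) {K : ℝ → ℝ} :
    ∃ h : ℝ → ℝ, IsGluingFunction h ∧
      (∃ c₀ : ℝ, 0 < c₀ ∧ ∀ x ∈ Icc (0 : ℝ) 1, c₀ * x ≤ h x) ∧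
      ∀ x ∈ Icc (0 : ℝ) 1, ∀ q : ℝ, c * x ≤ q → (∀ η > 0, 1 - q ≤ η + K η * (1 - x)) →
        h x ≤ q := by
  have hc0 : 0 < min c 1 := lt_min hc one_pos
  have hK : ∀ n : ℕ, 1 ≤ max (K (1 / ((n : ℝ) + 1))) 1 := fun n => le_max_right _ _
  refine ⟨gluing (min c 1) fun n => max (K (1 / ((n : ℝ) + 1))) 1,
    isGluingFunction_gluing hc0 (min_le_right _ _) hK, ⟨min c 1, hc0, fun x hx =>
      (le_max_left _ _).trans (le_gluing hc0.le (min_le_right _ _) hK hx.2 0)⟩,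
    fun x hx q h1 h2 => gluing_le ?_ fun n => ?_⟩
  · exact (mul_le_mul_of_nonneg_right (min_le_left _ _) hx.1).trans h1
  · exact (h2 _ (by positivity)).trans (add_le_add_right
      (mul_le_mul_of_nonneg_right (le_max_left _ _) (sub_nonneg.2 hx.2)) _)

end Gluing

/-! ### Proof of the gluing lemma -/

open MeasureTheory in
theorem measurableSet_of_clip {α : Type*} {I : Set α} (hI : I.Finite) {E : Set (α → Bool)}
    (hE : ∀ ω, clip I ω ∈ E ↔ ω ∈ E) : MeasurableSet E := by
  classical
  obtain ⟨I, rfl⟩ := hI.exists_finset_coe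
  have hpre : E = I.restrict ⁻¹' {η | extendFalse I η ∈ E} := by
    ext ω
    change ω ∈ E ↔ extendFalse I (I.restrict ω) ∈ E
    rw [extendFalse_restrict, hE]
  rw [hpre]
  exact (Finset.measurable_restrict _) (Set.toFinite _).measurableSet

instance (p : unitInterval) : MeasureTheory.IsProbabilityMeasure (percolation k p) :=
  inferInstanceAs (MeasureTheory.IsProbabilityMeasure (MeasureTheory.Measure.infinitePi _))

end SlabPercolation

open SlabPercolation in
theorem theorem3p5 (k : ℕ) (hk : 1 ≤ k) (r : ℕ) (hr : 3 ≤ r) (ε : ℝ) (hε : 0 < ε) :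
    ∃ h₀ : ℝ → ℝ, IsGluingFunction h₀ ∧
      (∃ c₀ : ℝ, 0 < c₀ ∧ ∀ x ∈ Set.Icc (0 : ℝ) 1, c₀ * x ≤ h₀ x) ∧
      ∀ S R : Set (Vertex k), IsBox k (r + 2) S → IsBox k (r + 2) R → S ⊆ R →
      ∀ A B C : Set (Vertex k),
        A ⊆ vertexBoundary S → B ⊆ vertexBoundary S → C ⊆ vertexBoundary R →
        FarApart (r + 2) A B → FarApart (r + 2) A C → FarApart (r + 2) B C →
      ∀ p : unitInterval, ε ≤ (p : ℝ) → (p : ℝ) ≤ 1 - ε →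
        h₀ ((percolation k p).real
            {ω | Connected ω R C (neighborhood S (minimalPath ω S A B) r)}) ≤
          (percolation k p).real {ω | Connected ω R C A} := by
  -- Contacts are taken at radius `r + 1`, one more than the neighbourhood, so that edges leading
  -- into it are seen; the surgery adds 2.
  obtain ⟨M, hM⟩ : ∃ M : ℝ, M = (3 * columnCard k (r + 1 + 2) : ℕ) *
    2 ^ incidentBound k (r + 1 + 2) / ε ^ incidentBound k (r + 1 + 2) := ⟨_, rfl⟩
  have hM0 : 0 ≤ M := by rw [hM]; positivity
  obtain ⟨L, hL⟩ : ∃ L : ℕ → ℝ, ∀ t, L t = 2 ^ (t * incidentBound k (r + 1)) /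
    ε ^ (t * incidentBound k (r + 1)) := ⟨_, fun _ => rfl⟩
  have hL0 : ∀ t, 0 ≤ L t := fun t => by rw [hL]; positivity
  -- The second threshold is chosen after the first, since its error is multiplied by `L t`.
  have hchoose : ∀ η : ℝ, ∃ t t' : ℕ, 0 < η → M / t ≤ η / 2 ∧ L t * (M / t') ≤ η / 2 ∧
      0 < t ∧ 0 < t' := by
    intro η
    by_cases hη : 0 < η
    · have key : ∀ a : ℝ, 0 ≤ a → ∃ t : ℕ, 0 < t ∧ a / t ≤ η / 2 := fun a ha => by
        obtain ⟨t, ht⟩ := exists_nat_gt (a / (η / 2))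
        have ht0 : (0 : ℝ) < t := (by positivity : 0 ≤ a / (η / 2)).trans_lt ht
        refine ⟨t, by exact_mod_cast ht0, ?_⟩
        rw [div_lt_iff₀ (by positivity)] at ht
        rw [div_le_iff₀ ht0]
        linarith
      obtain ⟨t, ht, h1⟩ := key M hM0
      obtain ⟨t', ht', h2⟩ := key (L t * M) (mul_nonneg (hL0 t) hM0)
      exact ⟨t, t', fun _ => ⟨h1, by rwa [← mul_div_assoc], ht, ht'⟩⟩
    · exact ⟨0, 0, fun h => (hη h).elim⟩
  choose T T' hT using hchoose
  obtain ⟨h, h1, h2, h3⟩ := exists_isGluingFunction (c := 1 / (1 + M)) (by positivity)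
    (K := fun η => L (T η) * L (T' η))
  refine ⟨h, h1, h2, fun S R hS hR hSR A B C hA _ hC _ hAC _ p hp0 hp1 => ?_⟩
  have hAR : A ⊆ R := fun a ha => hSR (hA ha).1
  have hCR : C ⊆ R := fun c hc => (hC hc).1
  set P := percolation k p
  set q := P.real {ω | Connected ω R C A}
  set x := P.real {ω | Connected ω R C (neighborhood S (minimalPath ω S A B) r)}
  have hq1 : q ≤ 1 := MeasureTheory.measureReal_le_one
  have hcontacts : ∀ t : ℕ, t * P.real {ω | ¬Connected ω R C A ∧
      t ≤ (contacts ω S R A B C (r + 1)).ncard} ≤ M * q := fun t => by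
    have := mul_real_contacts_le (B := B) (C := C) hk (by omega) hε hp0 hp1 hS hR hSR hAR t (r + 1)
    rw [hM, div_mul_eq_mul_div, le_div_iff₀ (by positivity)]
    refine le_trans (le_of_eq ?_) this
    ring
  have hseparate : ∀ t : ℕ, P.real {ω | ¬Connected ω R C A ∧
      (contacts ω S R A B C (r + 1)).ncard < t} ≤
      L t * P.real {ω | ¬Connected ω R C A ∧ ∀ v ∈ cluster ω R A, ∀ c ∈ C, v ∉ column c r} :=
    fun t => by
      have := mul_real_separate_le (B := B) hε hp0 hp1 hR.finite hSR hCR hAC t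
      rw [hL, div_mul_eq_mul_div, le_div_iff₀ (by positivity), mul_comm]
      exact this
  have hcompl : P.real {ω | ¬Connected ω R C (neighborhood S (minimalPath ω S A B) r)} = 1 - x :=
    MeasureTheory.probReal_compl_eq_one_sub (measurableSet_of_clip
      (regionEdges_finite_and_ncard_le hR.finite).1 (connected_neighborhood_clip hSR))
  have hseparate' : ∀ t : ℕ, P.real {ω | (¬Connected ω R C A ∧
      ∀ v ∈ cluster ω R A, ∀ c ∈ C, v ∉ column c r) ∧
      (contacts ω S R A B C (r + 1)).ncard < t} ≤ L t * (1 - x) := fun t => by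
    have := mul_real_separate_path_le (A := A) (B := B) (C := C) (r := r) hε hp0 hp1 hR.finite hSR t
    rw [hcompl] at this
    rw [hL, div_mul_eq_mul_div, le_div_iff₀ (by positivity), mul_comm]
    exact this
  have hsplit : ∀ (E F G : Set (Config k)), E ⊆ F ∪ G → P.real E ≤ P.real F + P.real G :=
    fun E F G h => (MeasureTheory.measureReal_mono h).trans (MeasureTheory.measureReal_union_le _ _)
  refine h3 x ⟨MeasureTheory.measureReal_nonneg, MeasureTheory.measureReal_le_one⟩ q ?_
    fun η hη => ?_
  -- If `C` is joined to the neighbourhood but not to `A`, the vertex reached is a contact. The case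
  -- `t = 1` then gives `x ≤ q + M * q`.
  · rw [one_div_mul_eq_div, div_le_iff₀ (by positivity)]
    have hx := hsplit {ω | Connected ω R C (neighborhood S (minimalPath ω S A B) r)}
      {ω | Connected ω R C A}
      {ω | ¬Connected ω R C A ∧ 1 ≤ (contacts ω S R A B C (r + 1)).ncard} fun ω hω => by
        by_cases hc : Connected ω R C A
        · exact .inl hc
        · refine .inr ⟨hc, ?_⟩
          obtain ⟨v, ⟨⟨-, y, hy, hvy⟩, -⟩, hv⟩ := connected_iff.1 hω
          refine (Set.ncard_pos (hR.finite.subset contacts_subset)).2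
            ⟨v, .inr ⟨hv, y, hy, column_mono (by omega) hvy⟩⟩
    have := hcontacts 1
    push_cast at this
    linarith
  -- Writing `T`, `T'` for the thresholds, the two rounds give `1 - q ≤ M / T + L T * (M / T' + L T'
  -- * (1 - x))`, and each of the two terms free of `1 - x` is at most `η / 2`.
  · obtain ⟨e1, e2, ht, ht'⟩ := hT η hη
    have hbound : ∀ t : ℕ, 0 < t → P.real {ω | ¬Connected ω R C A ∧
        t ≤ (contacts ω S R A B C (r + 1)).ncard} ≤ M / t := fun t ht => by
      rw [le_div_iff₀ (by exact_mod_cast ht), mul_comm]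
      exact (hcontacts t).trans (mul_le_of_le_one_right hM0 hq1)
    have f1 : 1 ≤ q + P.real {ω | ¬Connected ω R C A} := by
      rw [← MeasureTheory.probReal_univ (μ := P)]
      exact hsplit _ _ _ fun ω _ => em (Connected ω R C A)
    have f2 := hsplit {ω | ¬Connected ω R C A}
      {ω | ¬Connected ω R C A ∧ T η ≤ (contacts ω S R A B C (r + 1)).ncard}
      {ω | ¬Connected ω R C A ∧ (contacts ω S R A B C (r + 1)).ncard < T η} fun ω hω =>
        (le_or_gt _ _).imp (⟨hω, ·⟩) (⟨hω, ·⟩)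
    have f3 := hsplit
      {ω | ¬Connected ω R C A ∧ ∀ v ∈ cluster ω R A, ∀ c ∈ C, v ∉ column c r}
      {ω | ¬Connected ω R C A ∧ T' η ≤ (contacts ω S R A B C (r + 1)).ncard}
      {ω | (¬Connected ω R C A ∧ ∀ v ∈ cluster ω R A, ∀ c ∈ C, v ∉ column c r) ∧
        (contacts ω S R A B C (r + 1)).ncard < T' η} fun ω hω =>
        (le_or_gt _ _).imp (⟨hω.1, ·⟩) (⟨hω, ·⟩)
    have f4 := hbound _ ht
    have f5 := hbound _ ht'
    have f6 := hseparate (T η)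
    have f7 := hseparate' (T' η)
    have f8 := mul_le_mul_of_nonneg_left (f3.trans (add_le_add f5 f7)) (hL0 (T η))
    rw [mul_add, ← mul_assoc] at f8
    linarith
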